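/- **Theorem 1.1.** Let $M=(pqr)^2$, where $p,q,r$ are distinct primes, and let $A,B\subseteq \mathbb Z_M$ with $0\in A\cap B$ and $|A|=|B|=pqr$ be such that neither $A$ nor $B$ is contained in a proper subgroup of $\mathbb Z_M$. Then $A\oplus B=\mathbb Z_M$ (that is, every $g\in\mathbb Z_M$ can be written uniquely as $g=a+b$ with $a\in A$, $b\in B$) if and only if $(A,B)$ or $(B,A)$ is a Szabó pair. Here, for $E\subseteq\mathbb Z_M$, $\lambda\in\{p,q,r\}$ and an integer $s$, write $\mathcal C^\lambda_s(E)=\{x\in E: x\equiv s \pmod \lambda\}$. For $(a,b,c)$ a permutation of $(p,q,r)$ and $\ell\in\{0,\dots,a-1\}$, let $\tau_a(\ell)\in\{0,1,\dots,a-1\}$ be the number with $\tau_a(\ell)\,b^2c^2\equiv \ell\pmod a$. A pair $(A,B)$ of subsets of $\mathbb Z_M$ with $0\in A$, $0\in B$ and $|A|=|B|=pqr$ is a *Szabó pair* if (I) holds and, after replacing $B$ by $B-b$ for some $b\in B$, conditions (II)–(IV) hold: (I) $A=q^2r^2U+r^2p^2V+p^2q^2W$ (in $\mathbb Z_M$)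 for some sets of integers $U=\{u_i\}_{i=0}^{p-1}$, $V=\{v_j\}_{j=0}^{q-1}$, $W=\{w_k\}_{k=0}^{r-1}$ with $u_0=v_0=w_0=0$, $u_i\equiv i\pmod p$, $v_j\equiv j\pmod q$, $w_k\equiv k\pmod r$. (II) $B=B_{qr}\cup B_{rp}\cup B_{pq}\cup B_{pqr}$, where the sets $B_{pqr}=B\cap pqr\mathbb Z$, $B_{qr}=(B\cap qr\mathbb Z)\setminus B_{pqr}$, $B_{rp}=(B\cap rp\mathbb Z)\setminus B_{pqr}$ and $B_{pq}=(B\cap pq\mathbb Z)\setminus B_{pqr}$ are all nonempty. (III) $\mathcal C^p_i(B_{qr})=\mathcal C^p_i(B_{qr})+pq^2r^2$ for $1\le i\le p-1$; $\mathcal C^q_j(B_{rp})=\mathcal C^q_j(B_{rp})+qr^2p^2$ for $1\le j\le q-1$; $\mathcal C^r_k(B_{pq})=\mathcal C^r_k(B_{pq})+rp^2q^2$ for $1\le k\le r-1$. (IV) $\widehat{B_{qr}}\cup\widehat{B_{rp}}\cup\widehat{B_{pq}}\cup B_{pqr}=pqr\{0,1,\dots,pqr-1\}$, where $\widehat{B_{qr}}=\bigcup_{i=1}^{p-1}\big(\mathcal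 C^p_i(B_{qr})-\tau_p(i)q^2r^2\big)$, $\widehat{B_{rp}}=\bigcup_{j=1}^{q-1}\big(\mathcal C^q_j(B_{rp})-\tau_q(j)r^2p^2\big)$, $\widehat{B_{pq}}=\bigcup_{k=1}^{r-1}\big(\mathcal C^r_k(B_{pq})-\tau_r(k)p^2q^2\big)$. -/

import Mathlib

/-- The elements of `E ⊆ ℤ_M` that lie in `nℤ`, i.e. that are multiples of `n` in `ℤ_M`. -/
def multiplesIn {M : ℕ} (n : ℕ) (E : Set (ZMod M)) : Set (ZMod M) :=
  {x | x ∈ E ∧ (n : ZMod M) ∣ x}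

/-- `residueClass l s E = {x ∈ E : x ≡ s (mod l)}`, for a divisor `l` of `M`. -/
def residueClass {M : ℕ} (l s : ℕ) (E : Set (ZMod M)) : Set (ZMod M) :=
  {x | x ∈ E ∧ (l : ZMod M) ∣ x - (s : ZMod M)}

/-- `U = {u_0, …, u_{n-1}}` is a set of integers with `u_0 = 0` and `u_i ≡ i (mod n)`. -/
def IsNormalizedResidueSystem (n : ℕ) (U : Set ℤ) : Prop :=
  ∃ u : ℕ → ℤ, u 0 = 0 ∧ (∀ i < n, u i ≡ (i : ℤ) [ZMOD (n : ℤ)]) ∧ U = u '' Set.Iio n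

/-- The number `τ ∈ {0, …, a - 1}` with `τ b² c² ≡ l (mod a)`, for `a` coprime to `b` and `c`. -/
def tau (a b c l : ℕ) : ℕ :=
  ((l : ZMod a) * ((b ^ 2 * c ^ 2 : ℕ) : ZMod a)⁻¹).val

theorem tau_lt {a : ℕ} (ha : 0 < a) (b c l : ℕ) : tau a b c l < a := by
  have : NeZero a := ⟨ha.ne'⟩
  exact ZMod.val_lt _

theorem tau_modEq {a b c : ℕ} (ha : 0 < a) (hb : b.Coprime a) (hc : c.Coprime a) (l : ℕ) :
    tau a b c l * (b ^ 2 * c ^ 2) ≡ l [MOD a] := by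
  have : NeZero a := ⟨ha.ne'⟩
  have h : (b ^ 2 * c ^ 2).Coprime a :=
    Nat.Coprime.mul_left (Nat.Coprime.pow_left 2 hb) (Nat.Coprime.pow_left 2 hc)
  have h1 := ZMod.coe_mul_inv_eq_one _ h
  rw [← ZMod.natCast_eq_natCast_iff, Nat.cast_mul, tau, ZMod.natCast_zmod_val, mul_assoc,
    mul_comm (_⁻¹), h1, mul_one]

/-- The union over `l = 1, …, a - 1` of the translates `residueClass a l E - τ_a(l) b² c²`. -/
def hatSet {M : ℕ} (a b c : ℕ) (E : Set (ZMod M)) : Set (ZMod M) :=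
  ⋃ l ∈ Set.Ico 1 a,
    (fun x : ZMod M => x - ((tau a b c l * (b ^ 2 * c ^ 2) : ℕ) : ZMod M)) '' residueClass a l E

/-- `B_{bc} = (B ∩ bcℤ) \ (B ∩ abcℤ)`. -/
def pairPart {M : ℕ} (a b c : ℕ) (B : Set (ZMod M)) : Set (ZMod M) :=
  multiplesIn (b * c) B \ multiplesIn (a * b * c) B

/-- The condition on the first member of a Szabó pair:
`A = q²r² U + r²p² V + p²q² W` for normalized residue systems `U`, `V`, `W`. -/
def SzaboLeft (p q r : ℕ) (A : Set (ZMod ((p * q * r) ^ 2))) : Prop :=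
  ∃ U V W : Set ℤ, IsNormalizedResidueSystem p U ∧ IsNormalizedResidueSystem q V ∧
    IsNormalizedResidueSystem r W ∧
    A = {x | ∃ u ∈ U, ∃ v ∈ V, ∃ w ∈ W,
      x = (((q : ℤ) ^ 2 * (r : ℤ) ^ 2 * u + (r : ℤ) ^ 2 * (p : ℤ) ^ 2 * v
        + (p : ℤ) ^ 2 * (q : ℤ) ^ 2 * w : ℤ) : ZMod ((p * q * r) ^ 2))}

/-- The conditions on the (suitably translated) second member of a Szabó pair. Here
`pairPart p q r B`, `pairPart q r p B`, `pairPart r p q B` are `B_{qr}`, `B_{rp}`, `B_{pq}`. -/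
structure SzaboRight (p q r : ℕ) (B : Set (ZMod ((p * q * r) ^ 2))) : Prop where
  eq_union : B = pairPart p q r B ∪ pairPart q r p B ∪ pairPart r p q B ∪
    multiplesIn (p * q * r) B
  nonempty_qr : (pairPart p q r B).Nonempty
  nonempty_rp : (pairPart q r p B).Nonempty
  nonempty_pq : (pairPart r p q B).Nonempty
  nonempty_pqr : (multiplesIn (p * q * r) B).Nonempty
  periodic_qr : ∀ i ∈ Set.Ico 1 p, residueClass p i (pairPart p q r B) =
    (fun x => x + ((p * q ^ 2 * r ^ 2 : ℕ) : ZMod ((p * q * r) ^ 2))) ''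
      residueClass p i (pairPart p q r B)
  periodic_rp : ∀ j ∈ Set.Ico 1 q, residueClass q j (pairPart q r p B) =
    (fun x => x + ((q * r ^ 2 * p ^ 2 : ℕ) : ZMod ((p * q * r) ^ 2))) ''
      residueClass q j (pairPart q r p B)
  periodic_pq : ∀ k ∈ Set.Ico 1 r, residueClass r k (pairPart r p q B) =
    (fun x => x + ((r * p ^ 2 * q ^ 2 : ℕ) : ZMod ((p * q * r) ^ 2))) ''
      residueClass r k (pairPart r p q B)
  hat_union : hatSet p q r (pairPart p q r B) ∪ hatSet q r p (pairPart q r p B) ∪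
      hatSet r p q (pairPart r p q B) ∪ multiplesIn (p * q * r) B =
    {x | ∃ n < p * q * r, x = ((p * q * r * n : ℕ) : ZMod ((p * q * r) ^ 2))}

/-- `(A, B)` is a Szabó pair in `ℤ_{(pqr)²}`; the conditions on `B` are required of some
translate `B - b` with `b ∈ B`. -/
structure IsSzaboPair (p q r : ℕ) (A B : Set (ZMod ((p * q * r) ^ 2))) : Prop where
  zero_mem_left : 0 ∈ A
  zero_mem_right : 0 ∈ B
  card_left : A.ncard = p * q * r
  card_right : B.ncard = p * q * r
  left : SzaboLeft p q r A
  right : ∃ b ∈ B, SzaboRight p q r ((fun x => x - b) '' B)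

/-! An element of `ZMod ((p * q * r) ^ 2)` is encoded by its two lowest digits in bases p, q and r,
that is, by a leaf in each of three trees of depth two. Only the depth at which two elements branch
in each tree matters. A tiling may be dilated by any unit in one factor (`Tiles.nsmul`), so no
difference of A can be a unit multiple of a difference of B, apart from zero. Since the unit orbit
of an element is fixed by its prime-power divisibilities, the differences of A and B share no
nontrivial branching type. This is the structure `Factorization`, and the hard direction uses
nothing else until the final translation.

Counting turns this disjointness into orthogonality. For every triple of tree automorphisms exactly
one pair (a, b) is matched, and integer combinations of these identities give
`Factorization.kill_or`: each nonconstant component (l, m, n) of depths vanishes on A or on B. This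
plays the part of a cyclotomic polynomial dividing one of two mask polynomials, but remains
integral, so vanishing means equal counts and yields divisibility and size estimates.

The top digits of A, or those of B, pairwise agree in some direction, since two pairs disagreeing in
all three directions would have a common type. Say this holds for B. As B is not constant in any
direction, its top triples either all agree with a centre in at least two directions (`IsMajority`)
or form the tetrahedron of even-weight words (`IsTetra`). Vanishing components, with empty cells of
B, exclude the tetrahedron (`IsTetra.not_factorization`). In the majority case they force A to have
equal counts over top digits in every pair of directions (`IsMajority.kill_110`). Each branch of A
is then a rectangular array whose entries in different rows and columns have the same bottom digit,
so the bottom digit depends only on the branch (`color_eq_of_cross`). Hence A is sectional in each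
direction, which is condition (I).

If A is sectional, it realizes every pattern of top digits, so two distinct elements of B must
differ in the bottom digit alone in some direction (`IsSectional.eq_of_rigid`), while B meets every
product of sections (`IsSectional.exists_mem_section`). Suitable sections produce the centre used to
translate B, the full fibres of (III), and the covering of the central cell in (IV).

Conversely, A represents every class modulo pqr, so any g is a plus an element of pqrℤ. By (IV) this
element is in B or is a shifted element of a fibre of B; the shift moves into A, and fibre
periodicity absorbs the error. Cardinality gives uniqueness. -/

set_option linter.unusedSectionVars false

/-! ### Digit trees, branching types and weighted counts -/

/-- Pairs of digits: the leaves of a rooted tree of depth two with `n` branches at each node. -/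
abbrev Dig (n : ℕ) := ZMod n × ZMod n

/-- The pairs `u, u'` and `v, v'` branch at the same depth. -/
def SameType {n : ℕ} (u u' v v' : Dig n) : Prop :=
  (u.1 = u'.1 ↔ v.1 = v'.1) ∧ (u = u' ↔ v = v')

/-- Indicator function of a branch. -/
def topInd {n : ℕ} (i : ZMod n) (u : Dig n) : ℤ := if u.1 = i then 1 else 0

/-- Indicator function of a leaf. -/
def leafInd {n : ℕ} (i t : ZMod n) (u : Dig n) : ℤ := if u.1 = i ∧ u.2 = t then 1 else 0

/-- Differences of sibling indicators at a given depth. -/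
def testFns (n : ℕ) : ℕ → Set (Dig n → ℤ)
  | 0 => {1}
  | 1 => {f | ∃ i i', f = topInd i - topInd i'}
  | _ => {f | ∃ i t t', f = leafInd i t - leafInd i t'}

section
variable {α : Type*} {p q r : ℕ}

/-- Weighted count of `A` against a product function. -/
def wt (x : α → Dig p) (y : α → Dig q) (z : α → Dig r) (A : Finset α)
    (f : Dig p → ℤ) (g : Dig q → ℤ) (h : Dig r → ℤ) : ℤ :=
  ∑ a ∈ A, f (x a) * g (y a) * h (z a)

/-- The component of the indicator function of `A` of the given depths vanishes. -/
def Kill (x : α → Dig p) (y : α → Dig q) (z : α → Dig r) (A : Finset α) (l m n : ℕ) : Prop :=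
  ∀ f ∈ testFns p l, ∀ g ∈ testFns q m, ∀ h ∈ testFns r n, wt x y z A f g h = 0

/-- Two sets of equal size `pqr` without common nontrivial difference types, neither of which
lies in a single branch of one of the three trees. -/
structure Factorization (x : α → Dig p) (y : α → Dig q) (z : α → Dig r) (A B : Finset α) :
    Prop where
  pq : p ≠ q
  qr : q ≠ r
  pr : p ≠ r
  cardA : A.card = p * q * r
  cardB : B.card = p * q * r
  disj : ∀ a ∈ A, ∀ a' ∈ A, ∀ b ∈ B, ∀ b' ∈ B, SameType (x a) (x a') (x b) (x b') →
    SameType (y a) (y a') (y b) (y b') → SameType (z a) (z a') (z b) (z b') → a = a' ∧ b = b'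
  spreadAx : ∀ i, ∃ a ∈ A, (x a).1 ≠ i
  spreadAy : ∀ i, ∃ a ∈ A, (y a).1 ≠ i
  spreadAz : ∀ i, ∃ a ∈ A, (z a).1 ≠ i
  spreadBx : ∀ i, ∃ b ∈ B, (x b).1 ≠ i
  spreadBy : ∀ i, ∃ b ∈ B, (y b).1 ≠ i
  spreadBz : ∀ i, ∃ b ∈ B, (z b).1 ≠ i

variable {x : α → Dig p} {y : α → Dig q} {z : α → Dig r} {A B : Finset α}

theorem SameType.symm {n : ℕ} {u u' v v' : Dig n} (h : SameType u u' v v') :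
    SameType v v' u u' := ⟨h.1.symm, h.2.symm⟩

theorem Factorization.swap (F : Factorization x y z A B) : Factorization x y z B A where
  pq := F.pq
  qr := F.qr
  pr := F.pr
  cardA := F.cardB
  cardB := F.cardA
  disj a ha a' ha' b hb b' hb' h1 h2 h3 :=
    (F.disj b hb b' hb' a ha a' ha' h1.symm h2.symm h3.symm).symm
  spreadAx := F.spreadBx
  spreadAy := F.spreadBy
  spreadAz := F.spreadBz
  spreadBx := F.spreadAx
  spreadBy := F.spreadAy
  spreadBz := F.spreadAz

theorem Factorization.swap_xy (F : Factorization x y z A B) : Factorization y x z A B where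
  pq := F.pq.symm
  qr := F.pr
  pr := F.qr
  cardA := by rw [F.cardA]; ring
  cardB := by rw [F.cardB]; ring
  disj a ha a' ha' b hb b' hb' h1 h2 h3 := F.disj a ha a' ha' b hb b' hb' h2 h1 h3
  spreadAx := F.spreadAy
  spreadAy := F.spreadAx
  spreadAz := F.spreadAz
  spreadBx := F.spreadBy
  spreadBy := F.spreadBx
  spreadBz := F.spreadBz

theorem Factorization.swap_yz (F : Factorization x y z A B) : Factorization x z y A B where
  pq := F.pr
  qr := F.qr.symm
  pr := F.pq
  cardA := by rw [F.cardA]; ring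
  cardB := by rw [F.cardB]; ring
  disj a ha a' ha' b hb b' hb' h1 h2 h3 := F.disj a ha a' ha' b hb b' hb' h1 h3 h2
  spreadAx := F.spreadAx
  spreadAy := F.spreadAz
  spreadAz := F.spreadAy
  spreadBx := F.spreadBx
  spreadBy := F.spreadBz
  spreadBz := F.spreadBy

theorem wt_swap_xy (f : Dig p → ℤ) (g : Dig q → ℤ) (h : Dig r → ℤ) :
    wt y x z A g f h = wt x y z A f g h :=
  Finset.sum_congr rfl fun a _ => by ring

theorem wt_swap_yz (f : Dig p → ℤ) (g : Dig q → ℤ) (h : Dig r → ℤ) :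
    wt x z y A f h g = wt x y z A f g h :=
  Finset.sum_congr rfl fun a _ => by ring

theorem kill_swap_xy {l m n : ℕ} : Kill y x z A m l n ↔ Kill x y z A l m n :=
  ⟨fun H f hf g hg h hh => by rw [← wt_swap_xy]; exact H g hg f hf h hh,
    fun H g hg f hf h hh => by rw [wt_swap_xy]; exact H f hf g hg h hh⟩

theorem kill_swap_yz {l m n : ℕ} : Kill x z y A l n m ↔ Kill x y z A l m n :=
  ⟨fun H f hf g hg h hh => by rw [← wt_swap_yz]; exact H f hf h hh g hg,
    fun H f hf h hh g hg => by rw [wt_swap_yz]; exact H f hf g hg h hh⟩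

/-! ### Averaging over tree automorphisms -/

/-- Integer combinations, with coefficient sum `c`, of the permutation matrices of tree
automorphisms. -/
inductive AutComb {n : ℕ} : (Dig n → Dig n → ℤ) → ℤ → Prop
  | aut (e : Equiv.Perm (ZMod n)) (s : ZMod n → Equiv.Perm (ZMod n)) :
    AutComb (fun u v => if u = Equiv.prodShear e s v then 1 else 0) 1
  | zero : AutComb 0 0
  | add {K K' c c'} : AutComb K c → AutComb K' c' → AutComb (K + K') (c + c')
  | neg {K c} : AutComb K c → AutComb (-K) (-c)

theorem AutComb.sub {n : ℕ} {K K' : Dig n → Dig n → ℤ} {c c' : ℤ} (h : AutComb K c)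
    (h' : AutComb K' c') : AutComb (K - K') (c - c') := by
  rw [sub_eq_add_neg, sub_eq_add_neg]; exact h.add h'.neg

theorem AutComb.sum {n : ℕ} {ι : Type*} (s : Finset ι) {K : ι → Dig n → Dig n → ℤ} {c : ι → ℤ}
    (h : ∀ i ∈ s, AutComb (K i) (c i)) : AutComb (∑ i ∈ s, K i) (∑ i ∈ s, c i) := by
  classical
  induction s using Finset.induction_on with
  | empty => simpa using AutComb.zero
  | insert a s ha ih =>
    rw [Finset.sum_insert ha, Finset.sum_insert ha]
    exact (h a (by simp)).add (ih fun i hi => h i (by simp [hi]))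

theorem AutComb.congr {n : ℕ} {K K' : Dig n → Dig n → ℤ} {c c' : ℤ} (h : AutComb K c)
    (hK : ∀ u v, K u v = K' u v) (hc : c = c') : AutComb K' c' := by
  have : K = K' := funext fun u => funext fun v => hK u v
  rw [← this, ← hc]; exact h

/-- Shifting the leaves of all branches simultaneously by s and summing over s makes the bottom
digits irrelevant. The n summands give the coefficient. -/
theorem autComb_branch {n : ℕ} [NeZero n] (e : Equiv.Perm (ZMod n)) :
    AutComb (fun u v : Dig n => if u.1 = e v.1 then 1 else 0) n := by
  refine (AutComb.sum (Finset.univ : Finset (ZMod n)) (c := fun _ => 1)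
    (fun s _ => AutComb.aut e fun _ => Equiv.addRight s)).congr ?_ (by simp [ZMod.card])
  intro u v
  simp only [Finset.sum_apply, Equiv.prodShear_apply, Equiv.coe_addRight]
  by_cases h : u.1 = e v.1
  · rw [Finset.sum_eq_single (u.2 - v.2)]
    · simp [h, Prod.ext_iff]
    · intro s _ hs
      rw [if_neg]
      rintro rfl
      exact hs (by simp)
    · simp
  · rw [if_neg h]
    refine Finset.sum_eq_zero fun s _ => if_neg ?_
    rintro rfl
    exact h rfl

theorem autComb_one {n : ℕ} [NeZero n] : AutComb (fun _ _ : Dig n => 1) (n * n) := by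
  refine (AutComb.sum (Finset.univ : Finset (ZMod n)) (c := fun _ => (n : ℤ))
    (fun s _ => autComb_branch (Equiv.addRight s))).congr ?_ (by simp [ZMod.card])
  intro u v
  simp only [Finset.sum_apply, Equiv.coe_addRight]
  rw [Finset.sum_eq_single (u.1 - v.1)]
  · simp
  · intro s _ hs
    exact if_neg fun h => hs (by simp [h])
  · simp

theorem exists_perm_map_pair {ι : Type*} [DecidableEq ι] {y y' x x' : ι} (hy : y ≠ y')
    (hx : x ≠ x') : ∃ e : Equiv.Perm ι, e y = x ∧ e y' = x' := by
  refine ⟨Equiv.swap (Equiv.swap y x y') x' * Equiv.swap y x, ?_, ?_⟩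
  · have h1 : x ≠ Equiv.swap y x y' := by
      intro h
      have : Equiv.swap y x y = Equiv.swap y x y' := by rw [Equiv.swap_apply_left]; exact h
      exact hy ((Equiv.swap y x).injective this)
    simp [Equiv.swap_apply_of_ne_of_ne h1 hx]
  · simp

/-- A rank-one kernel of two sibling differences is a difference of two automorphism kernels: one
takes the sibling pair of g to that of f, the other does so with the pair interchanged, and they
agree elsewhere. The coefficients cancel, except at depth zero. This is what separates the count
over pairs into a product of a count on A and one on B. -/
theorem autComb_test {n : ℕ} [NeZero n] {l : ℕ} {f g : Dig n → ℤ} (hf : f ∈ testFns n l)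
    (hg : g ∈ testFns n l) : ∃ c, AutComb (fun u v => f u * g v) c ∧ (l ≠ 0 → c = 0) := by
  match l, hf, hg with
  | 0, hf, hg =>
    rw [testFns, Set.mem_singleton_iff] at hf hg
    subst hf hg
    exact ⟨_, autComb_one.congr (by simp) rfl, fun h => absurd rfl h⟩
  | 1, ⟨i, i', hf⟩, ⟨m, m', hg⟩ =>
    refine ⟨0, ?_, fun _ => rfl⟩
    subst hf hg
    by_cases hi : i = i'
    · subst hi; exact AutComb.zero.congr (by simp) rfl
    by_cases hm : m = m'
    · subst hm; exact AutComb.zero.congr (by simp) rfl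
    obtain ⟨e, he, he'⟩ := exists_perm_map_pair hm hi
    refine ((autComb_branch e).sub (autComb_branch (Equiv.swap i i' * e))).congr ?_ (by simp)
    rintro ⟨u, u'⟩ ⟨v, v'⟩
    simp only [Pi.sub_apply, topInd, Equiv.Perm.mul_apply]
    by_cases h1 : v = m
    · subst h1; simp [he, hm]
    by_cases h2 : v = m'
    · subst h2; simp [he', h1]
    have h3 : e v ≠ i := fun h => h1 (e.injective (h.trans he.symm))
    have h4 : e v ≠ i' := fun h => h2 (e.injective (h.trans he'.symm))
    simp [h1, h2, Equiv.swap_apply_of_ne_of_ne h3 h4]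
  | (k + 2), ⟨i, t, t', hf⟩, ⟨m, s, s', hg⟩ =>
    refine ⟨0, ?_, fun _ => rfl⟩
    subst hf hg
    by_cases ht : t = t'
    · subst ht; exact AutComb.zero.congr (by simp) rfl
    by_cases hs : s = s'
    · subst hs; exact AutComb.zero.congr (by simp) rfl
    obtain ⟨e, he, he'⟩ := exists_perm_map_pair hs ht
    refine ((AutComb.aut (Equiv.swap m i) fun _ => e).sub (AutComb.aut (Equiv.swap m i)
      fun j => if j = m then Equiv.swap t t' * e else e)).congr ?_ (by simp)
    rintro ⟨u, u'⟩ ⟨v, v'⟩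
    simp only [Pi.sub_apply, leafInd, Equiv.prodShear_apply, Prod.mk.injEq]
    by_cases hv : v = m
    swap
    · simp [hv]
    subst hv
    simp only [Equiv.swap_apply_left, if_true, Equiv.Perm.mul_apply, true_and]
    by_cases h1 : v' = s
    · subst h1; simp [he, hs]
    by_cases h2 : v' = s'
    · subst h2; simp [he', h1]
    have h3 : e v' ≠ t := fun h => h1 (e.injective (h.trans he.symm))
    have h4 : e v' ≠ t' := fun h => h2 (e.injective (h.trans he'.symm))
    simp [h1, h2, Equiv.swap_apply_of_ne_of_ne h3 h4]

section fundamental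
variable [NeZero p] [NeZero q] [NeZero r]

theorem sameType_prodShear {n : ℕ} (e : Equiv.Perm (ZMod n)) (s : ZMod n → Equiv.Perm (ZMod n))
    {u u' v v' t : Dig n} (h : u - Equiv.prodShear e s v = t)
    (h' : u' - Equiv.prodShear e s v' = t) : SameType u u' v v' := by
  rw [sub_eq_iff_eq_add] at h h'
  subst h h'
  refine ⟨?_, ?_⟩
  · simp
  · rw [add_right_inj, (Equiv.prodShear e s).apply_eq_iff_eq]

/-- Equal values of `φ` at two pairs mean equal branching types, because automorphisms and
translations preserve branching depth; `disj` then makes `φ` injective. Domain and codomain both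
have (pqr)² elements, so the value 0 is attained exactly once. -/
theorem Factorization.existsUnique_pair (F : Factorization x y z A B)
    (e₁ : Equiv.Perm (ZMod p)) (s₁ : ZMod p → Equiv.Perm (ZMod p))
    (e₂ : Equiv.Perm (ZMod q)) (s₂ : ZMod q → Equiv.Perm (ZMod q))
    (e₃ : Equiv.Perm (ZMod r)) (s₃ : ZMod r → Equiv.Perm (ZMod r)) :
    ∃! c : α × α, c ∈ A ×ˢ B ∧ x c.1 = Equiv.prodShear e₁ s₁ (x c.2) ∧
      y c.1 = Equiv.prodShear e₂ s₂ (y c.2) ∧ z c.1 = Equiv.prodShear e₃ s₃ (z c.2) := by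
  classical
  let φ : α × α → Dig p × Dig q × Dig r := fun c =>
    (x c.1 - Equiv.prodShear e₁ s₁ (x c.2), y c.1 - Equiv.prodShear e₂ s₂ (y c.2),
      z c.1 - Equiv.prodShear e₃ s₃ (z c.2))
  have hinj : Set.InjOn φ (A ×ˢ B : Finset (α × α)) := by
    rintro ⟨a, b⟩ hc ⟨a', b'⟩ hc' h
    simp only [Finset.coe_product, Set.mem_prod, Finset.mem_coe] at hc hc'
    simp only [φ, Prod.mk.injEq] at h
    obtain ⟨rfl, rfl⟩ := F.disj a hc.1 a' hc'.1 b hc.2 b' hc'.2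
      (sameType_prodShear _ _ h.1 rfl) (sameType_prodShear _ _ h.2.1 rfl)
      (sameType_prodShear _ _ h.2.2 rfl)
    rfl
  have himg : (A ×ˢ B).image φ = Finset.univ := by
    apply Finset.eq_univ_of_card
    rw [Finset.card_image_of_injOn hinj, Finset.card_product, F.cardA, F.cardB]
    simp only [Fintype.card_prod, ZMod.card]
    ring
  have h0 : (0 : Dig p × Dig q × Dig r) ∈ (A ×ˢ B).image φ := by rw [himg]; simp
  have key : ∀ c : α × α, (x c.1 = Equiv.prodShear e₁ s₁ (x c.2) ∧
      y c.1 = Equiv.prodShear e₂ s₂ (y c.2) ∧ z c.1 = Equiv.prodShear e₃ s₃ (z c.2)) ↔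
      φ c = 0 := by
    intro c
    simp only [φ, Prod.mk_eq_zero, sub_eq_zero]
  obtain ⟨c, hc, hc0⟩ := Finset.mem_image.1 h0
  refine ⟨c, ⟨hc, (key c).2 hc0⟩, ?_⟩
  rintro c' ⟨hc', h'⟩
  exact hinj hc' hc (((key c').1 h').trans hc0.symm)

/-- For permutation kernels this is the unique matched pair, contributing 1; both sides are additive
in each kernel separately. -/
theorem Factorization.sum_aut (F : Factorization x y z A B)
    {K₁ : Dig p → Dig p → ℤ} {K₂ : Dig q → Dig q → ℤ} {K₃ : Dig r → Dig r → ℤ} {c₁ c₂ c₃ : ℤ}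
    (h₁ : AutComb K₁ c₁) (h₂ : AutComb K₂ c₂) (h₃ : AutComb K₃ c₃) :
    ∑ c ∈ A ×ˢ B, K₁ (x c.1) (x c.2) * K₂ (y c.1) (y c.2) * K₃ (z c.1) (z c.2) =
      c₁ * c₂ * c₃ := by
  classical
  induction h₁ with
  | zero => simp
  | add _ _ ih ih' => simp only [Pi.add_apply, add_mul, Finset.sum_add_distrib, ih, ih']
  | neg _ ih => simp only [Pi.neg_apply, neg_mul, Finset.sum_neg_distrib, ih]
  | aut e₁ s₁ =>
  induction h₂ with
  | zero => simp
  | add _ _ ih ih' =>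
    simp only [Pi.add_apply, mul_add, add_mul, Finset.sum_add_distrib, ih, ih']
  | neg _ ih => simp only [Pi.neg_apply, mul_neg, neg_mul, Finset.sum_neg_distrib, ih]
  | aut e₂ s₂ =>
  induction h₃ with
  | zero => simp
  | add _ _ ih ih' =>
    simp only [Pi.add_apply, mul_add, Finset.sum_add_distrib, ih, ih']
  | neg _ ih => simp only [Pi.neg_apply, mul_neg, Finset.sum_neg_distrib, ih]
  | aut e₃ s₃ =>
  obtain ⟨c, ⟨hc, h1, h2, h3⟩, huniq⟩ := F.existsUnique_pair e₁ s₁ e₂ s₂ e₃ s₃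
  rw [Finset.sum_eq_single c]
  · simp [h1, h2, h3]
  · intro c' hc' hne
    by_contra h
    apply hne
    apply huniq
    refine ⟨hc', ?_⟩
    by_contra h'
    apply h
    beta_reduce
    by_cases k1 : x c'.1 = Equiv.prodShear e₁ s₁ (x c'.2)
    · by_cases k2 : y c'.1 = Equiv.prodShear e₂ s₂ (y c'.2)
      · have k3 : ¬ z c'.1 = Equiv.prodShear e₃ s₃ (z c'.2) := fun k3 => h' ⟨k1, k2, k3⟩
        rw [if_neg k3, mul_zero]
      · rw [if_neg k2, mul_zero, zero_mul]
    · rw [if_neg k1, zero_mul, zero_mul]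
  · exact fun h => absurd hc h

/-- Each nontrivial component is missing from one of the two factors. -/
theorem Factorization.kill_or (F : Factorization x y z A B) (l m n : ℕ)
    (h : l ≠ 0 ∨ m ≠ 0 ∨ n ≠ 0) : Kill x y z A l m n ∨ Kill x y z B l m n := by
  by_contra hcon
  rw [not_or] at hcon
  simp only [Kill, not_forall] at hcon
  obtain ⟨⟨f, hf, g, hg, k, hk, hA⟩, f', hf', g', hg', k', hk', hB⟩ := hcon
  obtain ⟨c₁, hc₁, h₁⟩ := autComb_test hf hf'
  obtain ⟨c₂, hc₂, h₂⟩ := autComb_test hg hg'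
  obtain ⟨c₃, hc₃, h₃⟩ := autComb_test hk hk'
  have hs := F.sum_aut hc₁ hc₂ hc₃
  have h0 : c₁ * c₂ * c₃ = 0 := by
    rcases h with h | h | h
    · simp [h₁ h]
    · simp [h₂ h]
    · simp [h₃ h]
  rw [h0, Finset.sum_product] at hs
  refine mul_ne_zero hA hB ?_
  rw [← hs, wt, wt, Finset.sum_mul_sum]
  exact Finset.sum_congr rfl fun a _ => Finset.sum_congr rfl fun b _ => by ring

end fundamental
end

/-! ### Elementary identities for weighted counts -/

theorem topInd_nonneg {n : ℕ} (i : ZMod n) (u : Dig n) : 0 ≤ topInd i u := by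
  unfold topInd; split_ifs <;> simp

theorem leafInd_nonneg {n : ℕ} (i t : ZMod n) (u : Dig n) : 0 ≤ leafInd i t u := by
  unfold leafInd; split_ifs <;> simp

theorem sum_topInd {n : ℕ} [NeZero n] : ∑ i : ZMod n, topInd i = (1 : Dig n → ℤ) := by
  funext u; simp [topInd]

theorem sum_leafInd {n : ℕ} [NeZero n] (i : ZMod n) :
    ∑ t : ZMod n, leafInd i t = (topInd i : Dig n → ℤ) := by
  funext u
  by_cases h : u.1 = i <;> simp [topInd, leafInd, h]

theorem one_mem_testFns {n : ℕ} : (1 : Dig n → ℤ) ∈ testFns n 0 := rfl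

theorem top_mem_testFns {n : ℕ} (i i' : ZMod n) : topInd i - topInd i' ∈ testFns n 1 := ⟨i, i', rfl⟩

theorem leaf_mem_testFns {n : ℕ} (i t t' : ZMod n) : leafInd i t - leafInd i t' ∈ testFns n 2 :=
  ⟨i, t, t', rfl⟩

section
variable {α : Type*} {p q r : ℕ} {x : α → Dig p} {y : α → Dig q} {z : α → Dig r}
  {A B : Finset α} {f f' : Dig p → ℤ} {g g' : Dig q → ℤ} {h h' : Dig r → ℤ}

theorem wt_sub_x : wt x y z A (f - f') g h = wt x y z A f g h - wt x y z A f' g h := by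
  simp only [wt, Pi.sub_apply, sub_mul, Finset.sum_sub_distrib]

theorem wt_sub_y : wt x y z A f (g - g') h = wt x y z A f g h - wt x y z A f g' h := by
  simp only [wt, Pi.sub_apply, mul_sub, sub_mul, Finset.sum_sub_distrib]

theorem wt_sub_z : wt x y z A f g (h - h') = wt x y z A f g h - wt x y z A f g h' := by
  simp only [wt, Pi.sub_apply, mul_sub, Finset.sum_sub_distrib]

theorem wt_sum_x {ι : Type*} (s : Finset ι) (f : ι → Dig p → ℤ) :
    wt x y z A (∑ i ∈ s, f i) g h = ∑ i ∈ s, wt x y z A (f i) g h := by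
  simp only [wt, Finset.sum_apply, Finset.sum_mul]
  exact Finset.sum_comm

theorem wt_one_one_one : wt x y z A 1 1 1 = A.card := by
  simp [wt]

theorem wt_nonneg (hf : ∀ u, 0 ≤ f u) (hg : ∀ u, 0 ≤ g u) (hh : ∀ u, 0 ≤ h u) :
    0 ≤ wt x y z A f g h :=
  Finset.sum_nonneg fun _ _ => mul_nonneg (mul_nonneg (hf _) (hg _)) (hh _)

theorem wt_congr (H : ∀ a ∈ A, f (x a) * g (y a) * h (z a) = f' (x a) * g' (y a) * h' (z a)) :
    wt x y z A f g h = wt x y z A f' g' h' := Finset.sum_congr rfl H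

theorem wt_eq_zero (H : ∀ a ∈ A, f (x a) * g (y a) * h (z a) = 0) : wt x y z A f g h = 0 :=
  Finset.sum_eq_zero H

theorem wt_le (H : ∀ a ∈ A, f (x a) * g (y a) * h (z a) ≤ f' (x a) * g' (y a) * h' (z a)) :
    wt x y z A f g h ≤ wt x y z A f' g' h' := Finset.sum_le_sum H

theorem wt_pos (hf : ∀ u, 0 ≤ f u) (hg : ∀ u, 0 ≤ g u) (hh : ∀ u, 0 ≤ h u) {a : α} (ha : a ∈ A)
    (H : f (x a) * g (y a) * h (z a) = 1) : 0 < wt x y z A f g h := by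
  have := Finset.single_le_sum (f := fun a => f (x a) * g (y a) * h (z a))
    (fun a _ => mul_nonneg (mul_nonneg (hf _) (hg _)) (hh _)) ha
  simp only [H] at this
  exact this

theorem exists_of_wt_pos (H : 0 < wt x y z A f g h) :
    ∃ a ∈ A, f (x a) * g (y a) * h (z a) ≠ 0 := by
  by_contra hc
  push Not at hc
  exact H.ne' (wt_eq_zero hc)

variable [NeZero p] [NeZero q] [NeZero r]

theorem wt_one_x : wt x y z A 1 g h = ∑ i, wt x y z A (topInd i) g h := by
  rw [← wt_sum_x, sum_topInd]

theorem wt_top_x (i : ZMod p) :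
    wt x y z A (topInd i) g h = ∑ t, wt x y z A (leafInd i t) g h := by
  rw [← wt_sum_x, sum_leafInd]

theorem wt_one_x_of_const {c : ZMod p} {a : ℤ}
    (H : ∀ i, i ≠ c → wt x y z A (topInd i) g h = a) :
    wt x y z A 1 g h = wt x y z A (topInd c) g h + (p - 1) * a := by
  rw [wt_one_x, ← Finset.add_sum_erase _ _ (Finset.mem_univ c),
    Finset.sum_congr rfl fun i hi => H i (Finset.ne_of_mem_erase hi)]
  simp [ZMod.card, Finset.card_erase_of_mem, Nat.cast_sub (NeZero.pos p)]

theorem wt_one_y_of_const {c : ZMod q} {a : ℤ}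
    (H : ∀ i, i ≠ c → wt x y z A f (topInd i) h = a) :
    wt x y z A f 1 h = wt x y z A f (topInd c) h + (q - 1) * a := by
  simp only [← wt_swap_xy (x := x) (y := y)] at H ⊢
  exact wt_one_x_of_const H

theorem wt_one_z_of_const {c : ZMod r} {a : ℤ}
    (H : ∀ i, i ≠ c → wt x y z A f g (topInd i) = a) :
    wt x y z A f g 1 = wt x y z A f g (topInd c) + (r - 1) * a := by
  simp only [← wt_swap_yz (y := y) (z := z)] at H ⊢
  exact wt_one_y_of_const H

theorem mul_wt_top_x (H : ∀ f ∈ testFns p 1, wt x y z A f g h = 0) (i : ZMod p) :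
    p * wt x y z A (topInd i) g h = wt x y z A 1 g h := by
  have hc : ∀ j ∈ Finset.univ, wt x y z A (topInd j) g h = wt x y z A (topInd i) g h := by
    intro j _
    have := H _ (top_mem_testFns j i)
    rw [wt_sub_x] at this
    exact sub_eq_zero.1 this
  rw [wt_one_x, Finset.sum_congr rfl hc, Finset.sum_const]
  simp [ZMod.card]

theorem mul_wt_leaf_x (i : ZMod p) (H : ∀ t t', wt x y z A (leafInd i t) g h =
    wt x y z A (leafInd i t') g h) (t : ZMod p) :
    p * wt x y z A (leafInd i t) g h = wt x y z A (topInd i) g h := by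
  rw [wt_top_x, Finset.sum_congr rfl fun j _ => H j t, Finset.sum_const]
  simp [ZMod.card]

theorem mul_wt_top_y (H : ∀ g ∈ testFns q 1, wt x y z A f g h = 0) (i : ZMod q) :
    q * wt x y z A f (topInd i) h = wt x y z A f 1 h := by
  simp only [← wt_swap_xy (x := x) (y := y)] at H ⊢
  exact mul_wt_top_x H i

theorem mul_wt_leaf_y (i : ZMod q) (H : ∀ t t', wt x y z A f (leafInd i t) h =
    wt x y z A f (leafInd i t') h) (t : ZMod q) :
    q * wt x y z A f (leafInd i t) h = wt x y z A f (topInd i) h := by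
  simp only [← wt_swap_xy (x := x) (y := y)] at H ⊢
  exact mul_wt_leaf_x i H t

theorem mul_wt_leaf_z (i : ZMod r) (H : ∀ t t', wt x y z A f g (leafInd i t) =
    wt x y z A f g (leafInd i t')) (t : ZMod r) :
    r * wt x y z A f g (leafInd i t) = wt x y z A f g (topInd i) := by
  simp only [← wt_swap_yz (y := y) (z := z)] at H ⊢
  exact mul_wt_leaf_y i H t

theorem wt_top_x_eq_zero (H₀ : ∀ f ∈ testFns p 0, wt x y z A f g h = 0)
    (H : ∀ f ∈ testFns p 1, wt x y z A f g h = 0) (i : ZMod p) :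
    wt x y z A (topInd i) g h = 0 := by
  have := mul_wt_top_x H i
  rw [H₀ _ one_mem_testFns] at this
  exact (mul_eq_zero.1 this).resolve_left (by exact_mod_cast NeZero.ne p)

theorem wt_top_y_eq_zero (H₀ : ∀ g ∈ testFns q 0, wt x y z A f g h = 0)
    (H : ∀ g ∈ testFns q 1, wt x y z A f g h = 0) (i : ZMod q) :
    wt x y z A f (topInd i) h = 0 := by
  simp only [← wt_swap_xy (x := x) (y := y)] at H₀ H ⊢
  exact wt_top_x_eq_zero H₀ H i

theorem wt_top_z_eq_zero (H₀ : ∀ h ∈ testFns r 0, wt x y z A f g h = 0)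
    (H : ∀ h ∈ testFns r 1, wt x y z A f g h = 0) (i : ZMod r) :
    wt x y z A f g (topInd i) = 0 := by
  simp only [← wt_swap_yz (y := y) (z := z)] at H₀ H ⊢
  exact wt_top_y_eq_zero H₀ H i

/-- If the bottom digit in direction `z` is determined by the top digit, then a component of
depth two in that direction vanishes only if that of depth zero does. -/
theorem kill_zero_of_kill_two {l m : ℕ} (hr : 1 < r)
    (hz : ∀ a ∈ A, ∀ a' ∈ A, (z a).1 = (z a').1 → (z a).2 = (z a').2)
    (H : Kill x y z A l m 2) : Kill x y z A l m 0 := by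
  have : Fact (1 < r) := ⟨hr⟩
  intro f hf g hg h hh
  rw [testFns, Set.mem_singleton_iff] at hh
  subst hh
  have hk : ∀ k, wt x y z A f g (topInd k) = 0 := by
    intro k
    have H' : ∀ t t', wt x y z A f g (leafInd k t) = wt x y z A f g (leafInd k t') := by
      intro t t'
      have := H f hf g hg _ (leaf_mem_testFns k t t')
      rw [wt_sub_z] at this
      exact sub_eq_zero.1 this
    by_cases hex : ∃ a ∈ A, (z a).1 = k
    · obtain ⟨a, ha, rfl⟩ := hex
      -- Only the leaf with bottom digit `(z a).2` is occupied in this branch. The leaf one further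
      -- on is empty because r > 1, and all leaves have equal weight, so the whole branch has weight
      -- zero.
      rw [← mul_wt_leaf_z _ H' ((z a).2 + 1), wt_eq_zero, mul_zero]
      intro a' ha'
      have : leafInd (z a).1 ((z a).2 + 1) (z a') = 0 := by
        unfold leafInd
        rw [if_neg]
        rintro ⟨h1, h2⟩
        rw [hz a' ha' a ha h1] at h2
        simp at h2
      rw [this, mul_zero]
    · apply wt_eq_zero
      intro a ha
      have : topInd k (z a) = 0 := if_neg fun h => hex ⟨a, ha, h⟩
      rw [this, mul_zero]
  have := wt_one_z_of_const (x := x) (y := y) (z := z) (A := A) (f := f) (g := g) (c := 0)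
    (a := 0) fun i _ => hk i
  rw [this, hk]; simp

end

/-! ### Vanishing components in a single direction -/

section
variable {α : Type*} {p q r : ℕ} {x : α → Dig p} {y : α → Dig q} {z : α → Dig r}
  {A B : Finset α}
variable [hp : Fact p.Prime] [hq : Fact q.Prime] [hr : Fact r.Prime]

theorem Factorization.p_not_dvd (F : Factorization x y z A B) : ¬ (p : ℤ) ∣ q * r := by
  intro h
  have h' : p ∣ q * r := by exact_mod_cast h
  rcases (Nat.Prime.dvd_mul hp.out).1 h' with h | h
  · exact F.pq ((Nat.prime_dvd_prime_iff_eq hp.out hq.out).1 h)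
  · exact F.pr ((Nat.prime_dvd_prime_iff_eq hp.out hr.out).1 h)

theorem Factorization.wtA (F : Factorization x y z A B) :
    wt x y z A 1 1 1 = (p : ℤ) * q * r := by
  rw [wt_one_one_one, F.cardA]; push_cast; ring

theorem Factorization.wtB (F : Factorization x y z A B) :
    wt x y z B 1 1 1 = (p : ℤ) * q * r := F.swap.wtA

theorem Kill.top_x (K : Kill x y z A 1 0 0) (hA : wt x y z A 1 1 1 = (p : ℤ) * q * r)
    (i : ZMod p) : wt x y z A (topInd i) 1 1 = (q : ℤ) * r := by
  have h := mul_wt_top_x (x := x) (y := y) (z := z) (A := A) (g := 1) (h := 1)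
    (fun f hf => K f hf 1 rfl 1 rfl) i
  rw [hA] at h
  have hp0 : (p : ℤ) ≠ 0 := by exact_mod_cast hp.out.ne_zero
  apply mul_left_cancel₀ hp0
  rw [h]; ring

theorem Kill.leaf_x (K : Kill x y z A 2 0 0) (i t : ZMod p) :
    p * wt x y z A (leafInd i t) 1 1 = wt x y z A (topInd i) 1 1 := by
  apply mul_wt_leaf_x
  intro t t'
  have := K _ (leaf_mem_testFns i t t') 1 rfl 1 rfl
  rw [wt_sub_x] at this
  exact sub_eq_zero.1 this

/-- A branch would have qr elements, equally distributed over its p leaves, although p does not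
divide qr. -/
theorem Factorization.not_kill_both (F : Factorization x y z A B) (h1 : Kill x y z A 1 0 0)
    (h2 : Kill x y z A 2 0 0) : False := by
  have h := h1.top_x F.wtA 0
  rw [← h2.leaf_x 0 0] at h
  exact F.p_not_dvd ⟨_, h.symm⟩

/-- In each direction, exactly one factor lacks the depth-one component and exactly the other one
lacks the depth-two component. -/
theorem Factorization.kill_x (F : Factorization x y z A B) :
    (Kill x y z A 1 0 0 ∧ ¬ Kill x y z A 2 0 0 ∧ Kill x y z B 2 0 0 ∧ ¬ Kill x y z B 1 0 0) ∨
    (Kill x y z B 1 0 0 ∧ ¬ Kill x y z B 2 0 0 ∧ Kill x y z A 2 0 0 ∧ ¬ Kill x y z A 1 0 0) := by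
  have hA := F.not_kill_both
  have hB := F.swap.not_kill_both
  have h1 := F.kill_or 1 0 0 (by simp)
  have h2 := F.kill_or 2 0 0 (by simp)
  tauto

theorem Factorization.kill_y (F : Factorization x y z A B) :
    (Kill x y z A 0 1 0 ∧ ¬ Kill x y z A 0 2 0 ∧ Kill x y z B 0 2 0 ∧ ¬ Kill x y z B 0 1 0) ∨
    (Kill x y z B 0 1 0 ∧ ¬ Kill x y z B 0 2 0 ∧ Kill x y z A 0 2 0 ∧ ¬ Kill x y z A 0 1 0) := by
  have := F.swap_xy.kill_x
  simpa only [kill_swap_xy] using this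

theorem Factorization.kill_z (F : Factorization x y z A B) :
    (Kill x y z A 0 0 1 ∧ ¬ Kill x y z A 0 0 2 ∧ Kill x y z B 0 0 2 ∧ ¬ Kill x y z B 0 0 1) ∨
    (Kill x y z B 0 0 1 ∧ ¬ Kill x y z B 0 0 2 ∧ Kill x y z A 0 0 2 ∧ ¬ Kill x y z A 0 0 1) := by
  have := F.swap_yz.kill_y
  simpa only [kill_swap_yz] using this

/-- If the top counts of `A` depend only on the top digit in direction `z`, then either they are
constant or `A` lies in a single branch. -/
theorem Factorization.not_flat (F : Factorization x y z A B) (h100 : Kill x y z A 1 0 0)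
    (h010 : Kill x y z A 0 1 0) (h110 : Kill x y z A 1 1 0) (h101 : Kill x y z A 1 0 1)
    (h011 : Kill x y z A 0 1 1) (h111 : Kill x y z A 1 1 1) (h002 : Kill x y z A 0 0 2) :
    False := by
  -- Vanishing at depths 0 and 1 in a direction gives vanishing against every top indicator there.
  -- Used in y and then z, this shows that top-cell counts do not depend on the x-branch.
  have hxk : ∀ f ∈ testFns p 1, ∀ j k, wt x y z A f (topInd j) (topInd k) = 0 := by
    intro f hf j k
    apply wt_top_y_eq_zero
    · intro g hg
      exact wt_top_z_eq_zero (fun h hh => h100 f hf g hg h hh)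
        (fun h hh => h101 f hf g hg h hh) k
    · intro g hg
      exact wt_top_z_eq_zero (fun h hh => h110 f hf g hg h hh)
        (fun h hh => h111 f hf g hg h hh) k
  have hyk : ∀ g ∈ testFns q 1, ∀ k, wt x y z A 1 g (topInd k) = 0 := by
    intro g hg k
    exact wt_top_z_eq_zero (fun h hh => h010 1 rfl g hg h hh)
        (fun h hh => h011 1 rfl g hg h hh) k
  have hc : ∀ k, (p : ℤ) * (q * wt x y z A (topInd 0) (topInd 0) (topInd k)) =
      wt x y z A 1 1 (topInd k) := by
    intro k
    rw [← mul_wt_top_y (fun g hg => hyk g hg k) 0, ← mul_wt_top_x (fun f hf => hxk f hf 0 k) 0]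
    ring
  have hd : ∀ k, (r : ℤ) ∣ wt x y z A 1 1 (topInd k) := by
    intro k
    refine ⟨wt x y z A 1 1 (leafInd k 0), ?_⟩
    rw [mul_wt_leaf_z]
    intro t t'
    have := h002 1 rfl 1 rfl _ (leaf_mem_testFns k t t')
    rw [wt_sub_z] at this
    exact sub_eq_zero.1 this
  -- Equal cells make a z-branch count divisible by pq, and equal leaves make it divisible by r. A
  -- nonempty branch therefore already contains pqr elements, so there cannot be two.
  have hbig : ∀ a ∈ A, (p : ℤ) * q * r ≤ wt x y z A 1 1 (topInd (z a).1) := by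
    intro a ha
    have hpos : 0 < wt x y z A 1 1 (topInd (z a).1) :=
      wt_pos (by simp) (by simp) (topInd_nonneg _) ha (by simp [topInd])
    apply Int.le_of_dvd hpos
    have hpr : IsCoprime ((p : ℤ) * q) r := by
      rw [← Nat.cast_mul, Nat.isCoprime_iff_coprime]
      exact Nat.Coprime.mul_left ((Nat.coprime_primes hp.out hr.out).2 F.pr)
        ((Nat.coprime_primes hq.out hr.out).2 F.qr)
    refine hpr.mul_dvd ?_ (hd _)
    · rw [← hc]
      exact ⟨wt x y z A (topInd 0) (topInd 0) (topInd (z a).1), by ring⟩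
  obtain ⟨a, ha, -⟩ := F.spreadAz 0
  obtain ⟨a', ha', hne⟩ := F.spreadAz (z a).1
  have h1 := hbig a ha
  have h2 := hbig a' ha'
  have h3 := F.wtA
  have h4 : wt x y z A 1 1 (topInd (z a).1) + wt x y z A 1 1 (topInd (z a').1) ≤
      wt x y z A 1 1 1 := by
    simp only [wt, ← Finset.sum_add_distrib]
    refine Finset.sum_le_sum fun b _ => ?_
    simp only [topInd, Pi.one_apply, one_mul]
    split_ifs with h5 h6
    · exact absurd (h6.symm.trans h5) hne
    all_goals simp
  have hpos : (0 : ℤ) < p * q * r := by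
    have := hp.out.pos; have := hq.out.pos; have := hr.out.pos
    positivity
  linarith
end

/-! ### Majority sets -/

/-- All top digits agree with `c` in at least two of the three directions. -/
def IsMajority {α : Type*} {p q r : ℕ} (x : α → Dig p) (y : α → Dig q) (z : α → Dig r)
    (B : Finset α) (c₁ : ZMod p) (c₂ : ZMod q) (c₃ : ZMod r) : Prop :=
  ∀ b ∈ B, ((y b).1 = c₂ ∧ (z b).1 = c₃) ∨ ((x b).1 = c₁ ∧ (z b).1 = c₃) ∨
    ((x b).1 = c₁ ∧ (y b).1 = c₂)

section
variable {α : Type*} {p q r : ℕ} {x : α → Dig p} {y : α → Dig q} {z : α → Dig r}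
  {A B : Finset α} {c₁ : ZMod p} {c₂ : ZMod q} {c₃ : ZMod r}

theorem IsMajority.swap_xy (M : IsMajority x y z B c₁ c₂ c₃) : IsMajority y x z B c₂ c₁ c₃ := by
  intro b hb
  have := M b hb
  tauto

theorem IsMajority.swap_yz (M : IsMajority x y z B c₁ c₂ c₃) : IsMajority x z y B c₁ c₃ c₂ := by
  intro b hb
  have := M b hb
  tauto

variable [hp : Fact p.Prime] [hq : Fact q.Prime] [hr : Fact r.Prime]

theorem Kill.top_y (K : Kill x y z A 0 1 0) (hA : wt x y z A 1 1 1 = (p : ℤ) * q * r)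
    (i : ZMod q) : wt x y z A 1 (topInd i) 1 = (p : ℤ) * r := by
  rw [← wt_swap_xy]
  refine Kill.top_x (kill_swap_xy.2 K) ?_ i
  rw [wt_swap_xy, hA]; ring

theorem Kill.top_z (K : Kill x y z A 0 0 1) (hA : wt x y z A 1 1 1 = (p : ℤ) * q * r)
    (i : ZMod r) : wt x y z A 1 1 (topInd i) = (p : ℤ) * q := by
  rw [← wt_swap_yz]
  refine Kill.top_y (kill_swap_yz.2 K) ?_ i
  rw [wt_swap_yz, hA]; ring

theorem Kill.leaf_y (K : Kill x y z A 0 2 0) (i t : ZMod q) :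
    q * wt x y z A 1 (leafInd i t) 1 = wt x y z A 1 (topInd i) 1 := by
  simp only [← wt_swap_xy (x := x)]
  exact Kill.leaf_x (kill_swap_xy.2 K) i t

theorem Kill.leaf_z (K : Kill x y z A 0 0 2) (i t : ZMod r) :
    r * wt x y z A 1 1 (leafInd i t) = wt x y z A 1 1 (topInd i) := by
  simp only [← wt_swap_yz (y := y)]
  exact Kill.leaf_y (kill_swap_yz.2 K) i t

theorem two_le_cast (n : ℕ) [h : Fact n.Prime] : (2 : ℤ) ≤ n := by exact_mod_cast h.out.two_le

theorem exists_wt_top_x_pos (H : ∀ i, ∃ b ∈ B, (x b).1 ≠ i) (c₁ : ZMod p) :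
    ∃ i, i ≠ c₁ ∧ 0 < wt x y z B (topInd i) 1 1 := by
  obtain ⟨b, hb, h⟩ := H c₁
  exact ⟨_, h, wt_pos (topInd_nonneg _) (by simp) (by simp) hb (by simp [topInd])⟩

theorem exists_wt_top_y_pos (H : ∀ i, ∃ b ∈ B, (y b).1 ≠ i) (c₂ : ZMod q) :
    ∃ i, i ≠ c₂ ∧ 0 < wt x y z B 1 (topInd i) 1 := by
  obtain ⟨b, hb, h⟩ := H c₂
  exact ⟨_, h, wt_pos (by simp) (topInd_nonneg _) (by simp) hb (by simp [topInd])⟩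

theorem exists_wt_top_z_pos (H : ∀ i, ∃ b ∈ B, (z b).1 ≠ i) (c₃ : ZMod r) :
    ∃ i, i ≠ c₃ ∧ 0 < wt x y z B 1 1 (topInd i) := by
  obtain ⟨b, hb, h⟩ := H c₃
  exact ⟨_, h, wt_pos (by simp) (by simp) (topInd_nonneg _) hb (by simp [topInd])⟩

/-- At most one depth-one component of a majority set vanishes. -/
theorem IsMajority.not_kill_one_one (M : IsMajority x y z B c₁ c₂ c₃) (F : Factorization x y z A B)
    (h1 : Kill x y z B 1 0 0) (h2 : Kill x y z B 0 1 0) : False := by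
  have e1 := h1.top_x F.wtB c₁
  have e2 := h2.top_y F.wtB c₂
  have e3 := F.wtB
  -- Agreement in two of the three directions puts every element in branch c₁ of x or branch c₂ of
  -- y.
  have h : wt x y z B 1 1 1 ≤ wt x y z B (topInd c₁) 1 1 + wt x y z B 1 (topInd c₂) 1 := by
    simp only [wt, ← Finset.sum_add_distrib]
    refine Finset.sum_le_sum fun b hb => ?_
    simp only [topInd, Pi.one_apply, one_mul, mul_one]
    rcases M b hb with ⟨h, -⟩ | ⟨h, -⟩ | ⟨h, -⟩
    · rw [if_pos h]; split_ifs <;> simp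
    · rw [if_pos h]; split_ifs <;> simp
    · rw [if_pos h]; split_ifs <;> simp
  rw [e1, e2, e3] at h
  have hr0 : (0 : ℤ) < r := by linarith [two_le_cast r]
  -- For integers at least 2 this inequality holds only when both equal 2, whereas p and q are
  -- distinct.
  have h' : (p : ℤ) * q ≤ p + q := by nlinarith
  have hp2 := two_le_cast p
  have hq2 := two_le_cast q
  have hpq : (p : ℤ) ≠ q := by exact_mod_cast F.pq
  rcases lt_or_gt_of_ne hpq with h | h <;> nlinarith

theorem IsMajority.wt_eq_zero_xy (M : IsMajority x y z B c₁ c₂ c₃) {i : ZMod p} (hi : i ≠ c₁)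
    {j : ZMod q} (hj : j ≠ c₂) (h : Dig r → ℤ) : wt x y z B (topInd i) (topInd j) h = 0 := by
  refine wt_eq_zero fun b hb => ?_
  have := M b hb
  simp only [topInd]
  split_ifs <;> simp_all

theorem IsMajority.wt_one_y (M : IsMajority x y z B c₁ c₂ c₃) {i : ZMod p} (hi : i ≠ c₁)
    (h : Dig r → ℤ) : wt x y z B (topInd i) (topInd c₂) h = wt x y z B (topInd i) 1 h := by
  refine wt_congr fun b hb => ?_
  have := M b hb
  simp only [topInd]
  split_ifs <;> simp_all

theorem IsMajority.wt_one_x (M : IsMajority x y z B c₁ c₂ c₃) {j : ZMod q} (hj : j ≠ c₂)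
    (h : Dig r → ℤ) : wt x y z B (topInd c₁) (topInd j) h = wt x y z B 1 (topInd j) h := by
  simp only [← wt_swap_xy (x := x)]
  exact M.swap_xy.wt_one_y hj h

theorem Kill.top_top {h : Dig r → ℤ} (K : ∀ f ∈ testFns p 1, ∀ g ∈ testFns q 1,
    wt x y z A f g h = 0) (i i' : ZMod p) (j j' : ZMod q) :
    wt x y z A (topInd i) (topInd j) h + wt x y z A (topInd i') (topInd j') h =
      wt x y z A (topInd i) (topInd j') h + wt x y z A (topInd i') (topInd j) h := by
  have := K _ (top_mem_testFns i i') _ (top_mem_testFns j j')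
  simp only [wt_sub_x, wt_sub_y] at this
  linarith

/-- Take the mixed difference on the corners (i, j), (i, c₂), (c₁, j), (c₁, c₂). Majority empties
the corner (i, j), so the centre is the sum of the two arms; varying i and j separately makes each
arm constant. The last equation counts the whole set: a + b in the centre, p − 1 arms of size a and
q − 1 of size b. -/
theorem IsMajority.of_kill_110 (M : IsMajority x y z B c₁ c₂ c₃) (F : Factorization x y z A B)
    (K : Kill x y z B 1 1 0) : ∃ a b : ℤ, 0 < a ∧ 0 < b ∧
      (∀ i, i ≠ c₁ → wt x y z B (topInd i) 1 1 = a) ∧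
      (∀ j, j ≠ c₂ → wt x y z B 1 (topInd j) 1 = b) ∧
      wt x y z B (topInd c₁) (topInd c₂) 1 = a + b ∧ (p : ℤ) * a + q * b = p * q * r := by
  obtain ⟨i₀, hi₀, ha⟩ := exists_wt_top_x_pos (y := y) (z := z) F.spreadBx c₁
  obtain ⟨j₀, hj₀, hb⟩ := exists_wt_top_y_pos (x := x) (z := z) F.spreadBy c₂
  have key : ∀ i, i ≠ c₁ → ∀ j, j ≠ c₂ → wt x y z B (topInd c₁) (topInd c₂) 1 =
      wt x y z B (topInd i) 1 1 + wt x y z B 1 (topInd j) 1 := by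
    intro i hi j hj
    have := Kill.top_top (fun f hf g hg => K f hf g hg 1 rfl) i c₁ j c₂
    rw [M.wt_eq_zero_xy hi hj, M.wt_one_y hi, M.wt_one_x hj] at this
    linarith
  have h1 : ∀ i, i ≠ c₁ → wt x y z B (topInd i) 1 1 = wt x y z B (topInd i₀) 1 1 := by
    intro i hi
    linarith [key i hi j₀ hj₀, key i₀ hi₀ j₀ hj₀]
  have h2 : ∀ j, j ≠ c₂ → wt x y z B 1 (topInd j) 1 = wt x y z B 1 (topInd j₀) 1 := by
    intro j hj
    linarith [key i₀ hi₀ j hj, key i₀ hi₀ j₀ hj₀]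
  refine ⟨_, _, ha, hb, h1, h2, key i₀ hi₀ j₀ hj₀, ?_⟩
  have e1 := wt_one_x_of_const h1
  have e2 := wt_one_y_of_const (x := x) (y := y) (z := z) (A := B) (f := topInd c₁) (h := 1)
    fun j hj => (M.wt_one_x hj 1).trans (h2 j hj)
  have e3 := F.wtB
  have e4 := key i₀ hi₀ j₀ hj₀
  linear_combination e3 - e1 - e2 - e4

/-- In the triple mixed difference only the centre and its three neighbours are occupied among the
eight corners, so the centre is the sum of three constant arms. -/
theorem IsMajority.of_kill_111 (M : IsMajority x y z B c₁ c₂ c₃) (F : Factorization x y z A B)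
    (K : Kill x y z B 1 1 1) : ∃ a b c : ℤ, 0 < a ∧ 0 < b ∧
      (∀ k, k ≠ c₃ → wt x y z B 1 1 (topInd k) = c) ∧
      (p : ℤ) * a + q * b + r * c = p * q * r := by
  obtain ⟨i₀, hi₀, ha⟩ := exists_wt_top_x_pos (y := y) (z := z) F.spreadBx c₁
  obtain ⟨j₀, hj₀, hb⟩ := exists_wt_top_y_pos (x := x) (z := z) F.spreadBy c₂
  obtain ⟨k₀, hk₀, -⟩ := exists_wt_top_z_pos (x := x) (y := y) F.spreadBz c₃
  have zi : ∀ i, i ≠ c₁ → ∀ k, k ≠ c₃ → ∀ g, wt x y z B (topInd i) g (topInd k) = 0 := by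
    intro i hi k hk g
    rw [← wt_swap_yz]
    exact M.swap_yz.wt_eq_zero_xy hi hk g
  have zj : ∀ j, j ≠ c₂ → ∀ k, k ≠ c₃ → ∀ f, wt x y z B f (topInd j) (topInd k) = 0 := by
    intro j hj k hk f
    have h := M.swap_xy.swap_yz.wt_eq_zero_xy hj hk f
    rwa [wt_swap_yz, wt_swap_xy] at h
  have oi : ∀ i, i ≠ c₁ → wt x y z B (topInd i) (topInd c₂) (topInd c₃) =
      wt x y z B (topInd i) 1 1 := by
    intro i hi
    rw [M.wt_one_y hi, ← wt_swap_yz, M.swap_yz.wt_one_y hi, wt_swap_yz]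
  have oj : ∀ j, j ≠ c₂ → wt x y z B (topInd c₁) (topInd j) (topInd c₃) =
      wt x y z B 1 (topInd j) 1 := by
    intro j hj
    refine wt_congr fun b hb => ?_
    have := M b hb
    simp only [topInd]
    split_ifs <;> simp_all
  have ok : ∀ k, k ≠ c₃ → wt x y z B (topInd c₁) (topInd c₂) (topInd k) =
      wt x y z B 1 1 (topInd k) := by
    intro j hj
    refine wt_congr fun b hb => ?_
    have := M b hb
    simp only [topInd]
    split_ifs <;> simp_all
  have key : ∀ i, i ≠ c₁ → ∀ j, j ≠ c₂ → ∀ k, k ≠ c₃ →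
      wt x y z B (topInd c₁) (topInd c₂) (topInd c₃) =
      wt x y z B (topInd i) 1 1 + wt x y z B 1 (topInd j) 1 + wt x y z B 1 1 (topInd k) := by
    intro i hi j hj k hk
    have := K _ (top_mem_testFns i c₁) _ (top_mem_testFns j c₂) _ (top_mem_testFns k c₃)
    simp only [wt_sub_x, wt_sub_y, wt_sub_z] at this
    rw [M.wt_eq_zero_xy hi hj, M.wt_eq_zero_xy hi hj, zi i hi k hk, zj j hj k hk, oi i hi,
      oj j hj, ok k hk] at this
    linarith
  have h1 : ∀ i, i ≠ c₁ → wt x y z B (topInd i) 1 1 = wt x y z B (topInd i₀) 1 1 := by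
    intro i hi
    linarith [key i hi j₀ hj₀ k₀ hk₀, key i₀ hi₀ j₀ hj₀ k₀ hk₀]
  have h2 : ∀ j, j ≠ c₂ → wt x y z B 1 (topInd j) 1 = wt x y z B 1 (topInd j₀) 1 := by
    intro j hj
    linarith [key i₀ hi₀ j hj k₀ hk₀, key i₀ hi₀ j₀ hj₀ k₀ hk₀]
  have h3 : ∀ k, k ≠ c₃ → wt x y z B 1 1 (topInd k) = wt x y z B 1 1 (topInd k₀) := by
    intro k hk
    linarith [key i₀ hi₀ j₀ hj₀ k hk, key i₀ hi₀ j₀ hj₀ k₀ hk₀]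
  refine ⟨_, _, _, ha, hb, h3, ?_⟩
  have e1 := wt_one_x_of_const h1
  have e2 := wt_one_y_of_const (x := x) (y := y) (z := z) (A := B) (f := topInd c₁) (h := 1)
    fun j hj => (M.wt_one_x hj 1).trans (h2 j hj)
  have e5 := wt_one_z_of_const (x := x) (y := y) (z := z) (A := B) (f := topInd c₁)
    (g := topInd c₂) fun k hk => (ok k hk).trans (h3 k hk)
  have e3 := F.wtB
  have e4 := key i₀ hi₀ j₀ hj₀ k₀ hk₀
  linear_combination e3 - e1 - e2 - e4 - e5

/-- If the depth-one component of a majority set vanishes in one direction, then the other factor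
lies in a branch. -/
theorem IsMajority.not_kill_001 (M : IsMajority x y z B c₁ c₂ c₃) (F : Factorization x y z A B)
    (K : Kill x y z B 0 0 1) : False := by
  have hA1 : Kill x y z A 1 0 0 := by
    rcases F.kill_x with h | h
    · exact h.1
    · exact (M.swap_yz.swap_xy.not_kill_one_one F.swap_yz.swap_xy
        (kill_swap_xy.2 (kill_swap_yz.2 K)) (kill_swap_xy.2 (kill_swap_yz.2 h.1))).elim
  have hA2 : Kill x y z A 0 1 0 := by
    rcases F.kill_y with h | h
    · exact h.1
    · exact (M.swap_xy.swap_yz.swap_xy.not_kill_one_one F.swap_xy.swap_yz.swap_xy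
        (kill_swap_xy.2 (kill_swap_yz.2 (kill_swap_xy.2 K)))
        (kill_swap_xy.2 (kill_swap_yz.2 (kill_swap_xy.2 h.1)))).elim
  have hA3 : Kill x y z A 0 0 2 := by
    rcases F.kill_z with h | h
    · exact absurd K h.2.2.2
    · exact h.2.2.1
  have hc := K.top_z F.wtB
  have hp2 := two_le_cast p
  have hq2 := two_le_cast q
  have hr2 := two_le_cast r
  have hpq0 : (0 : ℤ) < p * q := by positivity
  have hA110 : Kill x y z A 1 1 0 := by
    refine (F.kill_or 1 1 0 (by simp)).resolve_right fun h => ?_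
    obtain ⟨a, b, ha, hb, -, -, hab, hs⟩ := M.of_kill_110 F h
    have hk : ∀ k, k ≠ c₃ → wt x y z B (topInd c₁) (topInd c₂) (topInd k) = p * q := by
      intro k hk
      rw [← hc k]
      refine wt_congr fun b hb => ?_
      have := M b hb
      simp only [topInd]
      split_ifs <;> simp_all
    have e := wt_one_z_of_const hk
    have e0 : 0 ≤ wt x y z B (topInd c₁) (topInd c₂) (topInd c₃) :=
      wt_nonneg (topInd_nonneg _) (topInd_nonneg _) (topInd_nonneg _)
    have hpq : (p : ℤ) ≠ q := by exact_mod_cast F.pq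
    -- The r − 1 off-centre z-branches each put pq elements over (c₁, c₂), so a + b is at least (r −
    -- 1)pq. But distinct primes make a + b less than pqr / 2, which is impossible for r ≥ 2.
    have h1 : 2 * (a + b) < p * a + q * b := by
      rcases lt_or_gt_of_ne hpq with h | h <;> nlinarith
    nlinarith
  have hA101 : Kill x y z A 1 0 1 := by
    refine (F.kill_or 1 0 1 (by simp)).resolve_right fun h => ?_
    obtain ⟨a, b, ha, hb, -, hb', -, hs⟩ := M.swap_yz.of_kill_110 F.swap_yz (kill_swap_yz.2 h)
    obtain ⟨k, hk, -⟩ := exists_wt_top_z_pos (x := x) (y := y) F.spreadBz c₃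
    have := hb' k hk
    rw [wt_swap_yz, hc] at this
    -- The z-arm is now pq, so its r-fold multiple alone is pqr, leaving no room for the positive
    -- other arm. The cases 011 and 111 end in the same way.
    subst this
    nlinarith
  have hA011 : Kill x y z A 0 1 1 := by
    refine (F.kill_or 0 1 1 (by simp)).resolve_right fun h => ?_
    obtain ⟨a, b, ha, hb, -, hb', -, hs⟩ := M.swap_xy.swap_yz.of_kill_110 F.swap_xy.swap_yz
      (kill_swap_yz.2 (kill_swap_xy.2 h))
    obtain ⟨k, hk, -⟩ := exists_wt_top_z_pos (x := x) (y := y) F.spreadBz c₃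
    have := hb' k hk
    rw [wt_swap_yz, wt_swap_xy, hc] at this
    subst this
    nlinarith
  have hA111 : Kill x y z A 1 1 1 := by
    refine (F.kill_or 1 1 1 (by simp)).resolve_right fun h => ?_
    obtain ⟨a, b, c, ha, hb, hc', hs⟩ := M.of_kill_111 F h
    obtain ⟨k, hk, -⟩ := exists_wt_top_z_pos (x := x) (y := y) F.spreadBz c₃
    have := hc' k hk
    rw [hc] at this
    subst this
    nlinarith
  exact F.not_flat hA1 hA2 hA110 hA101 hA011 hA111 hA3

end

/-! ### Colourings of rectangular arrays -/

section connect
variable {α γ : Type*} {p q : ℕ} [hp : Fact p.Prime] [hq : Fact q.Prime]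
  {S : Finset α} {X : α → ZMod p} {Y : α → ZMod q} {C : α → γ}

theorem card_of_rows (hrow : ∀ i, (S.filter fun a => X a = i).card = q) : S.card = p * q := by
  classical
  rw [Finset.card_eq_sum_card_fiberwise (f := X) (t := Finset.univ) (fun a _ => by simp)]
  simp [hrow, ZMod.card]

/-- Two differently coloured entries of one row confine all other rows to their two columns. Neither
column can hold all of those entries, and outside the row an entry in one column and an entry in the
other must share a row. A third row contradicts this; with only two rows, the remaining columns
overfill the original row. -/
theorem color_eq_of_same_row (hpq : p ≠ q)
    (hrow : ∀ i, (S.filter fun a => X a = i).card = q)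
    (hcol : ∀ j, (S.filter fun a => Y a = j).card = p)
    (hC : ∀ a ∈ S, ∀ a' ∈ S, X a ≠ X a' → Y a ≠ Y a' → C a = C a')
    {a a' : α} (ha : a ∈ S) (ha' : a' ∈ S) (hX : X a = X a') : C a = C a' := by
  classical
  by_contra hne
  have haa : a ≠ a' := fun h => hne (by rw [h])
  have hp2 := hp.out.two_le
  have hq2 := hq.out.two_le
  have hcard := card_of_rows hrow
  have hout : (S.filter fun b => X b ≠ X a).card + q = p * q := by
    rw [← hcard, ← hrow (X a), add_comm]
    exact Finset.card_filter_add_card_filter_not _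
  have hY : ∀ b ∈ S, X b ≠ X a → Y b = Y a ∨ Y b = Y a' := by
    intro b hb hbX
    by_contra h
    push Not at h
    exact hne ((hC b hb a ha hbX h.1).symm.trans (hC b hb a' ha' (hX ▸ hbX) h.2))
  -- the elements outside the row of `a` cannot all lie in one column containing `a` or `a'`
  have hcolumn : ∀ c ∈ S, X c = X a → ¬ ∀ b ∈ S, X b ≠ X a → Y b = Y c := by
    intro c hc hcX h
    have hsub : insert c (S.filter fun b => X b ≠ X a) ⊆ S.filter fun b => Y b = Y c := by
      intro b hb
      rw [Finset.mem_insert] at hb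
      rcases hb with rfl | hb
      · simp [hc]
      · rw [Finset.mem_filter] at hb
        simp [hb.1, h b hb.1 hb.2]
    have := Finset.card_le_card hsub
    rw [Finset.card_insert_of_notMem (by simp [hcX]), hcol] at this
    nlinarith
  have hpick : ∀ i, ∃ b ∈ S, X b = i := by
    intro i
    have : 0 < (S.filter fun a => X a = i).card := by rw [hrow]; omega
    obtain ⟨b, hb⟩ := Finset.card_pos.1 this
    exact ⟨b, (Finset.mem_filter.1 hb).1, (Finset.mem_filter.1 hb).2⟩
  by_cases hYY : Y a = Y a'
  · exact hcolumn a ha rfl fun b hb hbX => (hY b hb hbX).elim id fun h => h.trans hYY.symm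
  have hconf : ∀ b ∈ S, ∀ b' ∈ S, X b ≠ X a → X b' ≠ X a → Y b = Y a → Y b' = Y a' →
      X b = X b' := by
    intro b hb b' hb' h1 h2 h3 h4
    by_contra h
    have e1 : C b = C a' := hC b hb a' ha' (hX ▸ h1) (h3 ▸ hYY)
    have e2 : C b' = C a := hC b' hb' a ha h2 (h4 ▸ Ne.symm hYY)
    have e3 : C b = C b' := hC b hb b' hb' h (by rw [h3, h4]; exact hYY)
    exact hne (e2.symm.trans (e3.symm.trans e1))
  rcases Nat.lt_or_ge 2 p with h3 | h3
  · have h1 := hcolumn a ha rfl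
    have h2 := hcolumn a' ha' hX.symm
    push Not at h1 h2
    obtain ⟨b', hb', hb'X, hb'Y⟩ := h1
    obtain ⟨b, hb, hbX, hbY⟩ := h2
    have hb'Y := (hY b' hb' hb'X).resolve_left hb'Y
    have hbY := (hY b hb hbX).resolve_right hbY
    have hbb := hconf b hb b' hb' hbX hb'X hbY hb'Y
    obtain ⟨i, hi⟩ : ∃ i, i ∉ ({X a, X b} : Finset (ZMod p)) := by
      by_contra hcon
      push Not at hcon
      have := Finset.card_le_card (fun i _ => hcon i : Finset.univ ⊆ ({X a, X b} : Finset _))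
      rw [Finset.card_univ, ZMod.card] at this
      have := this.trans Finset.card_le_two
      omega
    simp only [Finset.mem_insert, Finset.mem_singleton, not_or] at hi
    obtain ⟨c, hc, rfl⟩ := hpick i
    rcases hY c hc hi.1 with h | h
    · exact hi.2 ((hconf c hc b' hb' hi.1 hb'X h hb'Y).trans hbb.symm)
    · exact hi.2 (hconf b hb c hc hbX hi.1 hbY h).symm
  · have hp' : p = 2 := by omega
    have hsub : insert a (insert a' (S.filter fun b => ¬ (Y b = Y a ∨ Y b = Y a'))) ⊆
        S.filter fun b => X b = X a := by
      intro b hb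
      simp only [Finset.mem_insert, Finset.mem_filter] at hb ⊢
      rcases hb with rfl | rfl | hb
      · exact ⟨ha, rfl⟩
      · exact ⟨ha', hX.symm⟩
      · exact ⟨hb.1, by_contra fun h => hb.2 (hY b hb.1 h)⟩
    have h1 := Finset.card_le_card hsub
    rw [Finset.card_insert_of_notMem (by simp [haa]), Finset.card_insert_of_notMem (by simp),
      hrow] at h1
    have h2 : (S.filter fun b => Y b = Y a ∨ Y b = Y a').card ≤ p + p := by
      rw [Finset.filter_or]
      exact (Finset.card_union_le _ _).trans (by rw [hcol, hcol])
    have h4 : (S.filter fun b => Y b = Y a ∨ Y b = Y a').card +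
        (S.filter fun b => ¬ (Y b = Y a ∨ Y b = Y a')).card = p * q := by
      rw [← hcard]
      exact Finset.card_filter_add_card_filter_not _
    subst hp'
    -- The first row has at least 2 + (2q − 4) entries but exactly q, so q ≤ 2, against q ≠ p = 2.
    omega

/-- A colouring of a `p × q` array with constant row sums `q` and constant column sums `p` is
constant if entries in different rows and columns have the same colour. -/
theorem color_eq_of_cross (hpq : p ≠ q)
    (hrow : ∀ i, (S.filter fun a => X a = i).card = q)
    (hcol : ∀ j, (S.filter fun a => Y a = j).card = p)
    (hC : ∀ a ∈ S, ∀ a' ∈ S, X a ≠ X a' → Y a ≠ Y a' → C a = C a')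
    {a a' : α} (ha : a ∈ S) (ha' : a' ∈ S) : C a = C a' := by
  by_cases hX : X a = X a'
  · exact color_eq_of_same_row hpq hrow hcol hC ha ha' hX
  by_cases hY : Y a = Y a'
  · exact color_eq_of_same_row hpq.symm hcol hrow
      (fun a ha a' ha' h1 h2 => hC a ha a' ha' h2 h1) ha ha' hY
  exact hC a ha a' ha' hX hY

end connect

/-! ### Bottom digits opposite a majority set -/

section
variable {α : Type*} {p q r : ℕ} {x : α → Dig p} {y : α → Dig q} {z : α → Dig r}
  {A B : Finset α} {c₁ : ZMod p} {c₂ : ZMod q} {c₃ : ZMod r}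
variable [hp : Fact p.Prime] [hq : Fact q.Prime] [hr : Fact r.Prime]

theorem IsMajority.kill_x (M : IsMajority x y z B c₁ c₂ c₃) (F : Factorization x y z A B) :
    Kill x y z A 1 0 0 ∧ ¬ Kill x y z A 2 0 0 ∧ Kill x y z B 2 0 0 ∧ ¬ Kill x y z B 1 0 0 :=
  F.kill_x.resolve_right fun h => M.swap_xy.swap_yz.not_kill_001 F.swap_xy.swap_yz
    (kill_swap_yz.2 (kill_swap_xy.2 h.1))

theorem IsMajority.kill_y (M : IsMajority x y z B c₁ c₂ c₃) (F : Factorization x y z A B) :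
    Kill x y z A 0 1 0 ∧ ¬ Kill x y z A 0 2 0 ∧ Kill x y z B 0 2 0 ∧ ¬ Kill x y z B 0 1 0 :=
  F.kill_y.resolve_right fun h => M.swap_yz.not_kill_001 F.swap_yz (kill_swap_yz.2 h.1)

theorem IsMajority.kill_z (M : IsMajority x y z B c₁ c₂ c₃) (F : Factorization x y z A B) :
    Kill x y z A 0 0 1 ∧ ¬ Kill x y z A 0 0 2 ∧ Kill x y z B 0 0 2 ∧ ¬ Kill x y z B 0 0 1 :=
  F.kill_z.resolve_right fun h => M.not_kill_001 F h.1

theorem wt_top_one_top (i : ZMod p) (k : ZMod r) : wt x y z A (topInd i) 1 (topInd k) =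
    (((A.filter fun a => (z a).1 = k).filter fun a => (x a).1 = i).card : ℤ) := by
  rw [Finset.filter_filter, Finset.card_filter]
  push_cast
  refine Finset.sum_congr rfl fun a _ => ?_
  simp only [topInd, Pi.one_apply]
  split_ifs <;> simp_all

theorem wt_one_top_top (j : ZMod q) (k : ZMod r) : wt x y z A 1 (topInd j) (topInd k) =
    (((A.filter fun a => (z a).1 = k).filter fun a => (y a).1 = j).card : ℤ) := by
  rw [← wt_swap_xy, wt_top_one_top]

theorem Kill.wt_top_one_top (hA : wt x y z A 1 1 1 = (p : ℤ) * q * r) (h100 : Kill x y z A 1 0 0)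
    (h001 : Kill x y z A 0 0 1) (h101 : Kill x y z A 1 0 1) (i : ZMod p) (k : ZMod r) :
    wt x y z A (topInd i) 1 (topInd k) = (q : ℤ) := by
  have h1 : ∀ f ∈ testFns p 1, wt x y z A f 1 (topInd k) = 0 := fun f hf =>
    wt_top_z_eq_zero (fun h hh => h100 f hf 1 rfl h hh) (fun h hh => h101 f hf 1 rfl h hh) k
  have h2 := mul_wt_top_x h1 i
  rw [h001.top_z hA] at h2
  exact mul_left_cancel₀ (by exact_mod_cast hp.out.ne_zero) h2

/-- The vanishing components make each z-branch of A a p × q array in the top digits of x and y,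
with row sums q and column sums p. The bottom z-digit is its colour. -/
theorem Factorization.det_z (F : Factorization x y z A B) (h100 : Kill x y z A 1 0 0)
    (h010 : Kill x y z A 0 1 0) (h001 : Kill x y z A 0 0 1) (h101 : Kill x y z A 1 0 1)
    (h011 : Kill x y z A 0 1 1)
    (hcross : ∀ a ∈ A, ∀ a' ∈ A, (z a).1 = (z a').1 → (x a).1 ≠ (x a').1 →
      (y a).1 ≠ (y a').1 → (z a).2 = (z a').2) :
    ∀ a ∈ A, ∀ a' ∈ A, (z a).1 = (z a').1 → (z a).2 = (z a').2 := by
  intro a ha a' ha' h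
  refine color_eq_of_cross (S := A.filter fun b => (z b).1 = (z a).1) (X := fun b => (x b).1)
    (Y := fun b => (y b).1) (C := fun b => (z b).2) F.pq ?_ ?_ ?_ (by simp [ha])
    (by simp [ha', h])
  · intro i
    have := Kill.wt_top_one_top F.wtA h100 h001 h101 i (z a).1
    rw [_root_.wt_top_one_top] at this
    exact_mod_cast this
  · intro j
    have := Kill.wt_top_one_top F.swap_xy.wtA (kill_swap_xy.2 h010) (kill_swap_xy.2 h001)
      (kill_swap_xy.2 h011) j (z a).1
    rw [_root_.wt_top_one_top] at this
    exact_mod_cast this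
  · intro b hb b' hb' h1 h2
    rw [Finset.mem_filter] at hb hb'
    exact hcross b hb.1 b' hb'.1 (hb.2.trans hb'.2.symm) h1 h2

/-- The leaves ζ and ζ + 1 of branch c₃ have equal totals. The second lies entirely over c₂, whereas
b takes some of the first away from c₂, so the mixed difference cannot vanish. -/
theorem not_kill_012 {ζ : ZMod r}
    (hζ : ∀ b ∈ B, (z b).1 = c₃ → (z b).2 ≠ ζ → (y b).1 = c₂) {b : α} (hb : b ∈ B)
    (hby : (y b).1 ≠ c₂) (hbz : z b = (c₃, ζ)) (hB : Kill x y z B 0 0 2) :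
    ¬ Kill x y z B 0 1 2 := by
  intro h
  have hζ' : ζ + 1 ≠ ζ := by simp
  have e := h 1 rfl _ (top_mem_testFns (y b).1 c₂) _ (leaf_mem_testFns c₃ ζ (ζ + 1))
  have e' := hB 1 rfl 1 rfl _ (leaf_mem_testFns c₃ ζ (ζ + 1))
  simp only [wt_sub_y, wt_sub_z] at e e'
  have h1 : wt x y z B 1 (topInd (y b).1) (leafInd c₃ (ζ + 1)) = 0 := by
    refine wt_eq_zero fun b' hb' => ?_
    have := hζ b' hb'
    simp only [topInd, leafInd]
    split_ifs <;> simp_all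
  have h2 : wt x y z B 1 (topInd c₂) (leafInd c₃ (ζ + 1)) =
      wt x y z B 1 1 (leafInd c₃ (ζ + 1)) := by
    refine wt_congr fun b' hb' => ?_
    have := hζ b' hb'
    simp only [topInd, leafInd]
    split_ifs <;> simp_all
  have h3 : 0 < wt x y z B 1 (topInd (y b).1) (leafInd c₃ ζ) :=
    wt_pos (by simp) (topInd_nonneg _) (leafInd_nonneg _ _) hb (by simp [topInd, leafInd, hbz])
  have h4 : wt x y z B 1 (topInd c₂) (leafInd c₃ ζ) ≤ wt x y z B 1 1 (leafInd c₃ ζ) := by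
    refine wt_le fun b' _ => ?_
    simp only [topInd, leafInd]
    split_ifs <;> simp
  linarith

/-- Each direction contains differences of the majority set of the kind that forces the bottom
digits of the other factor to agree. -/
theorem IsMajority.cross (M : IsMajority x y z B c₁ c₂ c₃) (F : Factorization x y z A B) :
    ∀ a ∈ A, ∀ a' ∈ A, (z a).1 = (z a').1 → (x a).1 ≠ (x a').1 →
      (y a).1 ≠ (y a').1 → (z a).2 = (z a').2 := by
  -- Such b and b' differ at the top in x and y and only at the bottom in z, precisely the type to
  -- be excluded from A.
  by_cases hex : ∃ b ∈ B, ∃ b' ∈ B, (x b).1 ≠ c₁ ∧ (y b').1 ≠ c₂ ∧ (z b).2 ≠ (z b').2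
  · obtain ⟨b, hb, b', hb', h1, h2, h3⟩ := hex
    have hb1 : (y b).1 = c₂ ∧ (z b).1 = c₃ := by have := M b hb; tauto
    have hb2 : (x b').1 = c₁ ∧ (z b').1 = c₃ := by have := M b' hb'; tauto
    intro a ha a' ha' h4 h5 h6
    by_contra h7
    have := F.disj a ha a' ha' b hb b' hb'
      ⟨by rw [hb2.1]; tauto, by
        constructor
        · intro h; exact absurd (congrArg Prod.fst h) h5
        · intro h; rw [h] at h1; exact absurd hb2.1 h1⟩
      ⟨by rw [hb1.1]; exact ⟨fun h => absurd h h6, fun h => absurd h.symm h2⟩, by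
        constructor
        · intro h; exact absurd (congrArg Prod.fst h) h6
        · intro h; rw [← h] at h2; exact absurd hb1.1 h2⟩
      ⟨by rw [hb1.2, hb2.2]; simp [h4], by
        constructor
        · intro h; exact absurd (congrArg Prod.snd h) h7
        · intro h; exact absurd (congrArg Prod.snd h) h3⟩
    exact h5 (by rw [this.1])
  exfalso
  push Not at hex
  obtain ⟨-, hA, hB, -⟩ := M.kill_z F
  obtain ⟨b₁, hb₁, h1⟩ := F.spreadBx c₁
  obtain ⟨b₂, hb₂, h2⟩ := F.spreadBy c₂
  have hb1 : (y b₁).1 = c₂ ∧ (z b₁).1 = c₃ := by have := M b₁ hb₁; tauto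
  have hb2 : (x b₂).1 = c₁ ∧ (z b₂).1 = c₃ := by have := M b₂ hb₂; tauto
  obtain ⟨ζ, hζ⟩ : ∃ ζ, ζ = (z b₁).2 := ⟨_, rfl⟩
  have hz1 : z b₁ = (c₃, ζ) := Prod.ext hb1.2 hζ.symm
  have hz2 : z b₂ = (c₃, ζ) :=
    Prod.ext hb2.2 ((hex b₁ hb₁ b₂ hb₂ h1 h2).symm.trans hζ.symm)
  have hx : ∀ b ∈ B, (z b).1 = c₃ → (z b).2 ≠ ζ → (x b).1 = c₁ := by
    intro b hb _ h
    by_contra h'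
    exact h ((hex b hb b₂ hb₂ h' h2).trans (by rw [hz2]))
  have hy : ∀ b ∈ B, (z b).1 = c₃ → (z b).2 ≠ ζ → (y b).1 = c₂ := by
    intro b hb _ h
    by_contra h'
    exact h ((hex b₁ hb₁ b hb h1 h').symm.trans (by rw [hz1]))
  -- Now every element of the x-arm and y-arm has bottom z-digit ζ. This concentration prevents 012,
  -- 102 and 112 from vanishing on B, so A takes all three.
  have h012 : Kill x y z A 0 1 2 := (F.kill_or 0 1 2 (by simp)).resolve_right
    (not_kill_012 hy hb₂ h2 hz2 hB)
  have h102 : Kill x y z A 1 0 2 := (F.kill_or 1 0 2 (by simp)).resolve_right fun h =>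
    not_kill_012 hx hb₁ h1 hz1 (kill_swap_xy.2 hB) (kill_swap_xy.2 h)
  have h112 : Kill x y z A 1 1 2 := by
    refine (F.kill_or 1 1 2 (by simp)).resolve_right fun h => ?_
    have hζ' : ζ + 1 ≠ ζ := by simp
    have e := h _ (top_mem_testFns (x b₁).1 c₁) _ (top_mem_testFns (y b₂).1 c₂) _
      (leaf_mem_testFns c₃ ζ (ζ + 1))
    have e' := hB 1 rfl 1 rfl _ (leaf_mem_testFns c₃ ζ (ζ + 1))
    simp only [wt_sub_x, wt_sub_y, wt_sub_z] at e e'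
    rw [M.wt_eq_zero_xy h1 h2, M.wt_eq_zero_xy h1 h2] at e
    have k1 : wt x y z B (topInd (x b₁).1) (topInd c₂) (leafInd c₃ (ζ + 1)) = 0 := by
      refine wt_eq_zero fun b' hb' => ?_
      have := hx b' hb'
      simp only [topInd, leafInd]
      grind
    have k2 : wt x y z B (topInd c₁) (topInd (y b₂).1) (leafInd c₃ (ζ + 1)) = 0 := by
      refine wt_eq_zero fun b' hb' => ?_
      have := hy b' hb'
      simp only [topInd, leafInd]
      grind
    have k3 : wt x y z B (topInd c₁) (topInd c₂) (leafInd c₃ (ζ + 1)) =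
        wt x y z B 1 1 (leafInd c₃ (ζ + 1)) := by
      refine wt_congr fun b' hb' => ?_
      have := hx b' hb'
      have := hy b' hb'
      simp only [topInd, leafInd, Pi.one_apply]
      grind
    have k4 : wt x y z B (topInd c₁) (topInd c₂) (leafInd c₃ ζ) ≤
        wt x y z B 1 1 (leafInd c₃ ζ) := by
      refine wt_le fun b' _ => ?_
      simp only [topInd, leafInd]
      split_ifs <;> simp
    have k5 : 0 < wt x y z B (topInd (x b₁).1) (topInd c₂) (leafInd c₃ ζ) :=
      wt_pos (topInd_nonneg _) (topInd_nonneg _) (leafInd_nonneg _ _) hb₁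
        (by simp [topInd, leafInd, hz1, hb1.1])
    have k6 : 0 < wt x y z B (topInd c₁) (topInd (y b₂).1) (leafInd c₃ ζ) :=
      wt_pos (topInd_nonneg _) (topInd_nonneg _) (leafInd_nonneg _ _) hb₂
        (by simp [topInd, leafInd, hz2, hb2.1])
    linarith
  -- The three components make the leaf differences in z the same over every pair of top digits in x
  -- and y.
  have hconst : ∀ h ∈ testFns r 2, ∀ i i' j j', wt x y z A (topInd i) (topInd j) h =
      wt x y z A (topInd i') (topInd j') h := by
    intro h hh i i' j j'
    have e1 := wt_top_y_eq_zero (fun g hg => h102 _ (top_mem_testFns i i') g hg h hh)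
      (fun g hg => h112 _ (top_mem_testFns i i') g hg h hh) j
    have e2 := wt_top_x_eq_zero (fun f hf => h012 f hf _ (top_mem_testFns j j') h hh)
      (fun f hf => h112 f hf _ (top_mem_testFns j j') h hh) i'
    rw [wt_sub_x] at e1
    rw [wt_sub_y] at e2
    linarith
  have hle : ∀ k t t', wt x y z A (topInd 0) (topInd 0) (leafInd k t) ≤
      wt x y z A (topInd 0) (topInd 0) (leafInd k t') := by
    intro k t t'
    by_contra hlt
    push Not at hlt
    -- A strict inequality over one cell transfers to all cells and puts an element at leaf (k, t)
    -- over each. The cells (0, 0) and (1, 1) then give a pair of the same type as b₁, b₂: different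
    -- tops in x and y, equal in z.
    have hpos : ∀ i j, ∃ a ∈ A, (x a).1 = i ∧ (y a).1 = j ∧ z a = (k, t) := by
      intro i j
      have e := hconst _ (leaf_mem_testFns k t t') i 0 j 0
      simp only [wt_sub_z] at e
      have : 0 ≤ wt x y z A (topInd i) (topInd j) (leafInd k t') :=
        wt_nonneg (topInd_nonneg _) (topInd_nonneg _) (leafInd_nonneg _ _)
      obtain ⟨a, ha, hne⟩ := exists_of_wt_pos (x := x) (y := y) (z := z) (A := A)
        (f := topInd i) (g := topInd j) (h := leafInd k t) (by linarith)
      refine ⟨a, ha, ?_⟩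
      simp only [topInd, leafInd] at hne
      rw [Prod.ext_iff]
      grind
    obtain ⟨a, ha, hax, hay, haz⟩ := hpos 0 0
    obtain ⟨a', ha', hax', hay', haz'⟩ := hpos 1 1
    have := F.disj a ha a' ha' b₁ hb₁ b₂ hb₂
      ⟨by simp [hax, hax', hb2.1, h1], by
        constructor
        · intro h
          have := congrArg Prod.fst h
          simp [hax, hax'] at this
        · intro h; rw [h] at h1; exact absurd hb2.1 h1⟩
      ⟨by simp [hay, hay', hb1.1, h2.symm], by
        constructor
        · intro h
          have := congrArg Prod.fst h
          simp [hay, hay'] at this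
        · intro h; rw [← h] at h2; exact absurd hb1.1 h2⟩
      ⟨by simp [haz, haz', hz1, hz2], by simp [haz, haz', hz1, hz2]⟩
    rw [this.1, hax'] at hax
    exact one_ne_zero hax
  -- All leaf differences vanish cell by cell, so A would kill 002, which `kill_z` forbids.
  apply hA
  intro f hf g hg h hh
  rw [testFns, Set.mem_singleton_iff] at hf hg
  subst hf hg
  have h0 : wt x y z A (topInd 0) (topInd 0) h = 0 := by
    obtain ⟨k, t, t', rfl⟩ := hh
    rw [wt_sub_z]
    linarith [hle k t t', hle k t' t]
  have e2 : ∀ i, wt x y z A (topInd i) 1 h = 0 := by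
    intro i
    have := wt_one_y_of_const (x := x) (y := y) (z := z) (A := A) (f := topInd i) (h := h)
      (c := 0) (a := 0) fun j _ => (hconst h hh i 0 j 0).trans h0
    rw [this, hconst h hh i 0 0 0, h0]; simp
  have e1 := wt_one_x_of_const (x := x) (y := y) (z := z) (A := A) (g := 1) (h := h)
      (c := 0) (a := 0) fun i _ => e2 i
  rw [e1, e2]; simp

end

/-! ### Divisibility and the sectional structure of A -/

section
variable {α : Type*} {p q r : ℕ} {x : α → Dig p} {y : α → Dig q} {z : α → Dig r}
  {A B : Finset α} {c₁ : ZMod p} {c₂ : ZMod q} {c₃ : ZMod r}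
variable [hp : Fact p.Prime] [hq : Fact q.Prime] [hr : Fact r.Prime]

theorem isCoprime_of_primes {m n : ℕ} [hm : Fact m.Prime] [hn : Fact n.Prime] (h : m ≠ n) :
    IsCoprime (m : ℤ) n := by
  rw [Nat.isCoprime_iff_coprime]
  exact (Nat.coprime_primes hm.out hn.out).2 h

/-- An x-branch off the centre lies inside z-branch c₃. Its leaf differences therefore vanish over
all of c₃, and by 202 are equal over the leaves of c₃, hence vanish over each leaf t. The p leaves
of the x-branch consequently have equal counts there. -/
theorem IsMajority.dvd_of_kill_202 (M : IsMajority x y z B c₁ c₂ c₃) (h200 : Kill x y z B 2 0 0)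
    (h202 : Kill x y z B 2 0 2) {i : ZMod p} (hi : i ≠ c₁) (t : ZMod r) :
    (p : ℤ) ∣ wt x y z B (topInd i) 1 (leafInd c₃ t) := by
  have key : ∀ s s', wt x y z B (leafInd i s) 1 (leafInd c₃ t) =
      wt x y z B (leafInd i s') 1 (leafInd c₃ t) := by
    intro s s'
    have h1 : wt x y z B (leafInd i s - leafInd i s') 1 (topInd c₃) = 0 := by
      rw [← h200 _ (leaf_mem_testFns i s s') 1 rfl 1 rfl]
      refine wt_congr fun b hb => ?_
      have := M b hb
      simp only [topInd, leafInd, Pi.one_apply, Pi.sub_apply]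
      grind
    have h2 := mul_wt_leaf_z (x := x) (y := y) (z := z) (A := B)
      (f := leafInd i s - leafInd i s') (g := 1) c₃ (fun t t' => by
        have := h202 _ (leaf_mem_testFns i s s') 1 rfl _ (leaf_mem_testFns c₃ t t')
        rw [wt_sub_z] at this
        exact sub_eq_zero.1 this) t
    rw [h1] at h2
    have h3 := (mul_eq_zero.1 h2).resolve_left (by exact_mod_cast hr.out.ne_zero)
    rw [wt_sub_x] at h3
    exact sub_eq_zero.1 h3
  exact ⟨_, (mul_wt_leaf_x i key 0).symm⟩

/-- Coprimality gives q² ∣ d, so a nonzero d would make pd at least pq² in absolute value. -/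
theorem eq_zero_of_mul_add_mul {p q d e N : ℤ} (hp : 0 < p) (hN : N < p * q ^ 2)
    (h : p * (p * d) + q * (q * e) = 0) (hcop : IsCoprime p q) (h1 : p * d ≤ N)
    (h2 : -N ≤ p * d) : d = 0 := by
  have hd : q ^ 2 ∣ p ^ 2 * d := ⟨-e, by linear_combination h⟩
  obtain ⟨m, rfl⟩ := (hcop.symm.pow (m := 2) (n := 2)).dvd_of_dvd_mul_left hd
  have hpos : 0 ≤ p * q ^ 2 := by positivity
  rcases lt_trichotomy m 0 with hm | rfl | hm
  · nlinarith
  · simp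
  · nlinarith

/-- For a leaf difference in z over c₃, 112 makes the contributions of the x-arms and y-arms
constant, and 002 gives p times one plus q times the other equal to zero. These contributions are
divisible by p and q respectively and bounded by pq, so the x-contribution is zero. The arm is thus
equally distributed over the r leaves. -/
theorem IsMajority.dvd_of_kill_112 (M : IsMajority x y z B c₁ c₂ c₃) (F : Factorization x y z A B)
    (h200 : Kill x y z B 2 0 0) (h020 : Kill x y z B 0 2 0) (h002 : Kill x y z B 0 0 2)
    (h202 : Kill x y z B 2 0 2) (h022 : Kill x y z B 0 2 2) (h112 : Kill x y z B 1 1 2)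
    {i : ZMod p} (hi : i ≠ c₁) : (r : ℤ) ∣ wt x y z B (topInd i) 1 1 := by
  obtain ⟨j₀, hj₀, -⟩ := exists_wt_top_y_pos (x := x) (z := z) F.spreadBy c₂
  have hp2 := two_le_cast p
  have hq2 := two_le_cast q
  have hr2 := two_le_cast r
  have key : ∀ t t', wt x y z B (topInd i) 1 (leafInd c₃ t) =
      wt x y z B (topInd i) 1 (leafInd c₃ t') := by
    intro t t'
    obtain ⟨D, hD⟩ : ∃ D : Dig r → ℤ, D = leafInd c₃ t - leafInd c₃ t' := ⟨_, rfl⟩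
    have h4 : ∀ i, i ≠ c₁ → ∀ j, j ≠ c₂ → wt x y z B (topInd c₁) (topInd c₂) D =
        wt x y z B (topInd i) 1 D + wt x y z B 1 (topInd j) D := by
      intro i hi j hj
      have := Kill.top_top (fun f hf g hg => h112 f hf g hg D (hD ▸ leaf_mem_testFns c₃ t t'))
        i c₁ j c₂
      rw [M.wt_eq_zero_xy hi hj, M.wt_one_y hi, M.wt_one_x hj] at this
      linarith
    have e1 := wt_one_x_of_const (x := x) (y := y) (z := z) (A := B) (c := c₁) (g := 1) (h := D)
      (a := wt x y z B (topInd i) 1 D) fun i' hi' => by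
        linarith [h4 i' hi' j₀ hj₀, h4 i hi j₀ hj₀]
    have e2 := wt_one_y_of_const (x := x) (y := y) (z := z) (A := B) (f := topInd c₁) (h := D)
      (c := c₂) (a := wt x y z B 1 (topInd j₀) D) fun j hj => (M.wt_one_x hj D).trans (by
        linarith [h4 i hi j hj, h4 i hi j₀ hj₀])
    have e3 : wt x y z B 1 1 D = 0 := h002 1 rfl 1 rfl D (hD ▸ leaf_mem_testFns c₃ t t')
    have e4 : (p : ℤ) * wt x y z B (topInd i) 1 D + q * wt x y z B 1 (topInd j₀) D = 0 := by
      linear_combination e3 - e1 - e2 - h4 i hi j₀ hj₀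
    have hdi : (p : ℤ) ∣ wt x y z B (topInd i) 1 D := by
      rw [hD, wt_sub_z]
      exact dvd_sub (M.dvd_of_kill_202 h200 h202 hi t) (M.dvd_of_kill_202 h200 h202 hi t')
    have hdj : (q : ℤ) ∣ wt x y z B 1 (topInd j₀) D := by
      rw [hD, wt_sub_z]
      have := fun t => M.swap_xy.dvd_of_kill_202 (kill_swap_xy.2 h020) (kill_swap_xy.2 h022) hj₀ t
      simp only [wt_swap_xy] at this
      exact dvd_sub (this t) (this t')
    obtain ⟨d, hd⟩ := hdi
    obtain ⟨e, he⟩ := hdj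
    have hbound : ∀ t, wt x y z B (topInd i) 1 (leafInd c₃ t) ≤ p * q := by
      intro t
      have b1 : wt x y z B (topInd i) 1 (leafInd c₃ t) ≤ wt x y z B 1 1 (leafInd c₃ t) := by
        refine wt_le fun b _ => ?_
        simp only [topInd, leafInd, Pi.one_apply]
        split_ifs <;> simp
      have b2 := h002.leaf_z c₃ t
      have b3 : wt x y z B 1 1 (topInd c₃) ≤ wt x y z B 1 1 1 := by
        refine wt_le fun b _ => ?_
        simp only [topInd, Pi.one_apply]
        split_ifs <;> simp
      rw [F.wtB, ← b2] at b3
      have : wt x y z B 1 1 (leafInd c₃ t) ≤ p * q := by nlinarith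
      exact b1.trans this
    have hnonneg : ∀ t, 0 ≤ wt x y z B (topInd i) 1 (leafInd c₃ t) := fun t =>
      wt_nonneg (topInd_nonneg _) (by simp) (leafInd_nonneg _ _)
    have hdiff : wt x y z B (topInd i) 1 D = wt x y z B (topInd i) 1 (leafInd c₃ t) -
      wt x y z B (topInd i) 1 (leafInd c₃ t') := by rw [hD, wt_sub_z]
    have hd0 : d = 0 := by
      refine eq_zero_of_mul_add_mul (p := (p : ℤ)) (q := q) (e := e) (N := p * q) (by linarith)
        ?_ ?_ (isCoprime_of_primes F.pq) ?_ ?_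
      · nlinarith [mul_pos (by linarith : (0 : ℤ) < p) (by linarith : (0 : ℤ) < q)]
      · rw [← hd, ← he]; exact e4
      · linarith [hbound t, hnonneg t']
      · linarith [hbound t', hnonneg t]
    rw [hd0, mul_zero] at hd
    linarith
  have := mul_wt_leaf_z c₃ key 0
  have h5 : wt x y z B (topInd i) 1 (topInd c₃) = wt x y z B (topInd i) 1 1 := by
    rw [← wt_swap_yz, M.swap_yz.wt_one_y hi, wt_swap_yz]
  exact ⟨_, by rw [← h5, ← this]⟩

/-- Then pqr divides a > 0, although pa is less than pqr. -/
theorem not_dvd_of_mul_add_mul (F : Factorization x y z A B) {a b : ℤ} (ha : 0 < a) (hb : 0 < b)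
    (h : (p : ℤ) * a + q * b = p * q * r) (hpa : (p : ℤ) ∣ a) (hqa : (q : ℤ) ∣ a)
    (hra : (r : ℤ) ∣ a) : False := by
  have h1 := ((isCoprime_of_primes F.pr).mul_left (isCoprime_of_primes F.qr)).mul_dvd
    ((isCoprime_of_primes F.pq).mul_dvd hpa hqa) hra
  have h2 := Int.le_of_dvd ha h1
  have hp2 := two_le_cast p
  have hq2 := two_le_cast q
  nlinarith

theorem dvd_of_mul_add_mul {P Q R a b : ℤ} (hcop : IsCoprime Q P)
    (h : P * a + Q * b = P * Q * R) : Q ∣ a :=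
  hcop.dvd_of_dvd_mul_left ⟨P * R - b, by linear_combination h⟩

/-- Otherwise B has constant arms with pa + qb = pqr. Vanishing at depth two and coprimality make pq
divide both a and b, so r cannot divide either. This forces 101 and 011 onto A, which makes A
sectional in z; then 202, 022 and 112 must vanish on B, and they yield r ∣ a. -/
theorem IsMajority.kill_110 (M : IsMajority x y z B c₁ c₂ c₃) (F : Factorization x y z A B) :
    Kill x y z A 1 1 0 := by
  by_contra hA
  have hB := (F.kill_or 1 1 0 (by simp)).resolve_left hA
  obtain ⟨hA1, hA1', hB1, -⟩ := M.kill_x F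
  obtain ⟨hA2, hA2', hB2, -⟩ := M.kill_y F
  obtain ⟨hA3, -, hB3, -⟩ := M.kill_z F
  obtain ⟨a, b, ha, hb, hai, hbj, -, hs⟩ := M.of_kill_110 F hB
  obtain ⟨i, hi, -⟩ := exists_wt_top_x_pos (y := y) (z := z) F.spreadBx c₁
  obtain ⟨j, hj, -⟩ := exists_wt_top_y_pos (x := x) (z := z) F.spreadBy c₂
  have hpa : (p : ℤ) ∣ a := ⟨_, by rw [hB1.leaf_x i 0, hai i hi]⟩
  have hqb : (q : ℤ) ∣ b := ⟨_, by rw [hB2.leaf_y j 0, hbj j hj]⟩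
  have hqa : (q : ℤ) ∣ a := dvd_of_mul_add_mul (isCoprime_of_primes F.pq.symm) hs
  have hpb : (p : ℤ) ∣ b := dvd_of_mul_add_mul (isCoprime_of_primes F.pq) (P := q) (R := r)
    (a := b) (b := a) (by linear_combination hs)
  have hA101 : Kill x y z A 1 0 1 := by
    refine (F.kill_or 1 0 1 (by simp)).resolve_right fun h => ?_
    obtain ⟨a', c, -, -, hai', -, -, hs'⟩ := M.swap_yz.of_kill_110 F.swap_yz (kill_swap_yz.2 h)
    have haa := hai' i hi
    rw [wt_swap_yz, hai i hi] at haa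
    subst haa
    exact not_dvd_of_mul_add_mul F ha hb hs hpa hqa
      (dvd_of_mul_add_mul (isCoprime_of_primes F.pr.symm) hs')
  have hA011 : Kill x y z A 0 1 1 := by
    refine (F.kill_or 0 1 1 (by simp)).resolve_right fun h => ?_
    obtain ⟨b', c, -, -, hbj', -, -, hs'⟩ := M.swap_xy.swap_yz.of_kill_110 F.swap_xy.swap_yz
      (kill_swap_yz.2 (kill_swap_xy.2 h))
    have hbb := hbj' j hj
    rw [wt_swap_yz, wt_swap_xy, hbj j hj] at hbb
    subst hbb
    exact not_dvd_of_mul_add_mul F.swap_xy hb ha (by linear_combination hs) hqb hpb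
      (dvd_of_mul_add_mul (isCoprime_of_primes F.qr.symm) hs')
  have hdet := F.det_z hA1 hA2 hA3 hA101 hA011 (M.cross F)
  have hB202 := (F.kill_or 2 0 2 (by simp)).resolve_left fun h =>
    hA1' (kill_zero_of_kill_two hr.out.one_lt hdet h)
  have hB022 := (F.kill_or 0 2 2 (by simp)).resolve_left fun h =>
    hA2' (kill_zero_of_kill_two hr.out.one_lt hdet h)
  have hB112 := (F.kill_or 1 1 2 (by simp)).resolve_left fun h =>
    hA (kill_zero_of_kill_two hr.out.one_lt hdet h)
  have hra := M.dvd_of_kill_112 F hB1 hB2 hB3 hB202 hB022 hB112 hi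
  rw [hai i hi] at hra
  exact not_dvd_of_mul_add_mul F ha hb hs hpa hqa hra

theorem IsMajority.det_z (M : IsMajority x y z B c₁ c₂ c₃) (F : Factorization x y z A B) :
    ∀ a ∈ A, ∀ a' ∈ A, (z a).1 = (z a').1 → (z a).2 = (z a').2 :=
  F.det_z (M.kill_x F).1 (M.kill_y F).1 (M.kill_z F).1
    (kill_swap_yz.1 (M.swap_yz.kill_110 F.swap_yz))
    (kill_swap_xy.1 (kill_swap_yz.1 (M.swap_xy.swap_yz.kill_110 F.swap_xy.swap_yz)))
    (M.cross F)

/-- The bottom digits of the elements of `A` are determined by the top digits, direction by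
direction. -/
def IsSectional (x : α → Dig p) (y : α → Dig q) (z : α → Dig r) (A : Finset α) : Prop :=
  (∀ a ∈ A, ∀ a' ∈ A, (x a).1 = (x a').1 → (x a).2 = (x a').2) ∧
  (∀ a ∈ A, ∀ a' ∈ A, (y a).1 = (y a').1 → (y a).2 = (y a').2) ∧
  (∀ a ∈ A, ∀ a' ∈ A, (z a).1 = (z a').1 → (z a).2 = (z a').2)

theorem IsMajority.isSectional (M : IsMajority x y z B c₁ c₂ c₃) (F : Factorization x y z A B) :
    IsSectional x y z A :=
  ⟨M.swap_xy.swap_yz.det_z F.swap_xy.swap_yz, M.swap_yz.det_z F.swap_yz, M.det_z F⟩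

end

/-! ### The factor opposite a sectional set -/

section
variable {α : Type*} {p q r : ℕ} {x : α → Dig p} {y : α → Dig q} {z : α → Dig r}
  {A B : Finset α}
variable [hp : Fact p.Prime] [hq : Fact q.Prime] [hr : Fact r.Prime]

/-- On a sectional set equal top digits give equal digits, so the map to top triples is injective by
`disj`. The set has as many elements as there are triples. -/
theorem IsSectional.exists_cell (S : IsSectional x y z A) (F : Factorization x y z A B)
    (i : ZMod p) (j : ZMod q) (k : ZMod r) : ∃ a ∈ A, (x a).1 = i ∧ (y a).1 = j ∧ (z a).1 = k := by
  classical
  obtain ⟨b, hb, -⟩ := F.spreadBx 0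
  let φ : α → ZMod p × ZMod q × ZMod r := fun a => ((x a).1, (y a).1, (z a).1)
  have hinj : Set.InjOn φ A := by
    intro a ha a' ha' h
    simp only [φ, Prod.mk.injEq] at h
    have h1 : x a = x a' := Prod.ext h.1 (S.1 a ha a' ha' h.1)
    have h2 : y a = y a' := Prod.ext h.2.1 (S.2.1 a ha a' ha' h.2.1)
    have h3 : z a = z a' := Prod.ext h.2.2 (S.2.2 a ha a' ha' h.2.2)
    exact (F.disj a ha a' ha' b hb b hb (by simp [SameType, h1]) (by simp [SameType, h2])
      (by simp [SameType, h3])).1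
  have himg : A.image φ = Finset.univ := by
    apply Finset.eq_univ_of_card
    rw [Finset.card_image_of_injOn hinj, F.cardA]
    simp only [Fintype.card_prod, ZMod.card]
    ring
  have h0 : (i, j, k) ∈ A.image φ := by rw [himg]; simp
  obtain ⟨a, ha, h⟩ := Finset.mem_image.1 h0
  simp only [φ, Prod.mk.injEq] at h
  exact ⟨a, ha, h⟩

/-- Distinct elements of `B` have a direction in which they differ in the bottom digit only. -/
theorem IsSectional.eq_of_rigid (S : IsSectional x y z A) (F : Factorization x y z A B)
    {b b' : α} (hb : b ∈ B) (hb' : b' ∈ B) (h1 : (x b).1 = (x b').1 → x b = x b')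
    (h2 : (y b).1 = (y b').1 → y b = y b') (h3 : (z b).1 = (z b').1 → z b = z b') : b = b' := by
  obtain ⟨a, ha, ha1, ha2, ha3⟩ := S.exists_cell F (x b).1 (y b).1 (z b).1
  obtain ⟨a', ha', ha1', ha2', ha3'⟩ := S.exists_cell F (x b').1 (y b').1 (z b').1
  -- The elements of A over the cells of b and b' have the same branching type as b and b': on
  -- either side, equal tops mean equal leaves.
  refine (F.disj a ha a' ha' b hb b' hb' ⟨by rw [ha1, ha1'], ?_, ?_⟩ ⟨by rw [ha2, ha2'], ?_, ?_⟩
    ⟨by rw [ha3, ha3'], ?_, ?_⟩).2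
  · intro h; exact h1 (by rw [← ha1, ← ha1', h])
  · intro h
    have : (x a).1 = (x a').1 := by rw [ha1, ha1', h]
    exact Prod.ext this (S.1 a ha a' ha' this)
  · intro h; exact h2 (by rw [← ha2, ← ha2', h])
  · intro h
    have : (y a).1 = (y a').1 := by rw [ha2, ha2', h]
    exact Prod.ext this (S.2.1 a ha a' ha' this)
  · intro h; exact h3 (by rw [← ha3, ← ha3', h])
  · intro h
    have : (z a).1 = (z a').1 := by rw [ha3, ha3', h]
    exact Prod.ext this (S.2.2 a ha a' ha' this)

theorem exists_section {n : ℕ} {w : α → Dig n}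
    (h : ∀ a ∈ A, ∀ a' ∈ A, (w a).1 = (w a').1 → (w a).2 = (w a').2) :
    ∃ u : ZMod n → ZMod n, ∀ a ∈ A, (w a).2 = u (w a).1 := by
  classical
  refine ⟨fun i => if h : ∃ a ∈ A, (w a).1 = i then (w h.choose).2 else 0, fun a ha => ?_⟩
  have hex : ∃ a' ∈ A, (w a').1 = (w a).1 := ⟨a, ha, rfl⟩
  simp only [dif_pos hex]
  exact h a ha _ hex.choose_spec.1 hex.choose_spec.2.symm

/-- Every product of sections meets `B`. -/
theorem IsSectional.exists_mem_section (S : IsSectional x y z A) (F : Factorization x y z A B)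
    (sx : ZMod p → ZMod p) (sy : ZMod q → ZMod q) (sz : ZMod r → ZMod r) :
    ∃ b ∈ B, (x b).2 = sx (x b).1 ∧ (y b).2 = sy (y b).1 ∧ (z b).2 = sz (z b).1 := by
  obtain ⟨u, hu⟩ := exists_section S.1
  obtain ⟨v, hv⟩ := exists_section S.2.1
  obtain ⟨w, hw⟩ := exists_section S.2.2
  -- Over each branch the shear carries the prescribed section of B to the section of A; the matched
  -- element of A lies on its section, so its partner lies on the prescribed one.
  obtain ⟨⟨a, b⟩, ⟨hab, h1, h2, h3⟩, -⟩ := F.existsUnique_pair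
    1 (fun i => Equiv.addRight (u i - sx i)) 1 (fun i => Equiv.addRight (v i - sy i))
    1 (fun i => Equiv.addRight (w i - sz i))
  rw [Finset.mem_product] at hab
  have key : ∀ {n : ℕ} {c d : Dig n} {u s : ZMod n → ZMod n}, c.2 = u c.1 →
      c = Equiv.prodShear 1 (fun i => Equiv.addRight (u i - s i)) d → d.2 = s d.1 := by
    intro n c d u s hc h
    rw [Prod.ext_iff] at h
    simp only [Equiv.prodShear_apply, Equiv.Perm.coe_one, id_eq, Equiv.coe_addRight] at h
    rw [h.1, h.2] at hc
    linear_combination hc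
  exact ⟨b, hab.2, key (hu a hab.1) h1, key (hv a hab.1) h2, key (hw a hab.1) h3⟩

/-! ### Tetrahedral sets -/

/-- The top digits form a regular tetrahedron: pairwise they agree in exactly one direction. -/
structure IsTetra (x : α → Dig p) (y : α → Dig q) (z : α → Dig r) (B : Finset α)
    (i i' : ZMod p) (j j' : ZMod q) (k k' : ZMod r) : Prop where
  hi : i ≠ i'
  hj : j ≠ j'
  hk : k ≠ k'
  mem : ∀ b ∈ B, ((x b).1 = i ∧ (y b).1 = j ∧ (z b).1 = k) ∨
    ((x b).1 = i ∧ (y b).1 = j' ∧ (z b).1 = k') ∨ ((x b).1 = i' ∧ (y b).1 = j ∧ (z b).1 = k') ∨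
    ((x b).1 = i' ∧ (y b).1 = j' ∧ (z b).1 = k)
  ex₀ : ∃ b ∈ B, (x b).1 = i ∧ (y b).1 = j ∧ (z b).1 = k
  ex₁ : ∃ b ∈ B, (x b).1 = i ∧ (y b).1 = j' ∧ (z b).1 = k'
  ex₂ : ∃ b ∈ B, (x b).1 = i' ∧ (y b).1 = j ∧ (z b).1 = k'
  ex₃ : ∃ b ∈ B, (x b).1 = i' ∧ (y b).1 = j' ∧ (z b).1 = k

variable {i i' : ZMod p} {j j' : ZMod q} {k k' : ZMod r}

theorem IsTetra.swap_xy (T : IsTetra x y z B i i' j j' k k') :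
    IsTetra y x z B j j' i i' k k' where
  hi := T.hj
  hj := T.hi
  hk := T.hk
  mem b hb := by have := T.mem b hb; tauto
  ex₀ := by obtain ⟨b, hb, h⟩ := T.ex₀; exact ⟨b, hb, by tauto⟩
  ex₁ := by obtain ⟨b, hb, h⟩ := T.ex₂; exact ⟨b, hb, by tauto⟩
  ex₂ := by obtain ⟨b, hb, h⟩ := T.ex₁; exact ⟨b, hb, by tauto⟩
  ex₃ := by obtain ⟨b, hb, h⟩ := T.ex₃; exact ⟨b, hb, by tauto⟩

theorem IsTetra.swap_yz (T : IsTetra x y z B i i' j j' k k') :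
    IsTetra x z y B i i' k k' j j' where
  hi := T.hi
  hj := T.hk
  hk := T.hj
  mem b hb := by have := T.mem b hb; tauto
  ex₀ := by obtain ⟨b, hb, h⟩ := T.ex₀; exact ⟨b, hb, by tauto⟩
  ex₁ := by obtain ⟨b, hb, h⟩ := T.ex₁; exact ⟨b, hb, by tauto⟩
  ex₂ := by obtain ⟨b, hb, h⟩ := T.ex₃; exact ⟨b, hb, by tauto⟩
  ex₃ := by obtain ⟨b, hb, h⟩ := T.ex₂; exact ⟨b, hb, by tauto⟩

theorem IsTetra.opposite (T : IsTetra x y z B i i' j j' k k') :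
    IsTetra x y z B i' i j' j k k' where
  hi := T.hi.symm
  hj := T.hj.symm
  hk := T.hk
  mem b hb := by have := T.mem b hb; tauto
  ex₀ := T.ex₃
  ex₁ := T.ex₂
  ex₂ := T.ex₁
  ex₃ := T.ex₀

theorem exists_ne_ne {n : ℕ} [NeZero n] (hn : 2 < n) (i i' : ZMod n) : ∃ l, l ≠ i ∧ l ≠ i' := by
  by_contra hcon
  push Not at hcon
  have h : (Finset.univ : Finset (ZMod n)) ⊆ {i, i'} := by
    intro l _
    have := hcon l
    simp only [Finset.mem_insert, Finset.mem_singleton]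
    tauto
  have := Finset.card_le_card h
  rw [Finset.card_univ, ZMod.card] at this
  have := this.trans Finset.card_le_two
  omega

theorem IsTetra.wt_top_x_eq_zero (T : IsTetra x y z B i i' j j' k k') {l : ZMod p} (h1 : l ≠ i)
    (h2 : l ≠ i') (g : Dig q → ℤ) (h : Dig r → ℤ) : wt x y z B (topInd l) g h = 0 := by
  refine wt_eq_zero fun b hb => ?_
  have hl : topInd l (x b) = 0 := if_neg fun e => by
    rcases T.mem b hb with h | h | h | h
    · exact h1 (e.symm.trans h.1)
    · exact h1 (e.symm.trans h.1)
    · exact h2 (e.symm.trans h.1)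
    · exact h2 (e.symm.trans h.1)
  rw [hl]; ring

theorem IsTetra.wt_top_y_eq_zero (T : IsTetra x y z B i i' j j' k k') {l : ZMod q} (h1 : l ≠ j)
    (h2 : l ≠ j') (f : Dig p → ℤ) (h : Dig r → ℤ) : wt x y z B f (topInd l) h = 0 := by
  rw [← wt_swap_xy]; exact T.swap_xy.wt_top_x_eq_zero h1 h2 f h

theorem IsTetra.wt_top_z_eq_zero (T : IsTetra x y z B i i' j j' k k') {l : ZMod r} (h1 : l ≠ k)
    (h2 : l ≠ k') (f : Dig p → ℤ) (g : Dig q → ℤ) : wt x y z B f g (topInd l) = 0 := by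
  rw [← wt_swap_yz]; exact T.swap_yz.wt_top_y_eq_zero h1 h2 f g

theorem IsTetra.wt_one_z (T : IsTetra x y z B i i' j j' k k') (f : Dig p → ℤ) (g : Dig q → ℤ) :
    wt x y z B f g 1 = wt x y z B f g (topInd k) + wt x y z B f g (topInd k') := by
  simp only [wt, ← Finset.sum_add_distrib]
  refine Finset.sum_congr rfl fun b hb => ?_
  have h1 := T.mem b hb
  have h2 := T.hk
  have h3 : (z b).1 = k ∨ (z b).1 = k' := by tauto
  simp only [topInd, Pi.one_apply]
  rcases h3 with h3 | h3
  · rw [if_pos h3, if_neg (h3 ▸ h2)]; ring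
  · rw [if_pos h3, if_neg (h3 ▸ h2.symm)]; ring

theorem IsTetra.wt_one_y (T : IsTetra x y z B i i' j j' k k') (f : Dig p → ℤ) (h : Dig r → ℤ) :
    wt x y z B f 1 h = wt x y z B f (topInd j) h + wt x y z B f (topInd j') h := by
  simp only [← wt_swap_yz (y := y)]
  exact T.swap_yz.wt_one_z f h

theorem IsTetra.wt_one_x (T : IsTetra x y z B i i' j j' k k') (g : Dig q → ℤ) (h : Dig r → ℤ) :
    wt x y z B 1 g h = wt x y z B (topInd i) g h + wt x y z B (topInd i') g h := by
  simp only [← wt_swap_xy (x := x)]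
  exact T.swap_xy.wt_one_y g h

theorem IsTetra.wt_cell_pos (T : IsTetra x y z B i i' j j' k k') :
    0 < wt x y z B (topInd i) (topInd j) (topInd k) := by
  obtain ⟨b, hb, h1, h2, h3⟩ := T.ex₀
  exact wt_pos (topInd_nonneg _) (topInd_nonneg _) (topInd_nonneg _) hb (by simp [topInd, *])

/-- The cell `(i, j, k')` is empty. -/
theorem IsTetra.empty_cell (T : IsTetra x y z B i i' j j' k k') {f : Dig p → ℤ} {g : Dig q → ℤ}
    {h : Dig r → ℤ} (hf : ∀ u, u.1 ≠ i → f u = 0) (hg : ∀ u, u.1 ≠ j → g u = 0)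
    (hh : ∀ u, u.1 ≠ k' → h u = 0) : wt x y z B f g h = 0 := by
  refine wt_eq_zero fun b hb => ?_
  by_cases h1 : (x b).1 = i
  swap
  · rw [hf _ h1]; ring
  by_cases h2 : (y b).1 = j
  swap
  · rw [hg _ h2]; ring
  by_cases h3 : (z b).1 = k'
  swap
  · rw [hh _ h3]; ring
  have := T.mem b hb
  have := T.hi
  have := T.hj
  have := T.hk
  exfalso
  simp_all

theorem topInd_of_ne {n : ℕ} {i : ZMod n} (u : Dig n) (h : u.1 ≠ i) : topInd i u = 0 := if_neg h

theorem leafInd_of_ne {n : ℕ} {i t : ZMod n} (u : Dig n) (h : u.1 ≠ i) : leafInd i t u = 0 :=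
  if_neg fun e => h e.1

/-- The occupied cells of B over branch k are (i, j, k) and (i', j', k). If they always agreed in
the bottom z-digit, branch k would occupy a single leaf, against the uniform distribution given by
002. A disagreeing pair has the type to be excluded from A. -/
theorem IsTetra.cross (T : IsTetra x y z B i i' j j' k k') (F : Factorization x y z A B)
    (hB : Kill x y z B 0 0 2) : ∀ a ∈ A, ∀ a' ∈ A, (z a).1 = (z a').1 → (x a).1 ≠ (x a').1 →
      (y a).1 ≠ (y a').1 → (z a).2 = (z a').2 := by
  have hi := T.hi
  have hj := T.hj
  by_cases hex : ∃ b ∈ B, ∃ b' ∈ B, ((x b).1 = i ∧ (y b).1 = j ∧ (z b).1 = k) ∧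
      ((x b').1 = i' ∧ (y b').1 = j' ∧ (z b').1 = k) ∧ (z b).2 ≠ (z b').2
  · obtain ⟨b, hb, b', hb', h1, h2, h3⟩ := hex
    intro a ha a' ha' h4 h5 h6
    by_contra h7
    have hx : (x b).1 ≠ (x b').1 := by rw [h1.1, h2.1]; exact hi
    have hy : (y b).1 ≠ (y b').1 := by rw [h1.2.1, h2.2.1]; exact hj
    have := F.disj a ha a' ha' b hb b' hb'
      ⟨iff_of_false h5 hx, iff_of_false (fun h => h5 (by rw [h])) (fun h => hx (by rw [h]))⟩
      ⟨iff_of_false h6 hy, iff_of_false (fun h => h6 (by rw [h])) (fun h => hy (by rw [h]))⟩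
      ⟨iff_of_true h4 (h1.2.2.trans h2.2.2.symm),
        iff_of_false (fun h => h7 (by rw [h])) (fun h => h3 (by rw [h]))⟩
    exact h5 (by rw [this.1])
  exfalso
  push Not at hex
  obtain ⟨b, hb, h1⟩ := T.ex₀
  obtain ⟨b', hb', h2⟩ := T.ex₃
  have e := hB.leaf_z k ((z b).2 + 1)
  have h3 : 0 < wt x y z B 1 1 (topInd k) :=
    wt_pos (by simp) (by simp) (topInd_nonneg _) hb (by simp [topInd, h1])
  have h4 : wt x y z B 1 1 (leafInd k ((z b).2 + 1)) = 0 := by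
    refine wt_eq_zero fun c hc => ?_
    have h5 : leafInd k ((z b).2 + 1) (z c) = 0 := by
      refine if_neg ?_
      rintro ⟨h6, h7⟩
      have h8 : (z c).2 = (z b).2 := by
        have := T.hk
        rcases T.mem c hc with h | h | h | h
        · rw [hex c hc b' hb' h h2, hex b hb b' hb' h1 h2]
        · exact absurd (h6.symm.trans h.2.2) this
        · exact absurd (h6.symm.trans h.2.2) this
        · exact (hex b hb c hc h1 h).symm
      rw [h8] at h7
      simp at h7
    rw [h5, mul_zero]
  rw [h4, mul_zero] at e
  exact h3.ne e

/-- A tetrahedral set is not a factor if the other factor is sectional. -/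
theorem IsTetra.not_isSectional (T : IsTetra x y z B i i' j j' k k')
    (F : Factorization x y z A B) (S : IsSectional x y z A) : False := by
  classical
  have hi := T.hi
  have hj := T.hj
  have hk := T.hk
  obtain ⟨g, hg, g1, g2, g3⟩ := T.ex₁
  obtain ⟨h, hh, h1, h2, h3⟩ := T.ex₂
  obtain ⟨l, hl, l1, l2, l3⟩ := T.ex₃
  -- The section passes through g over i and l over i' in x, through g in y and through h in z.
  -- Whichever of the four cells contains b, one of g, h, l in a different cell shares its only
  -- common top digit and, by this choice, the corresponding bottom digit; rigidity makes them
  -- equal.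
  obtain ⟨b, hb, bx, bz, by'⟩ := S.exists_mem_section F
    (fun t => if t = i then (x g).2 else (x l).2) (fun _ => (y g).2) (fun _ => (z h).2)
  have key : ∀ c ∈ B, ∀ d ∈ B, ((x c).1 = (x d).1 → x c = x d) →
      ((y c).1 = (y d).1 → y c = y d) → ((z c).1 = (z d).1 → z c = z d) → c = d :=
    fun c hc d hd e1 e2 e3 => S.eq_of_rigid F hc hd e1 e2 e3
  rcases T.mem b hb with ⟨b1, b2, b3⟩ | ⟨b1, b2, b3⟩ | ⟨b1, b2, b3⟩ | ⟨b1, b2, b3⟩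
  · have : b = g := key b hb g hg (fun e => Prod.ext e (by simp_all))
      (fun e => absurd (b2.symm.trans (e.trans g2)) hj)
      (fun e => absurd (b3.symm.trans (e.trans g3)) hk)
    subst this
    exact hj (b2.symm.trans g2)
  · have : b = h := key b hb h hh (fun e => absurd (b1.symm.trans (e.trans h1)) hi)
      (fun e => absurd (b2.symm.trans (e.trans h2)) hj.symm)
      (fun e => Prod.ext e (by simp_all))
    subst this
    exact hi (b1.symm.trans h1)
  · have : b = l := key b hb l hl (fun e => Prod.ext e (by rw [bx, b1, if_neg (Ne.symm hi)]))
      (fun e => absurd (b2.symm.trans (e.trans l2)) hj)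
      (fun e => absurd (b3.symm.trans (e.trans l3)) hk.symm)
    subst this
    exact hj (b2.symm.trans l2)
  · have : b = g := key b hb g hg (fun e => absurd (b1.symm.trans (e.trans g1)) hi.symm)
      (fun e => Prod.ext e (by simp_all))
      (fun e => absurd (b3.symm.trans (e.trans g3)) hk)
    subst this
    exact hi (g1.symm.trans b1)

end

/-- A colouring of an array with `p ≥ 3` rows, two columns, row sums two and column sums at least
two is constant if entries in different rows and columns have the same colour. -/
theorem color_eq_of_cross_two {α γ : Type*} {p : ℕ} [NeZero p] {S : Finset α} {X : α → ZMod p}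
    {Y : α → ZMod 2} {C : α → γ} (hp : 2 < p)
    (hrow : ∀ i, (S.filter fun a => X a = i).card = 2)
    (hcol : ∀ j, 2 ≤ (S.filter fun a => Y a = j).card)
    (hC : ∀ a ∈ S, ∀ a' ∈ S, X a ≠ X a' → Y a ≠ Y a' → C a = C a')
    {a a' : α} (ha : a ∈ S) (ha' : a' ∈ S) : C a = C a' := by
  classical
  have hY : ∀ s t u : ZMod 2, s ≠ t → u = s ∨ u = t := by decide
  have hpick : ∀ i, ∃ b ∈ S, X b = i := by
    intro i
    have : 0 < (S.filter fun a => X a = i).card := by rw [hrow]; omega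
    obtain ⟨b, hb⟩ := Finset.card_pos.1 this
    exact ⟨b, (Finset.mem_filter.1 hb).1, (Finset.mem_filter.1 hb).2⟩
  -- three elements of a row cannot be pairwise distinct
  have hthree : ∀ b ∈ S, ∀ c ∈ S, ∀ d ∈ S, X b = X c → X c = X d → b ≠ c → b ≠ d → c ≠ d →
      False := by
    intro b hb c hc d hd h1 h2 h3 h4 h5
    have hsub : ({b, c, d} : Finset α) ⊆ S.filter fun a => X a = X d := by
      intro e he
      simp only [Finset.mem_insert, Finset.mem_singleton] at he
      rw [Finset.mem_filter]
      rcases he with rfl | rfl | rfl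
      · exact ⟨hb, h1.trans h2⟩
      · exact ⟨hc, h2⟩
      · exact ⟨hd, rfl⟩
    have := Finset.card_le_card hsub
    rw [hrow, Finset.card_eq_three.2 ⟨b, c, d, h3, h4, h5, rfl⟩] at this
    omega
  have hcol' : ∀ b ∈ S, ∃ c ∈ S, Y c = Y b ∧ c ≠ b := by
    intro b hb
    obtain ⟨c, hc, hcb⟩ := Finset.exists_mem_ne (lt_of_lt_of_le one_lt_two (hcol (Y b))) b
    exact ⟨c, (Finset.mem_filter.1 hc).1, (Finset.mem_filter.1 hc).2, hcb⟩
  have hother : ∀ b ∈ S, ∃ c ∈ S, ∃ d ∈ S, Y c ≠ Y b ∧ Y d ≠ Y b ∧ c ≠ d := by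
    intro b hb
    obtain ⟨c, hc, d, hd, hcd⟩ := Finset.one_lt_card.1 (lt_of_lt_of_le one_lt_two (hcol (Y b + 1)))
    rw [Finset.mem_filter] at hc hd
    exact ⟨c, hc.1, d, hd.1, by simp [hc.2], by simp [hd.2], hcd⟩
  by_contra hne
  have haa : a ≠ a' := fun h => hne (by rw [h])
  by_cases hX : X a = X a'
  · by_cases hYY : Y a = Y a'
    · obtain ⟨c, hc, d, hd, h1, h2, h3⟩ := hother a ha
      have hcX : X c ≠ X a := fun h => hthree c hc a ha a' ha' h hX (fun h => h1 (by rw [h]))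
        (fun h => h1 (by rw [h, hYY])) haa
      exact hne ((hC c hc a ha hcX h1).symm.trans (hC c hc a' ha' (hX ▸ hcX) (hYY ▸ h1)))
    · obtain ⟨c, hc, hcY, hca⟩ := hcol' a ha
      obtain ⟨d, hd, hdY, hda⟩ := hcol' a' ha'
      have hcX : X c ≠ X a := fun h => hthree c hc a ha a' ha' h hX hca
        (fun h => hYY (by rw [← hcY, h])) haa
      have hdX : X d ≠ X a := fun h => hthree d hd a ha a' ha' h hX
        (fun h => hYY (by rw [← hdY, h])) hda haa
      have e1 : C c = C a' := hC c hc a' ha' (hX ▸ hcX) (hcY ▸ hYY)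
      have e2 : C d = C a := hC d hd a ha hdX (by rw [hdY]; exact Ne.symm hYY)
      by_cases hcd : X c = X d
      · obtain ⟨l, hl1, hl2⟩ := exists_ne_ne hp (X a) (X c)
        obtain ⟨e, he, rfl⟩ := hpick l
        rcases hY (Y a) (Y a') (Y e) hYY with h | h
        · have e3 : C e = C a' := hC e he a' ha' (hX ▸ hl1) (h ▸ hYY)
          have e4 : C e = C d := hC e he d hd (hcd ▸ hl2) (by rw [h, hdY]; exact hYY)
          exact hne (e2.symm.trans (e4.symm.trans e3))
        · have e3 : C e = C a := hC e he a ha hl1 (h ▸ Ne.symm hYY)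
          have e4 : C e = C c := hC e he c hc hl2 (by rw [h, hcY]; exact Ne.symm hYY)
          exact hne (e3.symm.trans (e4.trans e1))
      · have e3 : C c = C d := hC c hc d hd hcd (by rw [hcY, hdY]; exact hYY)
        exact hne (e2.symm.trans (e3.symm.trans e1))
  · by_cases hYY : Y a = Y a'
    swap
    · exact hne (hC a ha a' ha' hX hYY)
    have hloc : ∀ c ∈ S, Y c ≠ Y a → X c = X a ∨ X c = X a' := by
      intro c hc h
      by_contra hcon
      push Not at hcon
      exact hne ((hC c hc a ha hcon.1 h).symm.trans (hC c hc a' ha' hcon.2 (hYY ▸ h)))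
    obtain ⟨l, hl1, hl2⟩ := exists_ne_ne hp (X a) (X a')
    obtain ⟨e, he, rfl⟩ := hpick l
    have heY : Y e = Y a := by
      by_contra h
      rcases hloc e he h with h | h
      · exact hl1 h
      · exact hl2 h
    have hca : ∀ c ∈ S, Y c ≠ Y a → X c = X a → C c = C a' := fun c hc h1 h2 =>
      hC c hc a' ha' (h2 ▸ hX) (hYY ▸ h1)
    have hca' : ∀ c ∈ S, Y c ≠ Y a → X c = X a' → C c = C a := fun c hc h1 h2 =>
      hC c hc a ha (h2 ▸ Ne.symm hX) h1
    have hce : ∀ c ∈ S, Y c ≠ Y a → C c = C e := by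
      intro c hc h
      refine hC c hc e he ?_ (heY ▸ h)
      rcases hloc c hc h with h | h
      · rw [h]; exact hl1.symm
      · rw [h]; exact hl2.symm
    obtain ⟨c, hc, d, hd, h1, h2, h3⟩ := hother a ha
    rcases hloc c hc h1 with k1 | k1 <;> rcases hloc d hd h2 with k2 | k2
    · exact hthree c hc d hd a ha (k1.trans k2.symm) k2 h3 (fun h => h1 (by rw [h]))
        (fun h => h2 (by rw [h]))
    · exact hne ((hca' d hd h2 k2).symm.trans ((hce d hd h2).trans ((hce c hc h1).symm.trans
        (hca c hc h1 k1))))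
    · exact hne ((hca' c hc h1 k1).symm.trans ((hce c hc h1).trans ((hce d hd h2).symm.trans
        (hca d hd h2 k2))))
    · exact hthree c hc d hd a' ha' (k1.trans k2.symm) k2 h3 (fun h => h1 (by rw [h, hYY]))
        (fun h => h2 (by rw [h, hYY]))

theorem zmod_two_eq_of_ne_add_one : ∀ u v : ZMod 2, u ≠ v + 1 → u = v := by decide

/-! ### Excluding the tetrahedron -/

section
variable {α : Type*} {p q r : ℕ} {x : α → Dig p} {y : α → Dig q} {z : α → Dig r}
  {A B : Finset α}
variable [hp : Fact p.Prime] [hq : Fact q.Prime] [hr : Fact r.Prime]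
variable {i i' : ZMod p} {j j' : ZMod q} {k k' : ZMod r}

/-- A third branch exists and is empty, whereas vanishing would give it qr elements. -/
theorem IsTetra.not_kill_100 (T : IsTetra x y z B i i' j j' k k') (F : Factorization x y z A B)
    (hp3 : 2 < p) : ¬ Kill x y z B 1 0 0 := by
  intro h
  obtain ⟨l, h1, h2⟩ := exists_ne_ne hp3 i i'
  have e := h.top_x F.wtB l
  rw [T.wt_top_x_eq_zero h1 h2] at e
  have := two_le_cast q
  have := two_le_cast r
  nlinarith

theorem IsTetra.wt_pair_pos (T : IsTetra x y z B i i' j j' k k') :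
    0 < wt x y z B (topInd i) (topInd j) 1 := by
  rw [T.wt_one_z]
  have h1 := T.wt_cell_pos
  have h2 : 0 ≤ wt x y z B (topInd i) (topInd j) (topInd k') :=
    wt_nonneg (topInd_nonneg _) (topInd_nonneg _) (topInd_nonneg _)
  linarith

/-- Using an empty third branch in each direction leaves only the corner (i, j) in the mixed
difference, and that corner is occupied. -/
theorem IsTetra.not_kill_110 (T : IsTetra x y z B i i' j j' k k') (hp3 : 2 < p) (hq3 : 2 < q) :
    ¬ Kill x y z B 1 1 0 := by
  intro h
  obtain ⟨l, h1, h2⟩ := exists_ne_ne hp3 i i'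
  obtain ⟨m, h3, h4⟩ := exists_ne_ne hq3 j j'
  have e := Kill.top_top (fun f hf g hg => h f hf g hg 1 rfl) i l j m
  rw [T.wt_top_x_eq_zero h1 h2, T.wt_top_x_eq_zero h1 h2, T.wt_top_y_eq_zero h3 h4] at e
  linarith [T.wt_pair_pos]

theorem IsTetra.not_kill_111 (T : IsTetra x y z B i i' j j' k k') (hp3 : 2 < p) (hq3 : 2 < q) :
    ¬ Kill x y z B 1 1 1 := by
  intro h
  obtain ⟨l, h1, h2⟩ := exists_ne_ne hp3 i i'
  obtain ⟨m, h3, h4⟩ := exists_ne_ne hq3 j j'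
  have e := Kill.top_top (fun f hf g hg => h f hf g hg _ (top_mem_testFns k k')) i l j m
  rw [T.wt_top_x_eq_zero h1 h2, T.wt_top_x_eq_zero h1 h2, T.wt_top_y_eq_zero h3 h4, wt_sub_z,
    T.empty_cell topInd_of_ne topInd_of_ne topInd_of_ne] at e
  linarith [T.wt_cell_pos]

/-- A vanishing component `101` equates the two halves of the branch `i`. -/
theorem IsTetra.wt_eq_of_kill_101 (T : IsTetra x y z B i i' j j' k k') (hp3 : 2 < p)
    (h : Kill x y z B 1 0 1) :
    wt x y z B (topInd i) 1 (topInd k) = wt x y z B (topInd i) 1 (topInd k') ∧ r = 2 := by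
  obtain ⟨l, h1, h2⟩ := exists_ne_ne hp3 i i'
  have e : ∀ m m', wt x y z B (topInd i) 1 (topInd m) = wt x y z B (topInd i) 1 (topInd m') := by
    intro m m'
    have e := h _ (top_mem_testFns i l) 1 rfl _ (top_mem_testFns m m')
    simp only [wt_sub_x, wt_sub_z, T.wt_top_x_eq_zero h1 h2] at e
    linarith
  refine ⟨e k k', ?_⟩
  by_contra hr2
  have hr3 : 2 < r := lt_of_le_of_ne hr.out.two_le (Ne.symm hr2)
  obtain ⟨m, h3, h4⟩ := exists_ne_ne hr3 k k'
  have e1 := e k m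
  rw [T.wt_top_z_eq_zero h3 h4] at e1
  have := T.swap_yz.wt_pair_pos
  rw [wt_swap_yz] at this
  linarith

/-- Against an empty third x-branch, 121 makes the y-leaves uniform inside each occupied cell of
branch i. With 220 this remains true over each single x-leaf, so q divides every leaf count; 200
supplies the factor p. -/
theorem IsTetra.dvd_wt_top_x (T : IsTetra x y z B i i' j j' k k') (hp3 : 2 < p)
    (h200 : Kill x y z B 2 0 0) (h220 : Kill x y z B 2 2 0) (h121 : Kill x y z B 1 2 1) :
    (p : ℤ) * q ∣ wt x y z B (topInd i) 1 1 := by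
  obtain ⟨l, h1, h2⟩ := exists_ne_ne hp3 i i'
  -- within each cell, the distribution in direction `y` is uniform
  have hcell : ∀ m, m = j ∨ m = j' → ∀ s s',
      wt x y z B (topInd i) (leafInd m s - leafInd m s') 1 = 0 := by
    intro m hm s s'
    have e := h121 _ (top_mem_testFns i l) _ (leaf_mem_testFns m s s') _ (top_mem_testFns k k')
    rw [wt_sub_x, T.wt_top_x_eq_zero h1 h2, wt_sub_z] at e
    rw [T.wt_one_z]
    have hz : ∀ {m : ZMod q} (u : Dig q), u.1 ≠ m → (leafInd m s - leafInd m s') u = 0 :=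
      fun u hu => by
        rw [Pi.sub_apply, leafInd_of_ne u hu, leafInd_of_ne u hu, sub_zero]
    rcases hm with rfl | rfl
    · have := T.empty_cell (topInd_of_ne (i := i)) (hz (m := m)) (topInd_of_ne (i := k'))
      rw [this] at e ⊢
      linarith
    · have : wt x y z B (topInd i) (leafInd m s - leafInd m s') (topInd k) = 0 := by
        refine wt_eq_zero fun b hb => ?_
        have h3 := T.mem b hb
        have h4 := T.hi
        have h5 := T.hj
        have h6 := T.hk
        by_cases h7 : (x b).1 = i
        swap
        · rw [topInd_of_ne _ h7]; ring
        by_cases h8 : (y b).1 = m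
        swap
        · rw [hz _ h8]; ring
        by_cases h9 : (z b).1 = k
        swap
        · rw [topInd_of_ne _ h9]; ring
        exfalso
        simp_all
      rw [this] at e ⊢
      linarith
  have hleaf : ∀ m, m = j ∨ m = j' → ∀ t, (q : ℤ) ∣ wt x y z B (leafInd i t) (topInd m) 1 := by
    intro m hm t
    have key : ∀ s s', wt x y z B (leafInd i t) (leafInd m s) 1 =
        wt x y z B (leafInd i t) (leafInd m s') 1 := by
      intro s s'
      have e := mul_wt_leaf_x (x := x) (y := y) (z := z) (A := B)
        (g := leafInd m s - leafInd m s') (h := 1) i (fun t t' => by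
          have := h220 _ (leaf_mem_testFns i t t') _ (leaf_mem_testFns m s s') 1 rfl
          rw [wt_sub_x] at this
          exact sub_eq_zero.1 this) t
      rw [hcell m hm s s'] at e
      have e' := (mul_eq_zero.1 e).resolve_left (by exact_mod_cast hp.out.ne_zero)
      rw [wt_sub_y] at e'
      exact sub_eq_zero.1 e'
    exact ⟨_, (mul_wt_leaf_y m key 0).symm⟩
  rw [← h200.leaf_x i 0]
  refine mul_dvd_mul_left _ ?_
  rw [T.wt_one_y]
  exact dvd_add (hleaf j (Or.inl rfl) 0) (hleaf j' (Or.inr rfl) 0)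

theorem wt_top_top_one (i : ZMod p) (j : ZMod q) : wt x y z A (topInd i) (topInd j) 1 =
    (((A.filter fun a => (y a).1 = j).filter fun a => (x a).1 = i).card : ℤ) := by
  rw [← wt_swap_yz, wt_top_one_top]

/-- Vanishing on B would force r = 2 and split both x-branches into equal halves. Then A is
sectional in y by the two-column colouring, and the resulting divisibility gives each of the two
x-branches exactly pq elements, an odd number. -/
theorem IsTetra.kill_101 (T : IsTetra x y z B i i' j j' k k') (F : Factorization x y z A B)
    (hp3 : 2 < p) (hq3 : 2 < q) : Kill x y z A 1 0 1 := by
  by_contra hA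
  have hB := (F.kill_or 1 0 1 (by simp)).resolve_left hA
  obtain ⟨s1, rfl⟩ := T.wt_eq_of_kill_101 hp3 hB
  obtain ⟨s2, -⟩ := T.opposite.wt_eq_of_kill_101 hp3 hB
  obtain ⟨hA1, hA1', hB1, -⟩ := F.kill_x.resolve_right fun h => T.not_kill_100 F hp3 h.1
  obtain ⟨hA2, -, hB2, -⟩ := F.kill_y.resolve_right fun h =>
    T.swap_xy.not_kill_100 F.swap_xy hq3 (kill_swap_xy.2 h.1)
  have hA110 := (F.kill_or 1 1 0 (by simp)).resolve_right (T.not_kill_110 hp3 hq3)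
  have hp2 := two_le_cast p
  have hq2 := two_le_cast q
  have hodd : ¬ (2 : ℤ) ∣ p * q := by
    intro h
    rcases Int.prime_two.dvd_or_dvd h with h | h
    · have := (Nat.prime_dvd_prime_iff_eq Nat.prime_two hp.out).1 (by exact_mod_cast h)
      omega
    · have := (Nat.prime_dvd_prime_iff_eq Nat.prime_two hq.out).1 (by exact_mod_cast h)
      omega
  have hcard := F.wtB
  rw [T.wt_one_x, T.wt_one_z, T.wt_one_z] at hcard
  -- If 011 vanished on B, all four occupied cells would have the same size, one quarter of 2pq, and
  -- pq would be even.
  have hA011 : Kill x y z A 0 1 1 := by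
    refine (F.kill_or 0 1 1 (by simp)).resolve_right fun h => ?_
    obtain ⟨s3, -⟩ := T.swap_xy.wt_eq_of_kill_101 hq3 (kill_swap_xy.2 h)
    rw [wt_swap_xy (x := x), wt_swap_xy (x := x)] at s3
    have e1 : wt x y z B 1 (topInd j) (topInd k) = wt x y z B (topInd i) 1 (topInd k) := by
      refine wt_congr fun b hb => ?_
      have h3 := T.mem b hb
      have h4 := T.hi
      have h5 := T.hj
      have h6 := T.hk
      simp only [topInd, Pi.one_apply]
      grind
    have e2 : wt x y z B 1 (topInd j) (topInd k') = wt x y z B (topInd i') 1 (topInd k') := by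
      refine wt_congr fun b hb => ?_
      have h3 := T.mem b hb
      have h4 := T.hi
      have h5 := T.hj
      have h6 := T.hk
      simp only [topInd, Pi.one_apply]
      grind
    refine hodd ⟨wt x y z B (topInd i) 1 (topInd k), ?_⟩
    push_cast at hcard
    linarith
  -- each branch in direction `y` is a coloured array
  have hrow : ∀ i j, wt x y z A (topInd i) (topInd j) 1 = 2 := by
    intro i j
    have h1 := mul_wt_top_y (fun g hg => _root_.wt_top_x_eq_zero (fun f hf => hA2 f hf g hg 1 rfl)
      (fun f hf => hA110 f hf g hg 1 rfl) i) j
    rw [hA1.top_x F.wtA] at h1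
    exact mul_left_cancel₀ (by positivity) h1
  have hcol : ∀ j k, 2 ≤ wt x y z A 1 (topInd j) (topInd k) := by
    intro j k
    have h1 := mul_wt_top_y (fun g hg => _root_.wt_top_z_eq_zero (fun h hh => hA2 1 rfl g hg h hh)
      (fun h hh => hA011 1 rfl g hg h hh) k) j
    -- If A kills 001, the column has p elements. If it kills 002 instead, the column count is even
    -- and positive.
    rcases F.kill_z with h | h
    · rw [h.1.top_z F.wtA] at h1
      have : wt x y z A 1 (topInd j) (topInd k) = p :=
        mul_left_cancel₀ (by positivity : (q : ℤ) ≠ 0) (h1.trans (mul_comm _ _))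
      rw [this]; exact hp2
    · have h2 : (2 : ℤ) ∣ q * wt x y z A 1 (topInd j) (topInd k) := by
        rw [h1, ← h.2.2.1.leaf_z k 0]
        exact dvd_mul_right _ _
      have h3 : (2 : ℤ) ∣ wt x y z A 1 (topInd j) (topInd k) :=
        (Int.prime_two.dvd_or_dvd h2).resolve_left fun h => hodd (Dvd.dvd.mul_left h _)
      have h4 : 0 < wt x y z A 1 1 (topInd k) := by
        obtain ⟨a, ha, hak⟩ := F.spreadAz (k + 1)
        exact wt_pos (by simp) (by simp) (topInd_nonneg _) ha
          (by simp [topInd, zmod_two_eq_of_ne_add_one _ _ hak])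
      rw [← h1] at h4
      exact Int.le_of_dvd (pos_of_mul_pos_right h4 (by positivity)) h3
  have hcross := T.swap_yz.cross F.swap_yz (kill_swap_yz.2 hB2)
  have hdet : ∀ a ∈ A, ∀ a' ∈ A, (y a).1 = (y a').1 → (y a).2 = (y a').2 := by
    intro a ha a' ha' h
    refine color_eq_of_cross_two (S := A.filter fun b => (y b).1 = (y a).1)
      (X := fun b => (x b).1) (Y := fun b => (z b).1) (C := fun b => (y b).2) hp3 ?_ ?_ ?_
      (by simp [ha]) (by simp [ha', h])
    · intro i
      have := hrow i (y a).1
      rw [wt_top_top_one] at this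
      exact_mod_cast this
    · intro k
      have := hcol (y a).1 k
      rw [← wt_swap_yz, wt_one_top_top] at this
      exact_mod_cast this
    · intro b hb b' hb' h1 h2
      rw [Finset.mem_filter] at hb hb'
      exact hcross b hb.1 b' hb'.1 (hb.2.trans hb'.2.symm) h1 h2
  have hB121 := (F.kill_or 1 2 1 (by simp)).resolve_left fun h =>
    hA (kill_swap_yz.1 (kill_zero_of_kill_two hq.out.one_lt hdet (kill_swap_yz.2 h)))
  have hB220 := (F.kill_or 2 2 0 (by simp)).resolve_left fun h =>
    hA1' (kill_swap_yz.1 (kill_zero_of_kill_two hq.out.one_lt hdet (kill_swap_yz.2 h)))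
  obtain ⟨m, hm⟩ := T.dvd_wt_top_x hp3 hB1 hB220 hB121
  obtain ⟨m', hm'⟩ := T.opposite.dvd_wt_top_x hp3 hB1 hB220 hB121
  have hpos : 0 < wt x y z B (topInd i) 1 1 := by
    rw [T.wt_one_y]
    have h1 := T.wt_pair_pos
    have h2 : 0 ≤ wt x y z B (topInd i) (topInd j') 1 :=
      wt_nonneg (topInd_nonneg _) (topInd_nonneg _) (by simp)
    linarith
  have hpos' : 0 < wt x y z B (topInd i') 1 1 := by
    rw [T.wt_one_y]
    have h1 := T.opposite.wt_pair_pos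
    have h2 : 0 ≤ wt x y z B (topInd i') (topInd j) 1 :=
      wt_nonneg (topInd_nonneg _) (topInd_nonneg _) (by simp)
    linarith
  have hpq0 : (0 : ℤ) < p * q := by positivity
  have hm1 : 0 < m := by rw [hm] at hpos; exact pos_of_mul_pos_right hpos hpq0.le
  have hm1' : 0 < m' := by rw [hm'] at hpos'; exact pos_of_mul_pos_right hpos' hpq0.le
  rw [T.wt_one_z] at hm hm'
  have hsum : (p : ℤ) * q * (m + m') = p * q * 2 := by
    push_cast at hcard
    linarith
  have hmm := mul_left_cancel₀ hpq0.ne' hsum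
  have hm2 : m = 1 := by omega
  rw [hm2] at hm
  exact hodd ⟨wt x y z B (topInd i) 1 (topInd k), by linarith⟩

/-- Every combination of depths at most one, other than 001 and the constant component, vanishes on
A. If A kills 002, then A lies in one z-branch; if it kills 001, then A is sectional in all
directions. Neither is possible. -/
theorem IsTetra.false_of_two_lt (T : IsTetra x y z B i i' j j' k k')
    (F : Factorization x y z A B) (hp3 : 2 < p) (hq3 : 2 < q) : False := by
  obtain ⟨hA1, -, hB1, -⟩ := F.kill_x.resolve_right fun h => T.not_kill_100 F hp3 h.1
  obtain ⟨hA2, -, hB2, -⟩ := F.kill_y.resolve_right fun h =>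
    T.swap_xy.not_kill_100 F.swap_xy hq3 (kill_swap_xy.2 h.1)
  have h110 := (F.kill_or 1 1 0 (by simp)).resolve_right (T.not_kill_110 hp3 hq3)
  have h111 := (F.kill_or 1 1 1 (by simp)).resolve_right (T.not_kill_111 hp3 hq3)
  have h101 := T.kill_101 F hp3 hq3
  have h011 : Kill x y z A 0 1 1 := kill_swap_xy.1 (T.swap_xy.kill_101 F.swap_xy hq3 hp3)
  rcases F.kill_z with ⟨hA3, -, hB3, -⟩ | ⟨-, -, hA3, -⟩
  swap
  · exact F.not_flat hA1 hA2 h110 h101 h011 h111 hA3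
  refine T.not_isSectional F ⟨?_, ?_, ?_⟩
  · exact F.swap_xy.swap_yz.det_z (kill_swap_yz.2 (kill_swap_xy.2 hA2))
      (kill_swap_yz.2 (kill_swap_xy.2 hA3)) (kill_swap_yz.2 (kill_swap_xy.2 hA1))
      (kill_swap_yz.2 (kill_swap_xy.2 h110)) (kill_swap_yz.2 (kill_swap_xy.2 h101))
      (T.swap_xy.swap_yz.cross F.swap_xy.swap_yz (kill_swap_yz.2 (kill_swap_xy.2 hB1)))
  · exact F.swap_yz.det_z (kill_swap_yz.2 hA1) (kill_swap_yz.2 hA3) (kill_swap_yz.2 hA2)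
      (kill_swap_yz.2 h110) (kill_swap_yz.2 h011)
      (T.swap_yz.cross F.swap_yz (kill_swap_yz.2 hB2))
  · exact F.det_z hA1 hA2 hA3 h101 h011 (T.cross F hB3)

/-- At most one of three distinct primes is 2, and a permutation moves it to the third direction. -/
theorem IsTetra.not_factorization (T : IsTetra x y z B i i' j j' k k')
    (F : Factorization x y z A B) : False := by
  have hp2 := hp.out.two_le
  have hq2 := hq.out.two_le
  have hr2 := hr.out.two_le
  have h1 := F.pq
  have h2 := F.qr
  have h3 := F.pr
  by_cases hp3 : 2 < p
  · by_cases hq3 : 2 < q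
    · exact T.false_of_two_lt F hp3 hq3
    · exact T.swap_yz.false_of_two_lt F.swap_yz hp3 (by omega)
  · exact T.swap_xy.swap_yz.false_of_two_lt F.swap_xy.swap_yz (by omega) (by omega)

/-! ### Classification of pairwise agreeing triples -/

/-- Write u = (i, j, k), v = (i, j', k') and w = (i', j, k'). The only candidate for the centre is
(i, j, k'). A triple that violates majority but agrees somewhere with each of u, v and w must be
(i', j', k); these four triples then leave no room for a fifth. -/
theorem majority_or_tetra_of_three {u v w : α} (hu : u ∈ B) (hv : v ∈ B) (hw : w ∈ B)
    (hint : ∀ b ∈ B, ∀ b' ∈ B, (x b).1 = (x b').1 ∨ (y b).1 = (y b').1 ∨ (z b).1 = (z b').1)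
    (hx : (x u).1 = (x v).1) (hy : (y u).1 ≠ (y v).1) (hz : (z u).1 ≠ (z v).1)
    (hwx : (x w).1 ≠ (x u).1) (hwy : (y w).1 = (y u).1) (hwz : (z w).1 = (z v).1) :
    (∃ c₁ c₂ c₃, IsMajority x y z B c₁ c₂ c₃) ∨
      ∃ i i' j j' k k', IsTetra x y z B i i' j j' k k' := by
  by_cases hmaj : IsMajority x y z B (x u).1 (y u).1 (z v).1
  · exact Or.inl ⟨_, _, _, hmaj⟩
  right
  unfold IsMajority at hmaj
  push Not at hmaj
  obtain ⟨t, ht, ht1, ht2, ht3⟩ := hmaj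
  have i1 := hint t ht u hu
  have i2 := hint t ht v hv
  have i3 := hint t ht w hw
  have htx : (x t).1 = (x w).1 := by grind
  have hty : (y t).1 = (y v).1 := by grind
  have htz : (z t).1 = (z u).1 := by grind
  refine ⟨(x u).1, (x w).1, (y u).1, (y v).1, (z u).1, (z v).1, hwx.symm, hy, hz, ?_,
    ⟨u, hu, rfl, rfl, rfl⟩, ⟨v, hv, hx.symm, rfl, rfl⟩, ⟨w, hw, rfl, hwy, hwz⟩,
    ⟨t, ht, htx, hty, htz⟩⟩
  intro b hb
  have j1 := hint b hb u hu
  have j2 := hint b hb v hv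
  have j3 := hint b hb w hw
  have j4 := hint b hb t ht
  grind

theorem majority_or_tetra_of_two {u v : α} (hu : u ∈ B) (hv : v ∈ B)
    (hint : ∀ b ∈ B, ∀ b' ∈ B, (x b).1 = (x b').1 ∨ (y b).1 = (y b').1 ∨ (z b).1 = (z b').1)
    (hs : ∀ i, ∃ b ∈ B, (x b).1 ≠ i)
    (hx : (x u).1 = (x v).1) (hy : (y u).1 ≠ (y v).1) (hz : (z u).1 ≠ (z v).1) :
    (∃ c₁ c₂ c₃, IsMajority x y z B c₁ c₂ c₃) ∨
      ∃ i i' j j' k k', IsTetra x y z B i i' j j' k k' := by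
  obtain ⟨w, hw, hwx⟩ := hs (x u).1
  have i1 := hint w hw u hu
  have i2 := hint w hw v hv
  have : ((y w).1 = (y u).1 ∧ (z w).1 = (z v).1) ∨ ((y w).1 = (y v).1 ∧ (z w).1 = (z u).1) := by
    grind
  rcases this with ⟨h1, h2⟩ | ⟨h1, h2⟩
  · exact majority_or_tetra_of_three hu hv hw hint hx hy hz hwx h1 h2
  · exact majority_or_tetra_of_three hv hu hw hint hx.symm hy.symm hz.symm (hx ▸ hwx) h1 h2

/-- A family of triples that pairwise agree somewhere, and that is not constant in any
direction, is a majority family or a tetrahedron. -/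
theorem majority_or_tetra (F : Factorization x y z A B)
    (hint : ∀ b ∈ B, ∀ b' ∈ B, (x b).1 = (x b').1 ∨ (y b).1 = (y b').1 ∨ (z b).1 = (z b').1) :
    (∃ c₁ c₂ c₃, IsMajority x y z B c₁ c₂ c₃) ∨
      ∃ i i' j j' k k', IsTetra x y z B i i' j j' k k' := by
  obtain ⟨b₀, hb₀, -⟩ := F.spreadBx 0
  obtain ⟨u, hu, hux⟩ := F.spreadBx (x b₀).1
  obtain ⟨v, hv, hvy⟩ := F.spreadBy (y b₀).1
  -- If every two elements agreed in at least two directions, u would differ from b₀ only in x and v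
  -- only in y. Then u and v would agree in z alone.
  have hex : ∃ s ∈ B, ∃ t ∈ B,
      ((x s).1 = (x t).1 ∧ (y s).1 ≠ (y t).1 ∧ (z s).1 ≠ (z t).1) ∨
      ((y s).1 = (y t).1 ∧ (x s).1 ≠ (x t).1 ∧ (z s).1 ≠ (z t).1) ∨
      ((z s).1 = (z t).1 ∧ (x s).1 ≠ (x t).1 ∧ (y s).1 ≠ (y t).1) := by
    by_contra hcon
    push Not at hcon
    have h1 := hint u hu b₀ hb₀
    have h2 := hint v hv b₀ hb₀
    have h3 := hint u hu v hv
    have h4 := hcon u hu b₀ hb₀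
    have h5 := hcon v hv b₀ hb₀
    have h6 := hcon u hu v hv
    grind
  obtain ⟨s, hs, t, ht, h | h | h⟩ := hex
  · exact majority_or_tetra_of_two hs ht hint F.spreadBx h.1 h.2.1 h.2.2
  · rcases majority_or_tetra_of_two (x := y) (y := x) (z := z) hs ht
      (fun b hb b' hb' => by have := hint b hb b' hb'; tauto) F.spreadBy h.1 h.2.1 h.2.2 with
      ⟨_, _, _, h⟩ | ⟨_, _, _, _, _, _, h⟩
    · exact Or.inl ⟨_, _, _, h.swap_xy⟩
    · exact Or.inr ⟨_, _, _, _, _, _, h.swap_xy⟩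
  · rcases majority_or_tetra_of_two (x := z) (y := x) (z := y) hs ht
      (fun b hb b' hb' => by have := hint b hb b' hb'; tauto) F.spreadBz h.1 h.2.1 h.2.2 with
      ⟨_, _, _, h⟩ | ⟨_, _, _, _, _, _, h⟩
    · exact Or.inl ⟨_, _, _, h.swap_xy.swap_yz⟩
    · exact Or.inr ⟨_, _, _, _, _, _, h.swap_xy.swap_yz⟩

theorem Factorization.sectional_of_intersecting (F : Factorization x y z A B)
    (hint : ∀ b ∈ B, ∀ b' ∈ B, (x b).1 = (x b').1 ∨ (y b).1 = (y b').1 ∨ (z b).1 = (z b').1) :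
    IsSectional x y z A ∧ ∃ c₁ c₂ c₃, IsMajority x y z B c₁ c₂ c₃ := by
  rcases majority_or_tetra F hint with ⟨c₁, c₂, c₃, M⟩ | ⟨_, _, _, _, _, _, T⟩
  · exact ⟨M.isSectional F, _, _, _, M⟩
  · exact (T.not_factorization F).elim

/-- If neither set were pairwise agreeing, each would have a pair differing at the top in all
directions, and these pairs would have the same type. -/
theorem Factorization.sectional_majority (F : Factorization x y z A B) :
    (IsSectional x y z A ∧ ∃ c₁ c₂ c₃, IsMajority x y z B c₁ c₂ c₃) ∨
    (IsSectional x y z B ∧ ∃ c₁ c₂ c₃, IsMajority x y z A c₁ c₂ c₃) := by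
  by_cases hB : ∀ b ∈ B, ∀ b' ∈ B,
      (x b).1 = (x b').1 ∨ (y b).1 = (y b').1 ∨ (z b).1 = (z b').1
  · exact Or.inl (F.sectional_of_intersecting hB)
  by_cases hA : ∀ b ∈ A, ∀ b' ∈ A,
      (x b).1 = (x b').1 ∨ (y b).1 = (y b').1 ∨ (z b).1 = (z b').1
  · exact Or.inr (F.swap.sectional_of_intersecting hA)
  push Not at hA hB
  obtain ⟨a, ha, a', ha', h1, h2, h3⟩ := hA
  obtain ⟨b, hb, b', hb', h4, h5, h6⟩ := hB
  have := F.disj a ha a' ha' b hb b' hb'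
    ⟨iff_of_false h1 h4, iff_of_false (fun h => h1 (by rw [h])) (fun h => h4 (by rw [h]))⟩
    ⟨iff_of_false h2 h5, iff_of_false (fun h => h2 (by rw [h])) (fun h => h5 (by rw [h]))⟩
    ⟨iff_of_false h3 h6, iff_of_false (fun h => h3 (by rw [h])) (fun h => h6 (by rw [h]))⟩
  exact absurd (by rw [this.1]) h1

end

/-! ### Tilings of finite abelian groups and dilation -/

section
variable {G α : Type*} [AddCommGroup G] [Fintype G]

/-- Every element of `G` is uniquely of the form `f a + b` with `a ∈ A`, `b ∈ B`. -/
def Tiles (f : α → G) (A : Finset α) (B : Finset G) : Prop :=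
  Set.BijOn (fun c : α × G => f c.1 + c.2) (A ×ˢ B : Finset (α × G)) Set.univ

theorem Tiles.card_mul_card {f : α → G} {A : Finset α} {B : Finset G} (h : Tiles f A B) :
    A.card * B.card = Fintype.card G := by
  classical
  rw [← Finset.card_product, ← Finset.card_univ]
  exact Finset.card_bij (fun c _ => f c.1 + c.2) (fun _ _ => Finset.mem_univ _)
    (fun c hc d hd e => h.injOn hc hd e) fun g _ => by
      obtain ⟨c, hc, e⟩ := h.surjOn (Set.mem_univ g)
      exact ⟨c, hc, e⟩

theorem tiles_of_surjOn {f : α → G} {A : Finset α} {B : Finset G}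
    (hc : A.card * B.card = Fintype.card G) (h : ∀ g, ∃ a ∈ A, ∃ b ∈ B, f a + b = g) :
    Tiles f A B := by
  have hs : Set.SurjOn (fun c : α × G => f c.1 + c.2) (A ×ˢ B : Finset (α × G))
      (Finset.univ : Finset G) := by
    intro g _
    obtain ⟨a, ha, b, hb, e⟩ := h g
    exact ⟨(a, b), by simp [ha, hb], e⟩
  refine ⟨fun _ _ => Set.mem_univ _, ?_, by simpa using hs⟩
  refine Finset.injOn_of_surjOn_of_card_le _ (fun _ _ => by simp) hs ?_
  rw [Finset.card_product, hc, Finset.card_univ]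

theorem AddMonoidAlgebra.charP_zmod (l : ℕ) [Fact l.Prime] (G : Type*) [AddCommGroup G] :
    CharP (AddMonoidAlgebra (ZMod l) G) l :=
  charP_of_injective_algebraMap (algebraMap (ZMod l) _).injective l

open AddMonoidAlgebra in
theorem sum_single_tiles (R : Type*) [CommSemiring R] {f : α → G} {A : Finset α} {B : Finset G}
    (h : Tiles f A B) :
    (∑ a ∈ A, single (f a) (1 : R)) * ∑ b ∈ B, single b (1 : R) = ∑ g : G, single g 1 := by
  rw [Finset.sum_mul_sum, ← Finset.sum_product']
  refine Finset.sum_bij (fun c _ => f c.1 + c.2) (fun _ _ => Finset.mem_univ _)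
    (fun c hc d hd e => h.injOn hc hd e) (fun g _ => ?_) fun c _ => ?_
  · obtain ⟨c, hc, e⟩ := h.surjOn (Set.mem_univ g)
    exact ⟨c, hc, e⟩
  · rw [single_mul_single, one_mul]

open AddMonoidAlgebra in
theorem sum_single_mul_sum_univ (R : Type*) [CommSemiring R] (f : α → G) (A : Finset α) :
    (∑ a ∈ A, single (f a) (1 : R)) * ∑ g : G, single g (1 : R) =
      (A.card : R) • ∑ g : G, single g (1 : R) := by
  have key : ∀ h : G, single h (1 : R) * ∑ g : G, single g (1 : R) = ∑ g : G, single g (1 : R) := by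
    intro h
    have e := Equiv.sum_comp (Equiv.addLeft h) fun g : G => single g (1 : R)
    rw [← e, e, Finset.mul_sum, ← e]
    simp [single_mul_single]
  rw [Finset.sum_mul, Finset.sum_congr rfl fun a _ => key (f a), Finset.sum_const,
    Nat.cast_smul_eq_nsmul]

open AddMonoidAlgebra in
-- In the group algebra over the field with l elements, Frobenius replaces the mask S of A by the
-- mask of its dilate. With B and T the masks of the other factor and of the group, SB = T and ST =
-- |A|T give SˡB = |A|ˡ⁻¹T = T by Fermat. All coefficients are nonzero, so every group element is
-- covered, and cardinality gives uniqueness.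
theorem Tiles.prime_nsmul {f : α → G} {A : Finset α} {B : Finset G} (h : Tiles f A B)
    {l : ℕ} (hl : l.Prime) (hc : ¬ l ∣ Fintype.card G) : Tiles (fun a => l • f a) A B := by
  classical
  have : Fact l.Prime := ⟨hl⟩
  have := AddMonoidAlgebra.charP_zmod l G
  refine tiles_of_surjOn h.card_mul_card fun g => ?_
  set S : AddMonoidAlgebra (ZMod l) G := ∑ a ∈ A, single (f a) 1
  set T : AddMonoidAlgebra (ZMod l) G := ∑ g : G, single g 1
  have hA : (A.card : ZMod l) ≠ 0 := by
    rw [Ne, ZMod.natCast_eq_zero_iff]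
    exact fun h' => hc (h.card_mul_card ▸ h'.mul_right _)
  have hpow : ∀ n : ℕ, S ^ n * T = (A.card : ZMod l) ^ n • T := by
    intro n
    induction n with
    | zero => simp
    | succ n ih =>
      rw [pow_succ, mul_assoc, sum_single_mul_sum_univ, mul_smul_comm, ih, smul_smul, pow_succ,
        mul_comm]
  have e : (∑ a ∈ A, single (l • f a) (1 : ZMod l)) * ∑ b ∈ B, single b (1 : ZMod l) = T := by
    have h1 : S ^ l = ∑ a ∈ A, single (l • f a) (1 : ZMod l) := by
      rw [sum_pow_char]
      simp [single_pow]
    have h2 := hpow (l - 1)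
    have h4 : S ^ l = S ^ (l - 1) * S := by rw [← pow_succ, Nat.sub_add_cancel hl.one_le]
    rw [← h1, h4, mul_assoc, sum_single_tiles _ h, h2, ZMod.pow_card_sub_one_eq_one hA, one_smul]
  by_contra! hn
  have h3 := congrArg (fun t => t.coeff g) e
  simp only [T, Finset.sum_mul_sum, single_mul_single, coeff_sum, Finsupp.finsetSum_apply,
    coeff_single, Finsupp.single_apply] at h3
  rw [Finset.sum_eq_zero fun a ha => Finset.sum_eq_zero fun b hb => if_neg (hn a ha b hb)] at h3
  simp at h3

theorem Tiles.nsmul {f : α → G} {A : Finset α} {B : Finset G} (h : Tiles f A B) {k : ℕ}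
    (hk : k.Coprime (Fintype.card G)) (h0 : k ≠ 0) : Tiles (fun a => k • f a) A B := by
  induction k using induction_on_primes with
  | zero => exact absurd rfl h0
  | one => simpa using h
  | prime_mul l k hl ih =>
    have h1 := (ih (Nat.Coprime.coprime_mul_left hk) (by rintro rfl; simp at h0)).prime_nsmul hl
      ((Nat.Prime.coprime_iff_not_dvd hl).1 (Nat.Coprime.coprime_mul_right hk))
    simpa only [mul_nsmul'] using h1

end

/-! ### Digits, divisibility and units modulo M -/

theorem ZMod.natCast_dvd_sub_iff {M n : ℕ} [NeZero M] (h : n ∣ M) (g g' : ZMod M) :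
    (n : ZMod M) ∣ g - g' ↔ g.val ≡ g'.val [MOD n] := by
  rw [← ZMod.natCast_eq_natCast_iff]
  constructor
  · rintro ⟨c, hc⟩
    have h1 := congrArg (ZMod.castHom h (ZMod n)) hc
    rw [map_sub, map_mul, map_natCast, ZMod.natCast_self, zero_mul, sub_eq_zero] at h1
    rwa [ZMod.natCast_val, ZMod.natCast_val]
  · intro h1
    have h2 : ((g.val : ℤ) : ZMod n) = ((g'.val : ℤ) : ZMod n) := by exact_mod_cast h1
    rw [← sub_eq_zero, ← Int.cast_sub, ZMod.intCast_zmod_eq_zero_iff_dvd] at h2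
    obtain ⟨c, hc⟩ := h2
    refine ⟨(c : ZMod M), ?_⟩
    have h3 := congrArg (Int.cast : ℤ → ZMod M) hc
    simpa using h3

/-- The two lowest digits in base `n` of an element of `ℤ_M`. -/
def dig {M : ℕ} (n : ℕ) (g : ZMod M) : Dig n := ((g.val : ZMod n), ((g.val / n : ℕ) : ZMod n))

theorem dig_fst_eq_iff {M n : ℕ} [NeZero M] (h : n ^ 2 ∣ M) (g g' : ZMod M) :
    (dig n g).1 = (dig n g').1 ↔ (n : ZMod M) ∣ g - g' := by
  rw [ZMod.natCast_dvd_sub_iff ((dvd_pow_self n two_ne_zero).trans h)]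
  exact ZMod.natCast_eq_natCast_iff _ _ _

theorem dig_eq_iff {M n : ℕ} [NeZero M] (h : n ^ 2 ∣ M) (g g' : ZMod M) :
    dig n g = dig n g' ↔ ((n ^ 2 : ℕ) : ZMod M) ∣ g - g' := by
  rw [ZMod.natCast_dvd_sub_iff h]
  simp only [dig, Prod.mk.injEq, ZMod.natCast_eq_natCast_iff]
  unfold Nat.ModEq
  rw [pow_two, Nat.mod_mul, Nat.mod_mul]
  refine ⟨fun ⟨h1, h2⟩ => by rw [h1, h2], fun h1 => ?_⟩
  rcases Nat.eq_zero_or_pos n with rfl | hn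
  · simp at h1; simp [h1]
  have h2 := congrArg (· % n) h1
  have h3 := congrArg (· / n) h1
  simp only [Nat.add_mul_mod_self_left, Nat.mod_mod, Nat.add_mul_div_left _ _ hn,
    Nat.div_eq_of_lt (Nat.mod_lt _ hn), zero_add] at h2 h3
  exact ⟨h2, h3⟩

theorem ZMod.dvd_unit_mul_natCast_iff {M n m : ℕ} [NeZero M] (h : n ∣ M) {u : ZMod M}
    (hu : IsUnit u) : (n : ZMod M) ∣ u * m ↔ n ∣ m := by
  rw [hu.dvd_mul_left]
  refine ⟨fun h1 => ?_, fun h1 => by exact_mod_cast Nat.cast_dvd_cast h1⟩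
  have h2 := map_dvd (ZMod.castHom h (ZMod n)) h1
  rwa [map_natCast, map_natCast, ZMod.natCast_self, zero_dvd_iff, ZMod.natCast_eq_zero_iff] at h2

/-- Elements of `ℤ_M` with the same divisibilities by prime powers are associated. -/
theorem ZMod.associated_of_prime_pow_dvd_iff {M : ℕ} [NeZero M] {d e : ZMod M}
    (h : ∀ l k : ℕ, l.Prime → l ^ k ∣ M →
      (((l ^ k : ℕ) : ZMod M) ∣ d ↔ ((l ^ k : ℕ) : ZMod M) ∣ e)) :
    Associated d e := by
  obtain ⟨m, hm, u, hu, rfl⟩ := d.eq_unit_mul_divisor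
  obtain ⟨n, hn, v, hv, rfl⟩ := e.eq_unit_mul_divisor
  have hmn : m = n := by
    apply Nat.dvd_antisymm
    · refine (Nat.dvd_iff_prime_pow_dvd_dvd _ _).2 fun l k hl hk => ?_
      have := h l k hl (hk.trans hm)
      rw [dvd_unit_mul_natCast_iff (hk.trans hm) hu,
        dvd_unit_mul_natCast_iff (hk.trans hm) hv] at this
      exact this.1 hk
    · refine (Nat.dvd_iff_prime_pow_dvd_dvd _ _).2 fun l k hl hk => ?_
      have := h l k hl (hk.trans hn)
      rw [dvd_unit_mul_natCast_iff (hk.trans hn) hu,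
        dvd_unit_mul_natCast_iff (hk.trans hn) hv] at this
      exact this.2 hk
  subst hmn
  exact (associated_unit_mul_left _ _ hu).trans (associated_unit_mul_left _ _ hv).symm

/-- Tijdeman's theorem: a factor of a tiling may be dilated by a unit. -/
theorem Tiles.eq_of_associated_sub {M : ℕ} [NeZero M] {A B : Finset (ZMod M)} (h : Tiles id A B)
    {a a' b b' : ZMod M} (ha : a ∈ A) (ha' : a' ∈ A) (hb : b ∈ B) (hb' : b' ∈ B)
    (h1 : Associated (a - a') (b' - b)) : a = a' ∧ b = b' := by
  obtain ⟨u, hu⟩ := h1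
  -- The representative of a unit vanishes only in the zero ring, where the claim is trivial;
  -- elsewhere it is a legitimate nonzero dilation factor.
  by_cases h0 : (u : ZMod M).val = 0
  · have : (1 : ZMod M) = 0 := by
      rw [ZMod.val_eq_zero] at h0
      have := u.mul_inv
      rwa [h0, zero_mul, eq_comm] at this
    have : Subsingleton (ZMod M) := subsingleton_of_zero_eq_one this.symm
    exact ⟨Subsingleton.elim _ _, Subsingleton.elim _ _⟩
  have h2 := h.nsmul (k := (u : ZMod M).val)
    (by rw [ZMod.card]; exact ZMod.val_coe_unit_coprime u) h0
  have h3 := h2.injOn (x₁ := (a, b)) (x₂ := (a', b')) (by simp [ha, hb]) (by simp [ha', hb']) (by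
    simp only [id, nsmul_eq_mul, ZMod.natCast_val, ZMod.cast_id']
    linear_combination hu)
  simpa using h3

section
variable {p q r : ℕ}

theorem Nat.prime_pow_dvd_sq_mul {p q r l k : ℕ} (hp : p.Prime) (hq : q.Prime) (hr : r.Prime)
    (hpq : p ≠ q) (hqr : q ≠ r) (hpr : p ≠ r) (hl : l.Prime) (hk : l ^ k ∣ (p * q * r) ^ 2) :
    k = 0 ∨ ((l = p ∨ l = q ∨ l = r) ∧ (k = 1 ∨ k = 2)) := by
  rcases Nat.eq_zero_or_pos k with h0 | h0
  · exact Or.inl h0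
  right
  have h1 : l ∣ p * q * r := hl.dvd_of_dvd_pow ((dvd_pow_self l h0.ne').trans hk)
  have hpqc := (Nat.coprime_primes hp hq).2 hpq
  have hqrc := (Nat.coprime_primes hq hr).2 hqr
  have hprc := (Nat.coprime_primes hp hr).2 hpr
  have key : ∀ n m : ℕ, n.Prime → n.Coprime m → n ^ k ∣ (n * m) ^ 2 → k = 1 ∨ k = 2 := by
    intro n m hn hc hd
    rw [mul_pow] at hd
    have h2 := (Nat.Coprime.pow k 2 hc).dvd_of_dvd_mul_right hd
    have := (Nat.pow_dvd_pow_iff_le_right hn.one_lt).1 h2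
    omega
  rw [hl.dvd_mul, hl.dvd_mul, Nat.prime_dvd_prime_iff_eq hl hp, Nat.prime_dvd_prime_iff_eq hl hq,
    Nat.prime_dvd_prime_iff_eq hl hr] at h1
  rcases h1 with (rfl | rfl) | rfl
  · exact ⟨by simp, key l (q * r) hp (Nat.Coprime.mul_right hpqc hprc) (by rwa [← mul_assoc])⟩
  · exact ⟨by simp, key l (p * r) hq (Nat.Coprime.mul_right hpqc.symm hqrc)
      (by rwa [← mul_assoc, mul_comm l p])⟩
  · exact ⟨by simp, key l (p * q) hr (Nat.Coprime.mul_right hprc.symm hqrc.symm)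
      (by rwa [mul_comm l])⟩

/-- Since 0 is in the set, a constant lowest digit would put the set inside the proper subgroup
generated by n. -/
theorem exists_dig_fst_ne {M n : ℕ} [NeZero M] (hn : n.Prime) (h : n ^ 2 ∣ M) {A : Set (ZMod M)}
    (h0 : 0 ∈ A) (hA : ∀ H : AddSubgroup (ZMod M), A ⊆ (H : Set _) → H = ⊤) (i : ZMod n) :
    ∃ a ∈ A, (dig n a).1 ≠ i := by
  by_contra! hc
  have h1 := hA ((Ideal.span {(n : ZMod M)}).toAddSubgroup) (by
    intro a ha
    have := (dig_fst_eq_iff h a 0).1 ((hc a ha).trans (hc 0 h0).symm)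
    simpa [Ideal.mem_span_singleton] using this)
  have h2 : (1 : ZMod M) ∈ (Ideal.span {(n : ZMod M)}).toAddSubgroup := by rw [h1]; trivial
  have h3 : (n : ZMod M) ∣ 1 := by simpa [Ideal.mem_span_singleton] using h2
  have h4 := (ZMod.dvd_unit_mul_natCast_iff (m := 1) ((dvd_pow_self n two_ne_zero).trans h)
    isUnit_one).1 (by simpa using h3)
  exact hn.one_lt.ne' (Nat.dvd_one.1 h4)

/-- For M = (pqr)² the relevant prime powers are p, p², q, q², r, r². Branching depths therefore
determine a difference up to a unit, and dilation of the tiling turns equality of types into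
equality of elements. -/
theorem Tiles.factorization (hp : p.Prime) (hq : q.Prime) (hr : r.Prime)
    (hpq : p ≠ q) (hqr : q ≠ r) (hpr : p ≠ r) [NeZero ((p * q * r) ^ 2)]
    {A B : Finset (ZMod ((p * q * r) ^ 2))} (h : Tiles id A B)
    (hA0 : 0 ∈ A) (hB0 : 0 ∈ B) (hAc : A.card = p * q * r) (hBc : B.card = p * q * r)
    (hA : ∀ H : AddSubgroup (ZMod ((p * q * r) ^ 2)), (A : Set (ZMod ((p * q * r) ^ 2))) ⊆ H →
      H = ⊤)
    (hB : ∀ H : AddSubgroup (ZMod ((p * q * r) ^ 2)), (B : Set (ZMod ((p * q * r) ^ 2))) ⊆ H →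
      H = ⊤) :
    Factorization (dig p) (dig q) (dig r) A B := by
  have dp : p ^ 2 ∣ (p * q * r) ^ 2 := pow_dvd_pow_of_dvd (by simp [mul_assoc]) 2
  have dq : q ^ 2 ∣ (p * q * r) ^ 2 := pow_dvd_pow_of_dvd ⟨p * r, by ring⟩ 2
  have dr : r ^ 2 ∣ (p * q * r) ^ 2 := pow_dvd_pow_of_dvd (by simp) 2
  refine ⟨hpq, hqr, hpr, hAc, hBc, ?_, exists_dig_fst_ne hp dp hA0 hA,
    exists_dig_fst_ne hq dq hA0 hA, exists_dig_fst_ne hr dr hA0 hA, exists_dig_fst_ne hp dp hB0 hB,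
    exists_dig_fst_ne hq dq hB0 hB, exists_dig_fst_ne hr dr hB0 hB⟩
  intro a ha a' ha' b hb b' hb' hx hy hz
  refine h.eq_of_associated_sub ha ha' hb hb' (ZMod.associated_of_prime_pow_dvd_iff ?_)
  simp only [SameType, dig_fst_eq_iff dp, dig_fst_eq_iff dq, dig_fst_eq_iff dr, dig_eq_iff dp,
    dig_eq_iff dq, dig_eq_iff dr] at hx hy hz
  intro l k hl hk
  rw [← neg_sub b b', dvd_neg]
  rcases Nat.prime_pow_dvd_sq_mul hp hq hr hpq hqr hpr hl hk with rfl | ⟨rfl | rfl | rfl, rfl | rfl⟩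
  · simp
  all_goals
    first
      | exact hx.2
      | exact hy.2
      | exact hz.2
      | simpa using hx.1
      | simpa using hy.1
      | simpa using hz.1

end

/-! ### Centre and fibres of the majority set -/

section
variable {α : Type*} {p q r : ℕ} {x : α → Dig p} {y : α → Dig q} {z : α → Dig r}
  {A B : Finset α} {c₁ : ZMod p} {c₂ : ZMod q} {c₃ : ZMod r}
variable [hp : Fact p.Prime] [hq : Fact q.Prime] [hr : Fact r.Prime]

theorem IsSectional.swap_xy (h : IsSectional x y z A) : IsSectional y x z A :=
  ⟨h.2.1, h.1, h.2.2⟩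

theorem IsSectional.swap_yz (h : IsSectional x y z A) : IsSectional x z y A :=
  ⟨h.1, h.2.2, h.2.1⟩

theorem IsSectional.exists_center (S : IsSectional x y z A) (F : Factorization x y z A B)
    (m : IsMajority x y z B c₁ c₂ c₃) :
    ∃ b ∈ B, (x b).1 = c₁ ∧ (y b).1 = c₂ ∧ (z b).1 = c₃ := by
  obtain ⟨b₁, h₁, n₁⟩ := F.spreadBx c₁
  obtain ⟨b₂, h₂, n₂⟩ := F.spreadBy c₂
  obtain ⟨b₃, h₃, n₃⟩ := F.spreadBz c₃
  -- The bottoms are chosen cyclically: if b is off-centre in x, then b and b₂ share a top digit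
  -- only in z, where the section gives them equal bottoms. Likewise y is compared with b₃ and z
  -- with b₁; rigidity excludes all three cases.
  obtain ⟨b, hb, e₁, e₂, e₃⟩ := S.exists_mem_section F (fun _ => (x b₃).2) (fun _ => (y b₁).2)
    (fun _ => (z b₂).2)
  have m₁ := m b₁ h₁
  have m₂ := m b₂ h₂
  have m₃ := m b₃ h₃
  have m₀ := m b hb
  simp only [n₁, n₂, n₃, false_and, and_false, or_false, false_or] at m₁ m₂ m₃
  refine ⟨b, hb, ?_⟩
  by_contra hc
  rcases m₀ with m₀ | m₀ | m₀ <;> simp only [m₀, true_and, and_true] at hc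
  · have : b = b₂ := S.eq_of_rigid F hb h₂ (fun h => absurd (h.trans m₂.1) hc)
      (fun h => absurd (h.symm.trans m₀.1) n₂) fun h => Prod.ext h e₃
    exact hc (this ▸ m₂.1)
  · have : b = b₃ := S.eq_of_rigid F hb h₃ (fun h => Prod.ext h e₁)
      (fun h => absurd (h.trans m₃.2) hc) (fun h => absurd (h.symm.trans m₀.2) n₃)
    exact hc (this ▸ m₃.2)
  · have : b = b₁ := S.eq_of_rigid F hb h₁ (fun h => absurd (h.symm.trans m₀.1) n₁)
      (fun h => Prod.ext h e₂) (fun h => absurd (h.trans m₁.2) hc)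
    exact hc (this ▸ m₁.2)

/-- Use the bottoms of g in x and those of b in y and z. The element d of B on this section cannot
lie in a different x-branch, or it would be rigid with b. Majority then fixes its remaining top
digits, so d is g. This is the source of the periodicity in (III). -/
theorem IsSectional.mem_of_fiber (S : IsSectional x y z A) (F : Factorization x y z A B)
    (m : IsMajority x y z B c₁ c₂ c₃) (hinj : ∀ g g', x g = x g' → y g = y g' → z g = z g' → g = g')
    {b g : α} (hb : b ∈ B) (hc : (x b).1 ≠ c₁) (h1 : (x g).1 = (x b).1) (h2 : y g = y b)
    (h3 : z g = z b) : g ∈ B := by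
  obtain ⟨d, hd, e₁, e₂, e₃⟩ := S.exists_mem_section F (fun _ => (x g).2) (fun _ => (y b).2)
    (fun _ => (z b).2)
  have h4 : (x d).1 = (x b).1 := by
    by_contra h
    have := S.eq_of_rigid F hd hb (fun h' => absurd h' h) (fun h => Prod.ext h e₂)
      (fun h => Prod.ext h e₃)
    exact h (this ▸ rfl)
  have m₁ := m b hb
  have m₂ := m d hd
  simp only [h4, hc, false_and, or_false] at m₁ m₂
  have : d = g := hinj d g (Prod.ext (h4.trans h1.symm) e₁)
    (h2 ▸ Prod.ext (m₂.1.trans m₁.1.symm) e₂) (h3 ▸ Prod.ext (m₂.2.trans m₁.2.symm) e₃)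
  exact this ▸ hd

/-- The product of constant sections through the bottoms of g meets B, and majority lets this point
leave the central cell in at most one direction. This gives the covering in (IV). -/
theorem IsSectional.exists_mem_through (S : IsSectional x y z A) (F : Factorization x y z A B)
    (m : IsMajority x y z B c₁ c₂ c₃) (hinj : ∀ g g', x g = x g' → y g = y g' → z g = z g' → g = g')
    {g : α} (h1 : (x g).1 = c₁) (h2 : (y g).1 = c₂) (h3 : (z g).1 = c₃) :
    g ∈ B ∨ ∃ d ∈ B, ((x d).1 ≠ c₁ ∧ y d = y g ∧ z d = z g) ∨
      ((y d).1 ≠ c₂ ∧ z d = z g ∧ x d = x g) ∨ ((z d).1 ≠ c₃ ∧ x d = x g ∧ y d = y g) := by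
  obtain ⟨d, hd, e₁, e₂, e₃⟩ := S.exists_mem_section F (fun _ => (x g).2) (fun _ => (y g).2)
    (fun _ => (z g).2)
  subst h1 h2 h3
  by_cases hx : (x d).1 = (x g).1
  · by_cases hy : (y d).1 = (y g).1
    · by_cases hz : (z d).1 = (z g).1
      · exact Or.inl (hinj d g (Prod.ext hx e₁) (Prod.ext hy e₂) (Prod.ext hz e₃) ▸ hd)
      · exact Or.inr ⟨d, hd, Or.inr (Or.inr ⟨hz, Prod.ext hx e₁, Prod.ext hy e₂⟩)⟩
    · have m₁ := m d hd
      simp only [hy, false_and, and_false, or_false, false_or] at m₁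
      exact Or.inr ⟨d, hd, Or.inr (Or.inl ⟨hy, Prod.ext m₁.2 e₃, Prod.ext hx e₁⟩)⟩
  · have m₁ := m d hd
    simp only [hx, false_and, or_false] at m₁
    exact Or.inr ⟨d, hd, Or.inl ⟨hx, Prod.ext m₁.1 e₂, Prod.ext m₁.2 e₃⟩⟩

end

/-! ### Divisibility descriptions of the pieces of B -/

section
variable {M a b c : ℕ} [NeZero M]

theorem ZMod.eq_of_sq_dvd_sub (hab : a.Coprime b) (hbc : b.Coprime c) (hac : a.Coprime c)
    (hM : M = (a * b * c) ^ 2) {g g' : ZMod M} (h1 : ((a ^ 2 : ℕ) : ZMod M) ∣ g - g')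
    (h2 : ((b ^ 2 : ℕ) : ZMod M) ∣ g - g') (h3 : ((c ^ 2 : ℕ) : ZMod M) ∣ g - g') : g = g' := by
  have da : a ^ 2 ∣ M := hM ▸ pow_dvd_pow_of_dvd (by simp [mul_assoc]) 2
  have db : b ^ 2 ∣ M := hM ▸ pow_dvd_pow_of_dvd ⟨a * c, by ring⟩ 2
  have dc : c ^ 2 ∣ M := hM ▸ pow_dvd_pow_of_dvd (by simp) 2
  rw [ZMod.natCast_dvd_sub_iff da] at h1
  rw [ZMod.natCast_dvd_sub_iff db] at h2
  rw [ZMod.natCast_dvd_sub_iff dc] at h3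
  have h4 := (Nat.modEq_and_modEq_iff_modEq_mul (hab.pow 2 2)).1 ⟨h1, h2⟩
  have h5 := (Nat.modEq_and_modEq_iff_modEq_mul
    (Nat.Coprime.mul_left (hac.pow 2 2) (hbc.pow 2 2))).1 ⟨h4, h3⟩
  rw [← mul_pow, ← mul_pow, ← hM] at h5
  apply ZMod.val_injective
  rwa [Nat.ModEq, Nat.mod_eq_of_lt (ZMod.val_lt g), Nat.mod_eq_of_lt (ZMod.val_lt g')] at h5

theorem ZMod.natCast_dvd_mul_iff {m n : ℕ} (hmn : m.Coprime n) (h : m * n ∣ M) {g : ZMod M} :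
    ((m * n : ℕ) : ZMod M) ∣ g ↔ (m : ZMod M) ∣ g ∧ (n : ZMod M) ∣ g := by
  have h1 := ZMod.natCast_dvd_sub_iff h g 0
  have h2 := ZMod.natCast_dvd_sub_iff ((dvd_mul_right m n).trans h) g 0
  have h3 := ZMod.natCast_dvd_sub_iff ((dvd_mul_left n m).trans h) g 0
  rw [sub_zero] at h1 h2 h3
  rw [h1, h2, h3, Nat.modEq_and_modEq_iff_modEq_mul hmn]

/-- A multiplier adjusting an integer multiple of `N` to a given residue class. -/
theorem ZMod.exists_dvd_mul_sub {N n : ℕ} (h : N.Coprime n) (g : ZMod M) :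
    ∃ t : ℤ, (n : ZMod M) ∣ N * t - g := by
  obtain ⟨u, v, e⟩ := Nat.isCoprime_iff_coprime.2 h
  have e' := congrArg (Int.cast : ℤ → ZMod M) e
  push_cast at e'
  refine ⟨u * g.val, -v * g, ?_⟩
  push_cast
  rw [ZMod.natCast_zmod_val]
  linear_combination g * e'

theorem IsNormalizedResidueSystem.exists_eq_add {n : ℕ} (hn : 0 < n) {U : Set ℤ}
    (hU : IsNormalizedResidueSystem n U) (t : ℤ) : ∃ u ∈ U, ∃ m : ℤ, u = t + n * m := by
  obtain ⟨u, -, h, rfl⟩ := hU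
  have hn' : (0 : ℤ) < n := by exact_mod_cast hn
  -- The reduction lies in 0, …, n − 1, the only range where the residue-system congruences are
  -- available.
  have h1 := Int.emod_nonneg t hn'.ne'
  have h2 : (t % n).toNat < n := by
    have := Int.emod_lt_of_pos t hn'
    omega
  have h3 := h _ h2
  rw [Int.toNat_of_nonneg h1] at h3
  obtain ⟨m, hm⟩ := (h3.trans (Int.mod_modEq t n)).symm.dvd
  exact ⟨u (t % n).toNat, ⟨_, h2, rfl⟩, m, by linarith⟩

theorem pairPart_eq (hab : a.Coprime b) (hbc : b.Coprime c) (hac : a.Coprime c)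
    (hM : M = (a * b * c) ^ 2) (D : Set (ZMod M)) :
    pairPart a b c D = {g | g ∈ D ∧ (b : ZMod M) ∣ g ∧ (c : ZMod M) ∣ g ∧ ¬ (a : ZMod M) ∣ g} := by
  have d1 : a * b * c ∣ M := hM ▸ dvd_pow_self _ two_ne_zero
  ext g
  simp only [pairPart, multiplesIn, Set.mem_sdiff, Set.mem_ofPred_eq]
  rw [mul_assoc a, ZMod.natCast_dvd_mul_iff (Nat.Coprime.mul_right hab hac) (by rwa [← mul_assoc]),
    ZMod.natCast_dvd_mul_iff hbc ((dvd_mul_left _ a).trans (by rwa [← mul_assoc]))]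
  tauto

theorem multiplesIn_eq (hab : a.Coprime b) (hbc : b.Coprime c) (hac : a.Coprime c)
    (hM : M = (a * b * c) ^ 2) (D : Set (ZMod M)) :
    multiplesIn (a * b * c) D =
      {g | g ∈ D ∧ (a : ZMod M) ∣ g ∧ (b : ZMod M) ∣ g ∧ (c : ZMod M) ∣ g} := by
  have d1 : a * b * c ∣ M := hM ▸ dvd_pow_self _ two_ne_zero
  ext g
  simp only [multiplesIn, Set.mem_ofPred_eq]
  rw [ZMod.natCast_dvd_mul_iff (Nat.Coprime.mul_left hac hbc) d1,
    ZMod.natCast_dvd_mul_iff hab ((dvd_mul_right _ c).trans d1), and_assoc]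

theorem exists_natCast_mul_iff (hab : a.Coprime b) (hbc : b.Coprime c) (hac : a.Coprime c)
    (hM : M = (a * b * c) ^ 2) (g : ZMod M) :
    (∃ n < a * b * c, g = ((a * b * c * n : ℕ) : ZMod M)) ↔
      (a : ZMod M) ∣ g ∧ (b : ZMod M) ∣ g ∧ (c : ZMod M) ∣ g := by
  have d1 : a * b * c ∣ M := hM ▸ dvd_pow_self _ two_ne_zero
  rw [← and_assoc, ← ZMod.natCast_dvd_mul_iff hab ((dvd_mul_right _ c).trans d1),
    ← ZMod.natCast_dvd_mul_iff (Nat.Coprime.mul_left hac hbc) d1]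
  constructor
  · rintro ⟨n, -, rfl⟩
    exact Nat.cast_dvd_cast (dvd_mul_right _ _)
  · intro h
    have h1 := (ZMod.natCast_dvd_sub_iff d1 g 0).1 (by simpa using h)
    rw [ZMod.val_zero, Nat.modEq_zero_iff_dvd] at h1
    obtain ⟨n, hn⟩ := h1
    refine ⟨n, ?_, by rw [← hn, ZMod.natCast_zmod_val]⟩
    have h2 := ZMod.val_lt g
    rw [hn, hM, pow_two] at h2
    exact Nat.lt_of_mul_lt_mul_left h2

theorem add_intCast_mul_mem {E : Set (ZMod M)} {t : ZMod M} (h : E = (fun x => x + t) '' E)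
    {g : ZMod M} (hg : g ∈ E) (m : ℤ) : g + m * t ∈ E := by
  induction m with
  | zero => simpa
  | succ n ih =>
    rw [h]
    exact ⟨_, ih, by push_cast; ring⟩
  | pred n ih =>
    rw [h] at ih
    obtain ⟨e, he, h1⟩ := ih
    convert he using 1
    push_cast at h1 ⊢
    linear_combination -h1

end

/-! ### Fibres, shifts and the sets in condition (IV) -/

section
variable {M a b c : ℕ} [NeZero M]

/-- The elements of `D` outside `aℤ` come in full cosets of `ab²c²ℤ`. -/
def FiberClosed (a b c : ℕ) (D : Set (ZMod M)) : Prop :=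
  ∀ g ∈ D, ¬ (a : ZMod M) ∣ g → ∀ h : ZMod M, (a : ZMod M) ∣ h - g →
    ((b ^ 2 : ℕ) : ZMod M) ∣ h - g → ((c ^ 2 : ℕ) : ZMod M) ∣ h - g → h ∈ D

theorem natCast_dvd_of_sq_dvd_sub {g h : ZMod M} (h1 : ((b ^ 2 : ℕ) : ZMod M) ∣ h - g) :
    (b : ZMod M) ∣ h ↔ (b : ZMod M) ∣ g := by
  have h2 : (b : ZMod M) ∣ h - g := (Nat.cast_dvd_cast (dvd_pow_self b two_ne_zero)).trans h1
  rw [← dvd_iff_dvd_of_dvd_sub h2]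

theorem FiberClosed.residueClass_eq (hab : a.Coprime b) (hbc : b.Coprime c) (hac : a.Coprime c)
    (hM : M = (a * b * c) ^ 2) {D : Set (ZMod M)} (h : FiberClosed a b c D) (i : ℕ) :
    residueClass a i (pairPart a b c D) =
      (fun x => x + ((a * b ^ 2 * c ^ 2 : ℕ) : ZMod M)) '' residueClass a i (pairPart a b c D) := by
  have da : (a : ZMod M) ∣ ((a * b ^ 2 * c ^ 2 : ℕ) : ZMod M) :=
    Nat.cast_dvd_cast ⟨b ^ 2 * c ^ 2, by ring⟩
  have db : ((b ^ 2 : ℕ) : ZMod M) ∣ ((a * b ^ 2 * c ^ 2 : ℕ) : ZMod M) :=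
    Nat.cast_dvd_cast ⟨a * c ^ 2, by ring⟩
  have dc : ((c ^ 2 : ℕ) : ZMod M) ∣ ((a * b ^ 2 * c ^ 2 : ℕ) : ZMod M) :=
    Nat.cast_dvd_cast (dvd_mul_left _ _)
  generalize ((a * b ^ 2 * c ^ 2 : ℕ) : ZMod M) = t at *
  have key : ∀ g s : ZMod M, (a : ZMod M) ∣ s → ((b ^ 2 : ℕ) : ZMod M) ∣ s →
      ((c ^ 2 : ℕ) : ZMod M) ∣ s → g ∈ residueClass a i (pairPart a b c D) →
      g + s ∈ residueClass a i (pairPart a b c D) := by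
    intro g s h1 h2 h3 hg
    rw [pairPart_eq hab hbc hac hM] at hg ⊢
    obtain ⟨⟨g1, g2, g3, g4⟩, g5⟩ := hg
    have e : g + s - g = s := by ring
    refine ⟨⟨h g g1 g4 _ (e.symm ▸ h1) (e.symm ▸ h2) (e.symm ▸ h3),
      (natCast_dvd_of_sq_dvd_sub (e.symm ▸ h2)).2 g2,
      (natCast_dvd_of_sq_dvd_sub (e.symm ▸ h3)).2 g3, fun h' => g4 ?_⟩, ?_⟩
    · exact (dvd_add_left h1).1 h'
    · rw [add_sub_right_comm]; exact dvd_add g5 h1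
  ext g
  constructor
  · intro hg
    exact ⟨g + -t, key g _ (dvd_neg.2 da) (dvd_neg.2 db) (dvd_neg.2 dc) hg, by simp⟩
  · rintro ⟨g, hg, rfl⟩
    exact key g t da db dc hg

theorem dvd_tau_sub (ha : 0 < a) (hab : a.Coprime b) (hac : a.Coprime c) (l : ℕ) :
    (a : ZMod M) ∣ ((tau a b c l * (b ^ 2 * c ^ 2) : ℕ) : ZMod M) - (l : ZMod M) := by
  have h := (Nat.modEq_iff_dvd.1 (tau_modEq ha hab.symm hac.symm l).symm)
  obtain ⟨k, hk⟩ := h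
  refine ⟨k, ?_⟩
  have := congrArg (Int.cast : ℤ → ZMod M) hk
  push_cast at this ⊢
  exact this

theorem hatSet_subset (ha : 0 < a) (hab : a.Coprime b) (hbc : b.Coprime c) (hac : a.Coprime c)
    (hM : M = (a * b * c) ^ 2) {D : Set (ZMod M)} {g : ZMod M}
    (hg : g ∈ hatSet a b c (pairPart a b c D)) :
    (a : ZMod M) ∣ g ∧ (b : ZMod M) ∣ g ∧ (c : ZMod M) ∣ g := by
  rw [pairPart_eq hab hbc hac hM] at hg
  simp only [hatSet, Set.mem_iUnion, exists_prop] at hg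
  obtain ⟨l, -, d, ⟨⟨-, h1, h2, -⟩, h3⟩, rfl⟩ := hg
  refine ⟨?_, dvd_sub h1 (Nat.cast_dvd_cast ⟨tau a b c l * b * c ^ 2, by ring⟩),
    dvd_sub h2 (Nat.cast_dvd_cast ⟨tau a b c l * b ^ 2 * c, by ring⟩)⟩
  have := dvd_sub h3 (dvd_tau_sub (M := M) ha hab hac l)
  rwa [sub_sub_sub_cancel_right] at this

/-- For l the residue of d modulo a, the point g + τ(l)b²c² has residue l and agrees with d modulo
b² and c². It therefore lies in the same fibre as d, hence in D; subtracting the shift recovers g.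
The residue is nonzero because a does not divide d. -/
theorem FiberClosed.mem_hatSet (ha : 0 < a) (hab : a.Coprime b) (hbc : b.Coprime c)
    (hac : a.Coprime c) (hM : M = (a * b * c) ^ 2) {D : Set (ZMod M)} (h : FiberClosed a b c D)
    {d g : ZMod M} (hd : d ∈ D) (hda : ¬ (a : ZMod M) ∣ d) (ga : (a : ZMod M) ∣ g)
    (gb : (b : ZMod M) ∣ g) (gc : (c : ZMod M) ∣ g) (hb : ((b ^ 2 : ℕ) : ZMod M) ∣ d - g)
    (hc : ((c ^ 2 : ℕ) : ZMod M) ∣ d - g) : g ∈ hatSet a b c (pairPart a b c D) := by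
  have h1 : (a : ZMod M) ∣ d - ((d.val % a : ℕ) : ZMod M) := by
    refine ⟨((d.val / a : ℕ) : ZMod M), ?_⟩
    have := congrArg (Nat.cast : ℕ → ZMod M) (Nat.mod_add_div d.val a)
    push_cast [ZMod.natCast_zmod_val] at this ⊢
    linear_combination -this
  have h2 := dvd_tau_sub (M := M) ha hab hac (d.val % a)
  have h0 : d.val % a ∈ Set.Ico 1 a := by
    refine ⟨Nat.one_le_iff_ne_zero.2 fun h' => hda ?_, Nat.mod_lt _ ha⟩
    rwa [h', Nat.cast_zero, sub_zero] at h1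
  have tb : ((b ^ 2 : ℕ) : ZMod M) ∣ ((tau a b c (d.val % a) * (b ^ 2 * c ^ 2) : ℕ) : ZMod M) :=
    Nat.cast_dvd_cast ⟨tau a b c (d.val % a) * c ^ 2, by ring⟩
  have tc : ((c ^ 2 : ℕ) : ZMod M) ∣ ((tau a b c (d.val % a) * (b ^ 2 * c ^ 2) : ℕ) : ZMod M) :=
    Nat.cast_dvd_cast ⟨tau a b c (d.val % a) * b ^ 2, by ring⟩
  rw [pairPart_eq hab hbc hac hM]
  simp only [hatSet, Set.mem_iUnion, exists_prop]
  refine ⟨d.val % a, h0, g + ((tau a b c (d.val % a) * (b ^ 2 * c ^ 2) : ℕ) : ZMod M), ?_, by simp⟩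
  generalize ((tau a b c (d.val % a) * (b ^ 2 * c ^ 2) : ℕ) : ZMod M) = t at *
  generalize d.val % a = l at *
  have e1 : g + t - d = g + (t - l) - (d - l) := by ring
  have e2 : g + t - d = t - (d - g) := by ring
  have f1 : (a : ZMod M) ∣ g + t - d := e1 ▸ dvd_sub (dvd_add ga h2) h1
  have f2 := e2 ▸ dvd_sub tb hb
  have f3 := e2 ▸ dvd_sub tc hc
  refine ⟨⟨h d hd hda _ f1 f2 f3, ?_, ?_, fun h' => hda ?_⟩, ?_⟩
  · exact (natCast_dvd_of_sq_dvd_sub f2).2 ((natCast_dvd_of_sq_dvd_sub hb).2 gb)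
  · exact (natCast_dvd_of_sq_dvd_sub f3).2 ((natCast_dvd_of_sq_dvd_sub hc).2 gc)
  · exact (dvd_sub_right h').1 f1
  · rw [add_sub_assoc]; exact dvd_add ga h2

/-- `A` is invariant, up to the period `ab²c²`, under translations by multiples of `b²c²`. -/
def ShiftClosed (a b c : ℕ) (A : Set (ZMod M)) : Prop :=
  ∀ g ∈ A, ∀ t : ℕ, ∃ m : ℤ, g - ((t * (b ^ 2 * c ^ 2) : ℕ) : ZMod M) +
    m * ((a * b ^ 2 * c ^ 2 : ℕ) : ZMod M) ∈ A

/-- Write h = d − τb²c². The shift is transferred to g, which returns to A after adding some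
multiple m of the period ab²c²; periodicity permits adding −m times that period to d. -/
theorem ShiftClosed.exists_add_eq {A D : Set (ZMod M)} (hA : ShiftClosed a b c A)
    (hD : ∀ i ∈ Set.Ico 1 a, residueClass a i (pairPart a b c D) =
      (fun x => x + ((a * b ^ 2 * c ^ 2 : ℕ) : ZMod M)) '' residueClass a i (pairPart a b c D))
    {g h : ZMod M} (hg : g ∈ A) (hh : h ∈ hatSet a b c (pairPart a b c D)) :
    ∃ g' ∈ A, ∃ d ∈ D, g' + d = g + h := by
  simp only [hatSet, Set.mem_iUnion, exists_prop] at hh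
  obtain ⟨l, hl, d, hd, rfl⟩ := hh
  obtain ⟨m, hm⟩ := hA g hg (tau a b c l)
  have h1 := add_intCast_mul_mem (hD l hl) hd (-m)
  refine ⟨_, hm, _, h1.1.1.1, ?_⟩
  push_cast
  ring

end

/-! ### A Szabó pair covers the group -/

section
variable {p q r : ℕ} [NeZero ((p * q * r) ^ 2)]

/-- The three coordinates of A solve independent congruences modulo p, q and r, so some a has g − a
in pqrℤ. Condition (IV) puts this difference in a shifted fibre part or directly in D, and shifts
can be exchanged with A. -/
theorem SzaboLeft.exists_add_eq (hp : p.Prime) (hq : q.Prime) (hr : r.Prime)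
    (hpq : p ≠ q) (hqr : q ≠ r) (hpr : p ≠ r) {A D : Set (ZMod ((p * q * r) ^ 2))}
    (hA : SzaboLeft p q r A) (hD : SzaboRight p q r D) (g : ZMod ((p * q * r) ^ 2)) :
    ∃ a ∈ A, ∃ d ∈ D, a + d = g := by
  have cpq := (Nat.coprime_primes hp hq).2 hpq
  have cqr := (Nat.coprime_primes hq hr).2 hqr
  have cpr := (Nat.coprime_primes hp hr).2 hpr
  obtain ⟨U, V, W, hU, hV, hW, rfl⟩ := hA
  set A := {x : ZMod ((p * q * r) ^ 2) | ∃ u ∈ U, ∃ v ∈ V, ∃ w ∈ W,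
      x = (((q : ℤ) ^ 2 * (r : ℤ) ^ 2 * u + (r : ℤ) ^ 2 * (p : ℤ) ^ 2 * v
        + (p : ℤ) ^ 2 * (q : ℤ) ^ 2 * w : ℤ) : ZMod ((p * q * r) ^ 2))} with hAdef
  have sp : ShiftClosed p q r A := by
    rintro _ ⟨u, hu, v, hv, w, hw, rfl⟩ t
    obtain ⟨u', hu', m, hm⟩ := hU.exists_eq_add hp.pos (u - t)
    exact ⟨m, u', hu', v, hv, w, hw, by rw [hm]; push_cast; ring⟩
  have sq : ShiftClosed q r p A := by
    rintro _ ⟨u, hu, v, hv, w, hw, rfl⟩ t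
    obtain ⟨v', hv', m, hm⟩ := hV.exists_eq_add hq.pos (v - t)
    exact ⟨m, u, hu, v', hv', w, hw, by rw [hm]; push_cast; ring⟩
  have sr : ShiftClosed r p q A := by
    rintro _ ⟨u, hu, v, hv, w, hw, rfl⟩ t
    obtain ⟨w', hw', m, hm⟩ := hW.exists_eq_add hr.pos (w - t)
    exact ⟨m, u, hu, v, hv, w', hw', by rw [hm]; push_cast; ring⟩
  obtain ⟨a, ha, h1⟩ : ∃ a ∈ A, (p : ZMod ((p * q * r) ^ 2)) ∣ g - a ∧
      (q : ZMod ((p * q * r) ^ 2)) ∣ g - a ∧ (r : ZMod ((p * q * r) ^ 2)) ∣ g - a := by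
    obtain ⟨tu, eu, hu⟩ := ZMod.exists_dvd_mul_sub (N := q ^ 2 * r ^ 2)
      (Nat.Coprime.mul_left (cpq.symm.pow_left 2) (cpr.symm.pow_left 2)) g
    obtain ⟨tv, ev, hv⟩ := ZMod.exists_dvd_mul_sub (N := r ^ 2 * p ^ 2)
      (Nat.Coprime.mul_left (cqr.symm.pow_left 2) (cpq.pow_left 2)) g
    obtain ⟨tw, ew, hw⟩ := ZMod.exists_dvd_mul_sub (N := p ^ 2 * q ^ 2)
      (Nat.Coprime.mul_left (cpr.pow_left 2) (cqr.pow_left 2)) g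
    obtain ⟨u, hu', mu, rfl⟩ := hU.exists_eq_add hp.pos tu
    obtain ⟨v, hv', mv, rfl⟩ := hV.exists_eq_add hq.pos tv
    obtain ⟨w, hw', mw, rfl⟩ := hW.exists_eq_add hr.pos tw
    refine ⟨_, ⟨_, hu', _, hv', _, hw', rfl⟩, ?_, ?_, ?_⟩
    · refine ⟨-eu - q ^ 2 * r ^ 2 * mu - r ^ 2 * p * (tv + q * mv) - p * q ^ 2 * (tw + r * mw), ?_⟩
      push_cast at hu ⊢
      linear_combination -hu
    · refine ⟨-ev - r ^ 2 * p ^ 2 * mv - r ^ 2 * q * (tu + p * mu) - p ^ 2 * q * (tw + r * mw), ?_⟩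
      push_cast at hv ⊢
      linear_combination -hv
    · refine ⟨-ew - p ^ 2 * q ^ 2 * mw - r * q ^ 2 * (tu + p * mu) - r * p ^ 2 * (tv + q * mv), ?_⟩
      push_cast at hw ⊢
      linear_combination -hw
  have h2 := (exists_natCast_mul_iff cpq cqr cpr rfl (g - a)).2 h1
  have h3 : g - a ∈ hatSet p q r (pairPart p q r D) ∪ hatSet q r p (pairPart q r p D) ∪
      hatSet r p q (pairPart r p q D) ∪ multiplesIn (p * q * r) D := by rw [hD.hat_union]; exact h2
  have h4 : a + (g - a) = g := by ring
  rcases h3 with ((h3 | h3) | h3) | h3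
  · exact h4 ▸ sp.exists_add_eq hD.periodic_qr ha h3
  · exact h4 ▸ sq.exists_add_eq hD.periodic_rp ha h3
  · exact h4 ▸ sr.exists_add_eq hD.periodic_pq ha h3
  · exact ⟨a, ha, _, h3.1, h4⟩

theorem IsSzaboPair.exists_add_eq (hp : p.Prime) (hq : q.Prime) (hr : r.Prime)
    (hpq : p ≠ q) (hqr : q ≠ r) (hpr : p ≠ r) {A B : Set (ZMod ((p * q * r) ^ 2))}
    (h : IsSzaboPair p q r A B) (g : ZMod ((p * q * r) ^ 2)) : ∃ a ∈ A, ∃ b ∈ B, a + b = g := by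
  obtain ⟨b, hb, hD⟩ := h.right
  obtain ⟨a, ha, _, ⟨b', hb', rfl⟩, e⟩ := h.left.exists_add_eq hp hq hr hpq hqr hpr hD (g - b)
  exact ⟨a, ha, b', hb', by linear_combination e⟩

end

/-! ### From digit structure to the conditions of a Szabó pair -/

section
variable {M a b c : ℕ} [NeZero M]

/-- The members of a set whose base `n` digits form a section are, modulo `n²`, the multiples of `N`
by a normalized residue system. -/
theorem exists_normalizedResidueSystem {n N : ℕ} (hn : 0 < n) (hN : N.Coprime n) (hM : n ^ 2 ∣ M)
    {A : Finset (ZMod M)} (h0 : 0 ∈ A)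
    (hs : ∀ g ∈ A, ∀ g' ∈ A, (dig n g).1 = (dig n g').1 → (dig n g).2 = (dig n g').2)
    (he : ∀ i, ∃ g ∈ A, (dig n g).1 = i) :
    ∃ U, IsNormalizedResidueSystem n U ∧
      (∀ u ∈ U, ∀ g ∈ A, (n : ZMod M) ∣ N * (u : ℤ) - g →
        ((n ^ 2 : ℕ) : ZMod M) ∣ N * (u : ℤ) - g) ∧
      ∀ g ∈ A, ∃ u ∈ U, ((n ^ 2 : ℕ) : ZMod M) ∣ N * (u : ℤ) - g := by
  have : NeZero n := ⟨hn.ne'⟩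
  have hd : (n : ZMod M) ∣ ((n ^ 2 : ℕ) : ZMod M) := Nat.cast_dvd_cast (dvd_pow_self n two_ne_zero)
  have hs' : ∀ g ∈ A, ∀ g' ∈ A, (n : ZMod M) ∣ g - g' → ((n ^ 2 : ℕ) : ZMod M) ∣ g - g' := by
    intro g hg g' hg' h
    rw [← dig_fst_eq_iff hM] at h
    exact (dig_eq_iff hM _ _).1 (Prod.ext h (hs g hg g' hg' h))
  have key : ∀ i : ℕ, ∃ u : ℤ, (i = 0 → u = 0) ∧ u ≡ i [ZMOD n] ∧
      ∃ g ∈ A, ((n ^ 2 : ℕ) : ZMod M) ∣ N * u - g := by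
    intro i
    -- The normalization u₀ = 0 uses the element 0 of A. For other i the representative is fixed
    -- modulo n² by an element of A with the required lowest digit.
    by_cases hi : i = 0
    · exact ⟨0, fun _ => rfl, by simp [hi], 0, h0, by simp⟩
    obtain ⟨g, hg, h1⟩ := he (dig n ((N * i : ℕ) : ZMod M)).1
    obtain ⟨u, hu⟩ := ZMod.exists_dvd_mul_sub (M := M) (hN.pow_right 2) g
    refine ⟨u, fun h => absurd h hi, ?_, g, hg, hu⟩
    rw [dig_fst_eq_iff hM] at h1
    have h2 : (n : ZMod M) ∣ ((N * (u - i) : ℤ) : ZMod M) := by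
      have := dvd_add (hd.trans hu) h1
      push_cast at this ⊢
      convert this using 1
      ring
    have h3 : (n : ℤ) ∣ N * (u - i) := by
      have hnM : n ∣ M := (dvd_pow_self n two_ne_zero).trans hM
      have := map_dvd (ZMod.castHom hnM (ZMod n)) h2
      rwa [map_natCast, map_intCast, ZMod.natCast_self, zero_dvd_iff,
        ZMod.intCast_zmod_eq_zero_iff_dvd] at this
    exact (Int.modEq_iff_dvd.2
      ((Int.isCoprime_iff_gcd_eq_one.2 (by simpa using hN.symm)).dvd_of_dvd_mul_left h3)).symm
  choose u h1 h2 h3 using key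
  refine ⟨u '' Set.Iio n, ⟨u, h1 0 rfl, fun i _ => h2 i, rfl⟩, ?_, ?_⟩
  · rintro _ ⟨i, -, rfl⟩ g hg h
    obtain ⟨g', hg', h4⟩ := h3 i
    have := dvd_sub h (hd.trans h4)
    rw [sub_sub_sub_cancel_left] at this
    have := dvd_add h4 (hs' _ hg' _ hg this)
    rwa [sub_add_sub_cancel] at this
  · intro g hg
    obtain ⟨t, ht⟩ := ZMod.exists_dvd_mul_sub hN g
    have hn' : (0 : ℤ) < n := by exact_mod_cast hn
    have hnn := Int.emod_nonneg t hn'.ne'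
    have hlt : (t % n).toNat < n := by
      have := Int.emod_lt_of_pos t hn'
      omega
    refine ⟨_, ⟨(t % n).toNat, hlt, rfl⟩, ?_⟩
    obtain ⟨g', hg', h4⟩ := h3 (t % n).toNat
    have h5 := h2 (t % n).toNat
    rw [Int.toNat_of_nonneg hnn] at h5
    obtain ⟨m, hm⟩ := (h5.trans (Int.mod_modEq t n)).dvd
    have h6 : (n : ZMod M) ∣ g' - g := by
      have h7 : (n : ZMod M) ∣ N * (t - u (t % n).toNat : ℤ) := by
        rw [hm]; push_cast; exact ⟨N * m, by ring⟩
      have := dvd_sub (dvd_sub ht (hd.trans h4)) h7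
      push_cast at this
      convert this using 1
      ring
    have := dvd_add h4 (hs' _ hg' _ hg h6)
    rwa [sub_add_sub_cancel] at this

end

section
variable {p q r : ℕ} [NeZero ((p * q * r) ^ 2)]

/-- Modulo p² only the term with U survives, and similarly for q and r. Sectionality fixes each
square residue from its top digit, and every combination of top digits occurs in A. -/
theorem IsSectional.szaboLeft (hp : p.Prime) (hq : q.Prime) (hr : r.Prime)
    {A B : Finset (ZMod ((p * q * r) ^ 2))} (S : IsSectional (dig p) (dig q) (dig r) A)
    (F : Factorization (dig p) (dig q) (dig r) A B) (h0 : 0 ∈ A) :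
    SzaboLeft p q r (A : Set (ZMod ((p * q * r) ^ 2))) := by
  have : Fact p.Prime := ⟨hp⟩
  have : Fact q.Prime := ⟨hq⟩
  have : Fact r.Prime := ⟨hr⟩
  have cpq := (Nat.coprime_primes hp hq).2 F.pq
  have cqr := (Nat.coprime_primes hq hr).2 F.qr
  have cpr := (Nat.coprime_primes hp hr).2 F.pr
  have dp : p ^ 2 ∣ (p * q * r) ^ 2 := pow_dvd_pow_of_dvd (by simp [mul_assoc]) 2
  have dq : q ^ 2 ∣ (p * q * r) ^ 2 := pow_dvd_pow_of_dvd ⟨p * r, by ring⟩ 2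
  have dr : r ^ 2 ∣ (p * q * r) ^ 2 := pow_dvd_pow_of_dvd (by simp) 2
  obtain ⟨U, hU, U1, U2⟩ := exists_normalizedResidueSystem (N := q ^ 2 * r ^ 2) hp.pos
    (Nat.Coprime.mul_left (cpq.symm.pow_left 2) (cpr.symm.pow_left 2)) dp h0 S.1 fun i => by
      obtain ⟨a, ha, h, -⟩ := S.exists_cell F i 0 0
      exact ⟨a, ha, h⟩
  obtain ⟨V, hV, V1, V2⟩ := exists_normalizedResidueSystem (N := r ^ 2 * p ^ 2) hq.pos
    (Nat.Coprime.mul_left (cqr.symm.pow_left 2) (cpq.pow_left 2)) dq h0 S.2.1 fun i => by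
      obtain ⟨a, ha, -, h, -⟩ := S.exists_cell F 0 i 0
      exact ⟨a, ha, h⟩
  obtain ⟨W, hW, W1, W2⟩ := exists_normalizedResidueSystem (N := p ^ 2 * q ^ 2) hr.pos
    (Nat.Coprime.mul_left (cpr.pow_left 2) (cqr.pow_left 2)) dr h0 S.2.2 fun i => by
      obtain ⟨a, ha, -, -, h⟩ := S.exists_cell F 0 0 i
      exact ⟨a, ha, h⟩
  refine ⟨U, V, W, hU, hV, hW, Set.ext fun g => ⟨fun hg => ?_, ?_⟩⟩
  · obtain ⟨u, hu, eu, u1⟩ := U2 g hg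
    obtain ⟨v, hv, ev, v1⟩ := V2 g hg
    obtain ⟨w, hw, ew, w1⟩ := W2 g hg
    refine ⟨u, hu, v, hv, w, hw, (ZMod.eq_of_sq_dvd_sub cpq cqr cpr rfl ?_ ?_ ?_).symm⟩
    · refine ⟨eu + r ^ 2 * v + q ^ 2 * w, ?_⟩
      push_cast at u1 ⊢
      linear_combination u1
    · refine ⟨ev + r ^ 2 * u + p ^ 2 * w, ?_⟩
      push_cast at v1 ⊢
      linear_combination v1
    · refine ⟨ew + q ^ 2 * u + p ^ 2 * v, ?_⟩
      push_cast at w1 ⊢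
      linear_combination w1
  · rintro ⟨u, hu, v, hv, w, hw, hg⟩
    obtain ⟨a, ha, h1, h2, h3⟩ := S.exists_cell F (dig p g).1 (dig q g).1 (dig r g).1
    rw [eq_comm, dig_fst_eq_iff dp] at h1
    rw [eq_comm, dig_fst_eq_iff dq] at h2
    rw [eq_comm, dig_fst_eq_iff dr] at h3
    have e1 : g - a = ((q ^ 2 * r ^ 2 : ℕ) * u - a) +
        ((p ^ 2 : ℕ) : ZMod ((p * q * r) ^ 2)) * (r ^ 2 * v + q ^ 2 * w) := by
      rw [hg]; push_cast; ring
    have e2 : g - a = ((r ^ 2 * p ^ 2 : ℕ) * v - a) +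
        ((q ^ 2 : ℕ) : ZMod ((p * q * r) ^ 2)) * (r ^ 2 * u + p ^ 2 * w) := by
      rw [hg]; push_cast; ring
    have e3 : g - a = ((p ^ 2 * q ^ 2 : ℕ) * w - a) +
        ((r ^ 2 : ℕ) : ZMod ((p * q * r) ^ 2)) * (q ^ 2 * u + p ^ 2 * v) := by
      rw [hg]; push_cast; ring
    have hd : ∀ n : ℕ, (n : ZMod ((p * q * r) ^ 2)) ∣ ((n ^ 2 : ℕ) : ZMod ((p * q * r) ^ 2)) :=
      fun n => Nat.cast_dvd_cast (dvd_pow_self n two_ne_zero)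
    have f1 := U1 u hu a ha ((dvd_add_left ((hd p).mul_right _)).1 (e1 ▸ h1))
    have f2 := V1 v hv a ha ((dvd_add_left ((hd q).mul_right _)).1 (e2 ▸ h2))
    have f3 := W1 w hw a ha ((dvd_add_left ((hd r).mul_right _)).1 (e3 ▸ h3))
    have : g = a := ZMod.eq_of_sq_dvd_sub cpq cqr cpr rfl
      (e1 ▸ dvd_add f1 (dvd_mul_right _ _)) (e2 ▸ dvd_add f2 (dvd_mul_right _ _))
      (e3 ▸ dvd_add f3 (dvd_mul_right _ _))
    exact this ▸ ha

/-- After moving an element of the central cell to 0, majority becomes divisibility by two of the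
primes, giving (II). Non-confinement makes each arm nonempty; fibre closure and coverage of the
centre give (III) and (IV). -/
theorem IsSectional.exists_szaboRight (hp : p.Prime) (hq : q.Prime) (hr : r.Prime)
    {A B : Finset (ZMod ((p * q * r) ^ 2))} (S : IsSectional (dig p) (dig q) (dig r) A)
    (F : Factorization (dig p) (dig q) (dig r) A B) {c₁ : ZMod p} {c₂ : ZMod q} {c₃ : ZMod r}
    (m : IsMajority (dig p) (dig q) (dig r) B c₁ c₂ c₃) :
    ∃ b ∈ (B : Set (ZMod ((p * q * r) ^ 2))), SzaboRight p q r ((fun x => x - b) '' B) := by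
  have : Fact p.Prime := ⟨hp⟩
  have : Fact q.Prime := ⟨hq⟩
  have : Fact r.Prime := ⟨hr⟩
  have cpq := (Nat.coprime_primes hp hq).2 F.pq
  have cqr := (Nat.coprime_primes hq hr).2 F.qr
  have cpr := (Nat.coprime_primes hp hr).2 F.pr
  have dp : p ^ 2 ∣ (p * q * r) ^ 2 := pow_dvd_pow_of_dvd (by simp [mul_assoc]) 2
  have dq : q ^ 2 ∣ (p * q * r) ^ 2 := pow_dvd_pow_of_dvd ⟨p * r, by ring⟩ 2
  have dr : r ^ 2 ∣ (p * q * r) ^ 2 := pow_dvd_pow_of_dvd (by simp) 2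
  have hinj : ∀ g g' : ZMod ((p * q * r) ^ 2), dig p g = dig p g' → dig q g = dig q g' →
      dig r g = dig r g' → g = g' := fun g g' h1 h2 h3 => ZMod.eq_of_sq_dvd_sub cpq cqr cpr rfl
    ((dig_eq_iff dp _ _).1 h1) ((dig_eq_iff dq _ _).1 h2) ((dig_eq_iff dr _ _).1 h3)
  obtain ⟨b, hb, b1, b2, b3⟩ := S.exists_center F m
  subst b1 b2 b3
  refine ⟨b, hb, ?_⟩
  set D : Set (ZMod ((p * q * r) ^ 2)) := (fun x => x - b) '' B with hDdef
  have hD : ∀ g, g ∈ D ↔ g + b ∈ B := fun g => by simp [hDdef, sub_eq_iff_eq_add]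
  have fp : FiberClosed p q r D := by
    intro g hg hgp h h1 h2 h3
    rw [hD] at hg ⊢
    refine S.mem_of_fiber F m hinj hg ?_ ((dig_fst_eq_iff dp _ _).2 (by simpa))
      ((dig_eq_iff dq _ _).2 (by simpa using h2)) ((dig_eq_iff dr _ _).2 (by simpa using h3))
    rwa [Ne, dig_fst_eq_iff dp, add_sub_cancel_right]
  have fq : FiberClosed q r p D := by
    intro g hg hgp h h1 h2 h3
    rw [hD] at hg ⊢
    refine S.swap_xy.mem_of_fiber F.swap_xy m.swap_xy (fun g g' e1 e2 => hinj g g' e2 e1) hg ?_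
      ((dig_fst_eq_iff dq _ _).2 (by simpa))
      ((dig_eq_iff dp _ _).2 (by simpa using h3)) ((dig_eq_iff dr _ _).2 (by simpa using h2))
    rwa [Ne, dig_fst_eq_iff dq, add_sub_cancel_right]
  have fr : FiberClosed r p q D := by
    intro g hg hgp h h1 h2 h3
    rw [hD] at hg ⊢
    refine S.swap_yz.swap_xy.mem_of_fiber F.swap_yz.swap_xy m.swap_yz.swap_xy
      (fun g g' e1 e2 e3 => hinj g g' e2 e3 e1) hg ?_
      ((dig_fst_eq_iff dr _ _).2 (by simpa))
      ((dig_eq_iff dp _ _).2 (by simpa using h2)) ((dig_eq_iff dq _ _).2 (by simpa using h3))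
    rwa [Ne, dig_fst_eq_iff dr, add_sub_cancel_right]
  have maj : ∀ g ∈ D, ((q : ZMod ((p * q * r) ^ 2)) ∣ g ∧ (r : ZMod ((p * q * r) ^ 2)) ∣ g) ∨
      ((p : ZMod ((p * q * r) ^ 2)) ∣ g ∧ (r : ZMod ((p * q * r) ^ 2)) ∣ g) ∨
      ((p : ZMod ((p * q * r) ^ 2)) ∣ g ∧ (q : ZMod ((p * q * r) ^ 2)) ∣ g) := by
    intro g hg
    have := m _ ((hD g).1 hg)
    simpa only [dig_fst_eq_iff dp, dig_fst_eq_iff dq, dig_fst_eq_iff dr,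
      add_sub_cancel_right] using this
  have hM2 : (p * q * r) ^ 2 = (q * r * p) ^ 2 := by ring
  have hM3 : (p * q * r) ^ 2 = (r * p * q) ^ 2 := by ring
  have Pp := pairPart_eq cpq cqr cpr rfl D
  have Pq := pairPart_eq cqr cpr.symm cpq.symm hM2 D
  have Pr := pairPart_eq cpr.symm cpq cqr.symm hM3 D
  have P0 := multiplesIn_eq cpq cqr cpr rfl D
  refine ⟨?_, ?_, ?_, ?_, ?_, fun i _ => fp.residueClass_eq cpq cqr cpr rfl i,
    fun i _ => fq.residueClass_eq cqr cpr.symm cpq.symm hM2 i,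
    fun i _ => fr.residueClass_eq cpr.symm cpq cqr.symm hM3 i, ?_⟩
  · rw [Pp, Pq, Pr, P0]
    ext g
    have := maj g
    simp only [Set.mem_union, Set.mem_ofPred_eq]
    tauto
  · obtain ⟨d, hd, h⟩ := F.spreadBx (dig p b).1
    rw [Ne, dig_fst_eq_iff dp] at h
    have hd' : d - b ∈ D := ⟨d, hd, rfl⟩
    have := maj _ hd'
    simp only [h, false_and, or_false] at this
    exact ⟨d - b, by rw [Pp]; exact ⟨hd', this.1, this.2, h⟩⟩
  · obtain ⟨d, hd, h⟩ := F.spreadBy (dig q b).1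
    rw [Ne, dig_fst_eq_iff dq] at h
    have hd' : d - b ∈ D := ⟨d, hd, rfl⟩
    have := maj _ hd'
    simp only [h, false_and, and_false, false_or, or_false] at this
    exact ⟨d - b, by rw [Pq]; exact ⟨hd', this.2, this.1, h⟩⟩
  · obtain ⟨d, hd, h⟩ := F.spreadBz (dig r b).1
    rw [Ne, dig_fst_eq_iff dr] at h
    have hd' : d - b ∈ D := ⟨d, hd, rfl⟩
    have := maj _ hd'
    simp only [h, and_false, false_or] at this
    exact ⟨d - b, by rw [Pr]; exact ⟨hd', this.1, this.2, h⟩⟩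
  · exact ⟨0, by rw [P0]; exact ⟨(hD 0).2 (by simpa using hb), by simp⟩⟩
  · ext g
    rw [Set.mem_ofPred_eq, exists_natCast_mul_iff cpq cqr cpr rfl]
    constructor
    · rintro (((h | h) | h) | h)
      · exact hatSet_subset hp.pos cpq cqr cpr rfl h
      · obtain ⟨h1, h2, h3⟩ := hatSet_subset hq.pos cqr cpr.symm cpq.symm hM2 h
        exact ⟨h3, h1, h2⟩
      · obtain ⟨h1, h2, h3⟩ := hatSet_subset hr.pos cpr.symm cpq cqr.symm hM3 h
        exact ⟨h2, h3, h1⟩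
      · rw [P0] at h
        exact h.2
    · rintro ⟨gp, gq, gr⟩
      rcases S.exists_mem_through F m hinj (g := g + b) ((dig_fst_eq_iff dp _ _).2 (by simpa))
        ((dig_fst_eq_iff dq _ _).2 (by simpa)) ((dig_fst_eq_iff dr _ _).2 (by simpa)) with
        h | ⟨d, hd, h⟩
      · exact Or.inr (by rw [P0]; exact ⟨(hD g).2 h, gp, gq, gr⟩)
      · have hd' : d - b ∈ D := ⟨d, hd, rfl⟩
        simp only [Ne, dig_fst_eq_iff dp, dig_fst_eq_iff dq, dig_fst_eq_iff dr, dig_eq_iff dp,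
          dig_eq_iff dq, dig_eq_iff dr, sub_add_eq_sub_sub_swap] at h
        refine Or.inl ?_
        rcases h with ⟨h1, h2, h3⟩ | ⟨h1, h2, h3⟩ | ⟨h1, h2, h3⟩
        · exact Or.inl (Or.inl (fp.mem_hatSet hp.pos cpq cqr cpr rfl hd' h1 gp gq gr h2 h3))
        · exact Or.inl (Or.inr
            (fq.mem_hatSet hq.pos cqr cpr.symm cpq.symm hM2 hd' h1 gq gr gp h2 h3))
        · exact Or.inr (fr.mem_hatSet hr.pos cpr.symm cpq cqr.symm hM3 hd' h1 gr gp gq h2 h3)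

/-! ### Uniqueness by counting and the final equivalence -/

theorem isComplement_of_exists_add_eq {A B : Set (ZMod ((p * q * r) ^ 2))}
    (hA : A.ncard = p * q * r) (hB : B.ncard = p * q * r)
    (h : ∀ g, ∃ a ∈ A, ∃ b ∈ B, a + b = g) : AddSubgroup.IsComplement A B := by
  classical
  have hT : Tiles id A.toFinset B.toFinset := by
    refine tiles_of_surjOn ?_ (by simpa using h)
    rw [← Set.ncard_eq_toFinset_card', ← Set.ncard_eq_toFinset_card', hA, hB, ZMod.card, pow_two]
  constructor
  · rintro ⟨a, b⟩ ⟨a', b'⟩ e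
    have := hT.injOn (x₁ := (↑a, ↑b)) (x₂ := (↑a', ↑b')) (by simp) (by simp) e
    simp only [Prod.mk.injEq] at this
    exact Prod.ext (Subtype.ext this.1) (Subtype.ext this.2)
  · intro g
    obtain ⟨a, ha, b, hb, e⟩ := h g
    exact ⟨(⟨a, ha⟩, ⟨b, hb⟩), e⟩

end

theorem theorem1p1 (p q r : ℕ) (hp : p.Prime) (hq : q.Prime) (hr : r.Prime)
    (hpq : p ≠ q) (hqr : q ≠ r) (hpr : p ≠ r)
    (A B : Set (ZMod ((p * q * r) ^ 2)))
    (hA0 : 0 ∈ A) (hB0 : 0 ∈ B)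
    (hAcard : A.ncard = p * q * r) (hBcard : B.ncard = p * q * r)
    (hA : ∀ H : AddSubgroup (ZMod ((p * q * r) ^ 2)), A ⊆ (H : Set _) → H = ⊤)
    (hB : ∀ H : AddSubgroup (ZMod ((p * q * r) ^ 2)), B ⊆ (H : Set _) → H = ⊤) :
    AddSubgroup.IsComplement A B ↔ IsSzaboPair p q r A B ∨ IsSzaboPair p q r B A := by
  classical
  have hM : NeZero ((p * q * r) ^ 2) :=
    ⟨pow_ne_zero 2 (mul_ne_zero (mul_ne_zero hp.ne_zero hq.ne_zero) hr.ne_zero)⟩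
  have : Fact p.Prime := ⟨hp⟩
  have : Fact q.Prime := ⟨hq⟩
  have : Fact r.Prime := ⟨hr⟩
  constructor
  · intro h
    have hAc : A.toFinset.card = p * q * r := by rw [← Set.ncard_eq_toFinset_card', hAcard]
    have hBc : B.toFinset.card = p * q * r := by rw [← Set.ncard_eq_toFinset_card', hBcard]
    have hT : Tiles id A.toFinset B.toFinset := by
      refine tiles_of_surjOn (by rw [hAc, hBc, ZMod.card, pow_two]) fun g => ?_
      obtain ⟨⟨a, b⟩, e⟩ := h.surjective g
      exact ⟨a, by simp, b, by simp, e⟩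
    have F := hT.factorization hp hq hr hpq hqr hpr (by simpa) (by simpa) hAc hBc (by simpa)
      (by simpa)
    rcases F.sectional_majority with ⟨S, c₁, c₂, c₃, m⟩ | ⟨S, c₁, c₂, c₃, m⟩
    · have h1 := S.szaboLeft hp hq hr F (by simpa)
      have h2 := S.exists_szaboRight hp hq hr F m
      rw [Set.coe_toFinset] at h1 h2
      exact Or.inl ⟨hA0, hB0, hAcard, hBcard, h1, h2⟩
    · have h1 := S.szaboLeft hp hq hr F.swap (by simpa)
      have h2 := S.exists_szaboRight hp hq hr F.swap m
      rw [Set.coe_toFinset] at h1 h2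
      exact Or.inr ⟨hB0, hA0, hBcard, hAcard, h1, h2⟩
  · rintro (h | h)
    · exact isComplement_of_exists_add_eq hAcard hBcard (h.exists_add_eq hp hq hr hpq hqr hpr)
    · refine isComplement_of_exists_add_eq hAcard hBcard fun g => ?_
      obtain ⟨b, hb, a, ha, e⟩ := h.exists_add_eq hp hq hr hpq hqr hpr g
      exact ⟨a, ha, b, hb, (add_comm a b).trans e⟩
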